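/- **Setting.** Fix integers $1\le J^*\le J$. Let $\Omega=C[0,\infty)^J$ with the $\sigma$-algebra generated by the evaluations $\omega\mapsto\omega(t)$; write $\omega=(S_1,\dots,S_J)$. A *stopping time* is a measurable $\tau:\Omega\to[0,\infty]$ such that $\omega|_{[0,\tau(\omega)]}=\omega'|_{[0,\tau(\omega)]}$ implies $\tau(\omega)=\tau(\omega')$. A *simple capital process* is $$c+\sum_{n\ge1}h_n(\omega)\cdot\bigl(\omega^*(\tau_{n+1}\wedge t)-\omega^*(\tau_n\wedge t)\bigr),\qquad \omega^*=(S_1,\dots,S_{J^*}),$$ where $c\in\mathbb R$, $\tau_1\le\tau_2\le\cdots$ are stopping times with $\tau_n(\omega)\to\infty$ for each $\omega$, and $h_n:\Omega\to\mathbb R^{J^*}$ are bounded, measurable and satisfy $h_n(\omega)=h_n(\omega')$ whenever $\omega|_{[0,\tau_n(\omega)]}=\omega'|_{[0,\tau_n(\omega)]}$. *Nonnegative supermartingales* form the smallest class of functions $[0,\infty)\times\Omega\to[0,\infty]$ that contains all nonnegative simple capital processes and is closed under pointwise $\liminf$ of sequences. A property of $(t,\omega)$ holds *quasi-always* (q.a.)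 if there is a nonnegative supermartingale with initial value $1$ that is infinite at every $(t,\omega)$ where the property fails. A *continuous process* is a map $X:[0,\infty)\times\Omega\to\mathbb R\cup\{\partial\}$ such that $X_t(\omega)$ depends on $\omega$ only through $\omega|_{[0,t]}$, $X$ is real q.a., and for each $\omega$ the set $\{t: X_t(\omega)\in\mathbb R\}$ is connected, contains $0$, and $t\mapsto X_t(\omega)$ is continuous on it; $\operatorname{dom}X$ is the set of $(t,\omega)$ with $X_t(\omega)\in\mathbb R$. *Continuous martingales* form the smallest class of continuous processes that contains all simple capital processes and contains every continuous process $X$ for which there are $X^k$ in the class with $\operatorname{dom}X\subseteq\operatorname{dom}X^k$ and $\sup_{s\le t}|X^k_s(\omega)-X_s(\omega)|\to0$ for all $(t,\omega)\in\operatorname{dom}X$. A *finite variation continuous process* is a continuous process $A$ with $A_0=0$ and with finite total variation over $[0,t]$ for all $(t,\omega)\in\operatorname{dom}A$. A *continuous semimartingale* is a continuous process $X=Y+A$ with $Y$ a continuous martingale, $A$ a finite variation continuous process, and $\operatorname{dom}X=\operatorname{dom}Y=\operatorname{dom}A$ (a *standard decomposition*). A *partition* is a sequence of stopping times $0=T_0\le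 T_1\le\cdots$ with $\lim_kT_k>t$ q.a. A sequence $T^1,T^2,\dots$ of partitions is *fine* for a continuous process $X$ if, for all $n$, $k$ and $\omega$, the oscillation of $X(\omega)$ over the part of $[T^n_{k-1}(\omega),T^n_k(\omega)]$ where $X$ is real is at most $2^{-n}$. It is fine for a continuous semimartingale if it is fine for both components of a standard decomposition. Along a fine sequence of partitions the *quadratic variation* $[X]$ is the limit, uniform on compact time intervals, of $$[X]^n_t=\sum_{k\ge1}\bigl(X_{T^n_k\wedge t}-X_{T^n_{k-1}\wedge t}\bigr)^2,\qquad (t,\omega)\in\operatorname{dom}X,\ \lim_kT^n_k(\omega)>t,$$ and $[X]_t(\omega):=\partial$ if some $[X]^n_t(\omega)$ is not defined or if there is no uniform convergence over $[0,t]$. Expressions involving $\partial$ have the value $\partial$. A continuous martingale is *positive* if it is positive on its effective domain. For a positive continuous martingale $Y$, $\ln Y$ is understood as a continuous semimartingale $Z$ with $\operatorname{dom}Z\subseteq\operatorname{dom}Y$ and $Z=\ln Y$ on $\operatorname{dom}Z$ (a version of $\ln Y$). **Theorem.** 1. If $X$ is a continuous martingale, then sequences of partitions fine for $X$ exist and,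 along any of them, $\mathcal E(X):=\exp(X-[X]/2)$ is a continuous martingale. 2. If $Y$ is a positive continuous martingale, then a version of $\ln Y$ and a sequence of partitions fine for it exist, and, for any of them, $\mathcal L(Y):=\ln Y+[\ln Y]/2$ is a continuous martingale. 3. For any continuous martingale $X$, $\mathcal L(\mathcal E(X))=X$ q.a. 4. For any positive continuous martingale $Y$, $\mathcal E(\mathcal L(Y))=Y$ q.a. In 3 and 4 the quadratic variations and the version of the logarithm may be taken along any (possibly different) fine sequences of partitions and for any version. -/

import Mathlib

open scoped NNReal ENNReal Topology
open Filter

noncomputable section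

/-- A market with `numPaths` basic continuous paths, of which the first `numTraded` are the
price paths of traded securities; the others are information paths. -/
structure Market where
  numPaths : ℕ
  numTraded : ℕ
  one_le_numTraded : 1 ≤ numTraded
  numTraded_le : numTraded ≤ numPaths

namespace Market

/-- The sample space `C[0,∞)^J`. -/
def Omega (M : Market) : Type := Fin M.numPaths → C(ℝ≥0, ℝ)

variable {M : Market}

/-- `ω(t) = (S_1(t), …, S_J(t))`. -/
def path (ω : M.Omega) (t : ℝ≥0) : Fin M.numPaths → ℝ := fun j => ω j t

/-- The price `S_j(t)` of the `j`th traded security. -/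
def price (ω : M.Omega) (j : Fin M.numTraded) (t : ℝ≥0) : ℝ :=
  path ω t (Fin.castLE M.numTraded_le j)

/-- The σ-algebra generated by the evaluations `ω ↦ ω(t)`. -/
instance instMeasurableSpaceOmega : MeasurableSpace M.Omega :=
  ⨆ t : ℝ≥0, MeasurableSpace.comap (fun ω : M.Omega => path ω t) MeasurableSpace.pi

/-- `ω|_{[0,a]} = ω'|_{[0,a]}`, where `a` may be infinite. -/
def AgreeUpTo (ω ω' : M.Omega) (a : ℝ≥0∞) : Prop :=
  ∀ s : ℝ≥0, (s : ℝ≥0∞) ≤ a → path ω s = path ω' s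

/-- Stopping times. -/
def IsStoppingTime (τ : M.Omega → ℝ≥0∞) : Prop :=
  Measurable τ ∧ ∀ ω ω' : M.Omega, AgreeUpTo ω ω' (τ ω) → τ ω = τ ω'

/-- `a ∧ t` as a finite time. -/
def minTime (a : ℝ≥0∞) (t : ℝ≥0) : ℝ≥0 := (min a (t : ℝ≥0∞)).toNNReal

/-- Simple trading strategies. The sequences are indexed from `0`. -/
structure SimpleStrategy (M : Market) where
  time : ℕ → M.Omega → ℝ≥0∞
  bet : ℕ → M.Omega → (Fin M.numTraded → ℝ)
  stopping : ∀ n, IsStoppingTime (time n)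
  mono : ∀ ω, Monotone fun n => time n ω
  tendsto_top : ∀ ω, Tendsto (fun n => time n ω) atTop (𝓝 ⊤)
  bet_measurable : ∀ n, Measurable (bet n)
  bet_bounded : ∀ n, ∃ C : ℝ, ∀ ω j, |bet n ω j| ≤ C
  bet_stopped : ∀ n, ∀ ω ω' : M.Omega, AgreeUpTo ω ω' (time n ω) → bet n ω = bet n ω'

/-- The simple capital process with strategy `G` and initial capital `c`. For each `t` and `ω`
only finitely many terms of the sum are nonzero, since the times tend to infinity. -/
def capital (G : SimpleStrategy M) (c : ℝ) (t : ℝ≥0) (ω : M.Omega) : ℝ :=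
  c + ∑' n, ∑ j, G.bet n ω j *
    (price ω j (minTime (G.time (n + 1) ω) t) - price ω j (minTime (G.time n ω) t))

/-- Nonnegative supermartingales: the smallest liminf-closed class of nonnegative
(`[0,∞]`-valued) processes that contains all nonnegative simple capital processes. -/
inductive IsNonnegSupermartingale : (ℝ≥0 → M.Omega → ℝ≥0∞) → Prop
  | simple (G : SimpleStrategy M) (c : ℝ) (hnonneg : ∀ t ω, 0 ≤ capital G c t ω) :
      IsNonnegSupermartingale fun t ω => ENNReal.ofReal (capital G c t ω)
  | liminf (X : ℕ → ℝ≥0 → M.Omega → ℝ≥0∞) (hX : ∀ k, IsNonnegSupermartingale (X k)) :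
      IsNonnegSupermartingale fun t ω => Filter.liminf (fun k => X k t ω) atTop

/-- A property of `t` and `ω` holds quasi-always. -/
def QuasiAlways (E : ℝ≥0 → M.Omega → Prop) : Prop :=
  ∃ X : ℝ≥0 → M.Omega → ℝ≥0∞, IsNonnegSupermartingale X ∧ (∀ ω, X 0 ω = 1) ∧
    ∀ t ω, ¬ E t ω → X t ω = ⊤

/-- Processes with values in `ℝ ∪ {cemetery}`; the cemetery state is `none`. -/
abbrev ExtProc (M : Market) : Type := ℝ≥0 → M.Omega → Option ℝ

/-- `(t, ω)` belongs to the effective domain of `X`. -/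
def InDom (X : ExtProc M) (t : ℝ≥0) (ω : M.Omega) : Prop := (X t ω).isSome

/-- The real value of `X` (only used inside the effective domain). -/
def val (X : ExtProc M) (t : ℝ≥0) (ω : M.Omega) : ℝ := (X t ω).getD 0

def IsAdapted (X : ExtProc M) : Prop :=
  ∀ (t : ℝ≥0) (ω ω' : M.Omega), AgreeUpTo ω ω' t → X t ω = X t ω'

/-- Continuous processes (in the sense that allows a cemetery state). -/
structure IsContinuousProcess (X : ExtProc M) : Prop where
  adapted : IsAdapted X
  quasiAlways_real : QuasiAlways (InDom X)
  zero_mem : ∀ ω, InDom X 0 ω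
  connected : ∀ ω, IsConnected {t | InDom X t ω}
  continuousOn : ∀ ω, ContinuousOn (fun t => val X t ω) {t | InDom X t ω}

/-- Continuous martingales: the smallest lim-closed class of continuous processes that contains
all simple capital processes. -/
inductive IsContinuousMartingale : ExtProc M → Prop
  | simple (G : SimpleStrategy M) (c : ℝ) :
      IsContinuousMartingale fun t ω => some (capital G c t ω)
  | lim (X : ExtProc M) (Xs : ℕ → ExtProc M) (hX : IsContinuousProcess X)
      (hXs : ∀ k, IsContinuousMartingale (Xs k))
      (hdom : ∀ k t ω, InDom X t ω → InDom (Xs k) t ω)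
      (hlim : ∀ t ω, InDom X t ω →
        TendstoUniformlyOn (fun k s => val (Xs k) s ω) (fun s => val X s ω) atTop (Set.Icc 0 t)) :
      IsContinuousMartingale X

/-- Finite variation continuous processes. -/
def IsFiniteVariation (A : ExtProc M) : Prop :=
  IsContinuousProcess A ∧ (∀ ω, A 0 ω = some 0) ∧
    ∀ t ω, InDom A t ω → BoundedVariationOn (fun s => val A s ω) (Set.Icc 0 t)

/-- `X = Y + A` is a standard decomposition of `X`: `Y` is a continuous martingale, `A` is a
finite variation continuous process, and the three effective domains coincide. -/
def IsStandardDecomposition (X Y A : ExtProc M) : Prop :=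
  IsContinuousProcess X ∧ IsContinuousMartingale Y ∧ IsFiniteVariation A ∧
    (∀ t ω, InDom X t ω ↔ InDom Y t ω) ∧ (∀ t ω, InDom X t ω ↔ InDom A t ω) ∧
    ∀ t ω, InDom X t ω → val X t ω = val Y t ω + val A t ω

/-- Continuous semimartingales. -/
def IsContinuousSemimartingale (X : ExtProc M) : Prop :=
  ∃ Y A : ExtProc M, IsStandardDecomposition X Y A

/-- Partitions: increasing sequences `0 = T_0 ≤ T_1 ≤ …` of stopping times such that
`lim_k T_k > t` quasi-always. -/
structure IsPartition (T : ℕ → M.Omega → ℝ≥0∞) : Prop where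
  stopping : ∀ k, IsStoppingTime (T k)
  zero : ∀ ω, T 0 ω = 0
  mono : ∀ ω, Monotone fun k => T k ω
  quasiAlways_gt : QuasiAlways fun t ω => (t : ℝ≥0∞) < ⨆ k, T k ω

/-- The sequence `T 0, T 1, …` of partitions is fine for `Y`: the oscillation of `Y` over each
interval of the `n`th partition, `n = 1, 2, …`, is at most `2^{-n}`. (The `n`th partition is
`T (n - 1)`, since the sequence is indexed from `0`.) -/
def IsFine (T : ℕ → ℕ → M.Omega → ℝ≥0∞) (Y : ExtProc M) : Prop :=
  (∀ n, IsPartition (T n)) ∧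
    ∀ (n k : ℕ) (ω : M.Omega) (s t : ℝ≥0),
      InDom Y s ω → InDom Y t ω →
      (s : ℝ≥0∞) ∈ Set.Icc (T n k ω) (T n (k + 1) ω) →
      (t : ℝ≥0∞) ∈ Set.Icc (T n k ω) (T n (k + 1) ω) →
      val Y s ω - val Y t ω ≤ (1 / 2 : ℝ) ^ (n + 1)

/-- The sequence of partitions is fine for both components of a standard decomposition of the
continuous semimartingale `X`. -/
def IsFineForSemimartingale (T : ℕ → ℕ → M.Omega → ℝ≥0∞) (X : ExtProc M) : Prop :=
  ∃ Y A : ExtProc M, IsStandardDecomposition X Y A ∧ IsFine T Y ∧ IsFine T A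

open Classical in
/-- The approximation `∑_k (X_{T_{k+1} ∧ t} - X_{T_k ∧ t})²` of the quadratic variation. It is in
the cemetery state where `X` is, and where `lim_k T_k ≤ t`; elsewhere the sum is finite. -/
def quadVarApprox (T : ℕ → M.Omega → ℝ≥0∞) (X : ExtProc M) : ExtProc M := fun t ω =>
  if InDom X t ω ∧ (t : ℝ≥0∞) < ⨆ k, T k ω then
    some (∑' k, (val X (minTime (T (k + 1) ω) t) ω - val X (minTime (T k ω) t) ω) ^ 2)
  else none

open Classical in
/-- The limit of a sequence of processes, uniform on compact time intervals. At `(t, ω)` it is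
in the cemetery state unless all `X k` are real there and converge uniformly over `[0,t]`. -/
def ucLimit (X : ℕ → ExtProc M) : ExtProc M := fun t ω =>
  if (∀ k, InDom (X k) t ω) ∧
      ∃ f : ℝ≥0 → ℝ, TendstoUniformlyOn (fun k s => val (X k) s ω) f atTop (Set.Icc 0 t) then
    some (limUnder atTop fun k => val (X k) t ω)
  else none

/-- The quadratic variation `[X]`, computed along the sequence `T` of partitions. -/
def quadVar (T : ℕ → ℕ → M.Omega → ℝ≥0∞) (X : ExtProc M) : ExtProc M :=
  ucLimit fun n => quadVarApprox (T n) X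

/-- `exp(X - [X]/2)`, with `[X]` computed along `T`. -/
def doleansExp (T : ℕ → ℕ → M.Omega → ℝ≥0∞) (X : ExtProc M) : ExtProc M := fun t ω =>
  Option.map₂ (fun x q => Real.exp (x - q / 2)) (X t ω) (quadVar T X t ω)

/-- `Y` is positive (wherever it is real). -/
def IsPositive (Y : ExtProc M) : Prop := ∀ t ω, InDom Y t ω → 0 < val Y t ω

/-- `Z` is a version of `ln Y` as a continuous semimartingale: `Z` is a continuous
semimartingale that is equal to `ln Y` on its effective domain, which is contained in that
of `Y` (and holds quasi-always, `Z` being a continuous process). -/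
def IsLogSemimartingale (Y Z : ExtProc M) : Prop :=
  IsContinuousSemimartingale Z ∧
    ∀ t ω, InDom Z t ω → InDom Y t ω ∧ val Z t ω = Real.log (val Y t ω)

/-- `Z + [Z]/2`, with `[Z]` computed along `T`. For a version `Z` of `ln Y` this is the Doléans
logarithm of `Y`. -/
def doleansLog (T : ℕ → ℕ → M.Omega → ℝ≥0∞) (Z : ExtProc M) : ExtProc M := fun t ω =>
  Option.map₂ (fun z q => z + q / 2) (Z t ω) (quadVar T Z t ω)

end Market

end

noncomputable section

namespace Market

/-! ### Truncated times and sums over the intervals of a partition of a time axis -/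

/-! Continuous martingales are closed under limits that are uniform on compact time intervals, and
simple integrals of a continuous martingale along a partition are again continuous martingales. So
the Doléans exponential and logarithm only have to be exhibited as limits of such integrals. Let Δ
be the increment of X over a partition interval and c = X_0. Betting e^c ∏ (1 + Δ), the product
being over the past intervals, yields e^c ∏ (1 + Δ) = exp(c + ∑ log(1 + Δ)), and log(1 + Δ) = Δ -
Δ²/2 + O(Δ³). Along a fine sequence the cubic errors are a vanishing multiple of the sum of squares,
so the limit is exp(X - [X]/2) (`isContinuousMartingale_doleansExp`). Dually, the integral of 1/Y
against Y is a sum of terms exp(Δ) - 1 = Δ + Δ²/2 + O(Δ³), with Δ now an increment of ln Y, and its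
limit is ln Y + [ln Y]/2 (`isContinuousMartingale_doleansLog`).

That the limits exist quasi-always rests on `IsContinuousMartingale.quasiAlways_tendsto`. If two
integrands differ by at most δ and X moves by at most K, the difference D of the integrals satisfies
D² ≤ δ²K² + (a simple integral against X). Until |D| reaches l the right side is a nonnegative
martingale, started from δ²K² and at least l² when |D| = l;
`IsContinuousMartingale.exists_supermartingale` turns it into a nonnegative supermartingale. A
Borel–Cantelli sum over n with δ = C 2^{-n} and l = (3/4)^n concludes. Applied to the integrals of X
against X this gives [X]. Applied to those of 1/Y against Y it gives a martingale L and, by the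
expansion above, the convergence of the sums of squares of ln Y; hence ln Y = L - [ln Y]/2 is a
semimartingale (`exists_isLogSemimartingale`).

Statements 3 and 4 follow from uniqueness: a continuous martingale X of finite variation with X_0 =
0 vanishes quasi-always (`IsContinuousMartingale.quasiAlways_eq_zero`), because [nX] = 0 makes
exp(nX) a positive martingale for every n, and exp(nX) tends to infinity where X > 0. The two sides
of 3 differ by a process of finite variation. For 4, L(Y) and the martingale part of ln Y differ by
one, so they coincide, and so do their quadratic variations.

Bets must be bounded and measurable on the whole sample space, while processes are controlled only
on their effective domains. This is why measurable versions, hitting times of such versions and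
clipped bets are needed. -/

lemma coe_minTime (a : ℝ≥0∞) (t : ℝ≥0) : ((minTime a t : ℝ≥0) : ℝ≥0∞) = min a t :=
  ENNReal.coe_toNNReal (ne_top_of_le_ne_top ENNReal.coe_ne_top (min_le_right _ _))

lemma minTime_le (a : ℝ≥0∞) (t : ℝ≥0) : minTime a t ≤ t := by
  rw [← ENNReal.coe_le_coe, coe_minTime]; exact min_le_right _ _

lemma coe_minTime_le (a : ℝ≥0∞) (t : ℝ≥0) : (minTime a t : ℝ≥0∞) ≤ a := by
  rw [coe_minTime]; exact min_le_left _ _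

lemma minTime_of_le {a : ℝ≥0∞} {t : ℝ≥0} (h : (t : ℝ≥0∞) ≤ a) : minTime a t = t := by
  rw [← ENNReal.coe_inj, coe_minTime, min_eq_right h]

lemma minTime_of_ge {a : ℝ≥0∞} {u t : ℝ≥0} (ha : (u : ℝ≥0∞) = a) (h : u ≤ t) :
    minTime a t = u := by
  rw [← ENNReal.coe_inj, coe_minTime, ← ha, min_eq_left (by exact_mod_cast h)]

@[simp] lemma minTime_zero_left (t : ℝ≥0) : minTime 0 t = 0 := by
  rw [← ENNReal.coe_inj, coe_minTime]; simp

@[simp] lemma minTime_zero_right (a : ℝ≥0∞) : minTime a 0 = 0 :=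
  le_antisymm (minTime_le a 0) bot_le

lemma minTime_mono_left {a b : ℝ≥0∞} (h : a ≤ b) (t : ℝ≥0) : minTime a t ≤ minTime b t := by
  rw [← ENNReal.coe_le_coe, coe_minTime, coe_minTime]; exact min_le_min_right _ h

lemma minTime_congr {a : ℝ≥0∞} {u v : ℝ≥0} (h : a ≤ u) (huv : u ≤ v) :
    minTime a v = minTime a u := by
  rw [← ENNReal.coe_inj, coe_minTime, coe_minTime, min_eq_left h,
    min_eq_left (h.trans (by exact_mod_cast huv))]

lemma minTime_eq_min (b t : ℝ≥0) : minTime b t = min b t := by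
  rw [← ENNReal.coe_inj, coe_minTime]; simp

lemma continuous_minTime (a : ℝ≥0∞) : Continuous (minTime a) := by
  rcases eq_or_ne a ⊤ with rfl | ha
  · have : minTime ⊤ = id := funext fun t => minTime_of_le le_top
    rw [this]; exact continuous_id
  · lift a to ℝ≥0 using ha
    have : minTime a = fun t => min a t := funext fun t => minTime_eq_min a t
    rw [this]; fun_prop

lemma step_cases {T : ℕ → ℝ≥0∞} (hT : Monotone T) (k : ℕ) (t : ℝ≥0) :
    (minTime (T k) t = t ∧ minTime (T (k + 1)) t = t) ∨
    ∃ u v : ℝ≥0, (u : ℝ≥0∞) = T k ∧ u ≤ v ∧ (v : ℝ≥0∞) ≤ T (k + 1) ∧ v ≤ t ∧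
      minTime (T k) t = u ∧ minTime (T (k + 1)) t = v := by
  rcases le_total (t : ℝ≥0∞) (T k) with h | h
  · exact Or.inl ⟨minTime_of_le h, minTime_of_le (h.trans (hT k.le_succ))⟩
  · refine Or.inr ⟨minTime (T k) t, minTime (T (k + 1)) t, ?_, minTime_mono_left (hT k.le_succ) t,
      coe_minTime_le _ _, minTime_le _ _, rfl, rfl⟩
    rw [coe_minTime, min_eq_left h]

/-- The sum of the increments of `F k` over the intervals `[T k, T (k + 1)]` truncated at `t`. -/
def patch (T : ℕ → ℝ≥0∞) (F : ℕ → ℝ≥0 → ℝ) (t : ℝ≥0) : ℝ :=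
  ∑' k, (F k (minTime (T (k + 1)) t) - F k (minTime (T k) t))

lemma exists_lt_of_lt_iSup {T : ℕ → ℝ≥0∞} {t : ℝ≥0} (ht : (t : ℝ≥0∞) < ⨆ k, T k) :
    ∃ K, (t : ℝ≥0∞) < T K := lt_iSup_iff.mp ht

lemma patch_eq_sum {T : ℕ → ℝ≥0∞} (hT : Monotone T) (F : ℕ → ℝ≥0 → ℝ) {t : ℝ≥0} {K : ℕ}
    (h : (t : ℝ≥0∞) ≤ T K) :
    patch T F t = ∑ k ∈ Finset.range K, (F k (minTime (T (k + 1)) t) - F k (minTime (T k) t)) := by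
  refine tsum_eq_sum fun k hk => ?_
  have hk : K ≤ k := by simpa using hk
  rw [minTime_of_le (h.trans (hT hk)), minTime_of_le (h.trans (hT (hk.trans k.le_succ))), sub_self]

lemma patch_zero (T : ℕ → ℝ≥0∞) (F : ℕ → ℝ≥0 → ℝ) : patch T F 0 = 0 := by
  simp [patch]

/-- Simple integrals, sums of squares and sums of logarithms all have the form `patch`. Between two
times of one interval the earlier terms are frozen and the later ones are zero, so each comparison
of such sums reduces to a single interval. -/
lemma patch_local {T : ℕ → ℝ≥0∞} (hT : Monotone T) (F : ℕ → ℝ≥0 → ℝ) {k : ℕ} {u v : ℝ≥0}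
    (hu : T k ≤ u) (huv : u ≤ v) (hv : (v : ℝ≥0∞) ≤ T (k + 1)) :
    patch T F v - patch T F u = F k v - F k u := by
  have huv' : (u : ℝ≥0∞) ≤ v := by exact_mod_cast huv
  rw [patch_eq_sum hT F hv, patch_eq_sum hT F (huv'.trans hv), Finset.sum_range_succ,
    Finset.sum_range_succ, minTime_of_le hv, minTime_of_le (huv'.trans hv),
    minTime_congr hu huv]
  have : ∀ i ∈ Finset.range k, F i (minTime (T (i + 1)) v) - F i (minTime (T i) v) =
      F i (minTime (T (i + 1)) u) - F i (minTime (T i) u) := by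
    intro i hi
    have hi : i + 1 ≤ k := by simpa using hi
    rw [minTime_congr ((hT hi).trans hu) huv, minTime_congr ((hT (i.le_succ.trans hi)).trans hu) huv]
  rw [Finset.sum_congr rfl this]; ring

lemma patch_le {T : ℕ → ℝ≥0∞} (hT : Monotone T) {F G : ℕ → ℝ≥0 → ℝ} {t : ℝ≥0}
    (ht : (t : ℝ≥0∞) < ⨆ k, T k)
    (h : ∀ (k : ℕ) (u v : ℝ≥0), (u : ℝ≥0∞) = T k → u ≤ v → (v : ℝ≥0∞) ≤ T (k + 1) → v ≤ t →
      F k v - F k u ≤ G k v - G k u) : patch T F t ≤ patch T G t := by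
  obtain ⟨K, hK⟩ := exists_lt_of_lt_iSup ht
  rw [patch_eq_sum hT F hK.le, patch_eq_sum hT G hK.le]
  refine Finset.sum_le_sum fun k _ => ?_
  rcases step_cases hT k t with ⟨h1, h2⟩ | ⟨u, v, hu, huv, hv, hvt, h1, h2⟩
  · simp [h1, h2]
  · rw [h1, h2]; exact h k u v hu huv hv hvt

lemma patch_congr {T : ℕ → ℝ≥0∞} (hT : Monotone T) {F G : ℕ → ℝ≥0 → ℝ} {t : ℝ≥0}
    (h : ∀ (k : ℕ) (u v : ℝ≥0), (u : ℝ≥0∞) = T k → u ≤ v → (v : ℝ≥0∞) ≤ T (k + 1) → v ≤ t →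
      F k v - F k u = G k v - G k u) : patch T F t = patch T G t := by
  refine tsum_congr fun k => ?_
  rcases step_cases hT k t with ⟨h1, h2⟩ | ⟨u, v, hu, huv, hv, hvt, h1, h2⟩
  · simp [h1, h2]
  · rw [h1, h2]; exact h k u v hu huv hv hvt

lemma patch_const {T : ℕ → ℝ≥0∞} (hT : Monotone T) (hT0 : T 0 = 0) (x : ℝ≥0 → ℝ) {t : ℝ≥0}
    (ht : (t : ℝ≥0∞) < ⨆ k, T k) : patch T (fun _ => x) t = x t - x 0 := by
  obtain ⟨K, hK⟩ := exists_lt_of_lt_iSup ht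
  rw [patch_eq_sum hT _ hK.le, Finset.sum_range_sub (fun k => x (minTime (T k) t)),
    minTime_of_le hK.le, hT0, minTime_zero_left]

/-- The increments of `P` telescope, so a global identity needs to be checked only inside each
interval. -/
lemma eq_add_patch {T : ℕ → ℝ≥0∞} (hT : Monotone T) (hT0 : T 0 = 0) {P : ℝ≥0 → ℝ}
    {F : ℕ → ℝ≥0 → ℝ} {t : ℝ≥0} (ht : (t : ℝ≥0∞) < ⨆ k, T k)
    (h : ∀ (k : ℕ) (u v : ℝ≥0), (u : ℝ≥0∞) = T k → u ≤ v → (v : ℝ≥0∞) ≤ T (k + 1) → v ≤ t →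
      P v - P u = F k v - F k u) : P t = P 0 + patch T F t := by
  have := patch_congr hT (F := fun _ => P) h
  rw [patch_const hT hT0 P ht] at this
  linarith

lemma patch_add {T : ℕ → ℝ≥0∞} (hT : Monotone T) (F G : ℕ → ℝ≥0 → ℝ) {t : ℝ≥0}
    (ht : (t : ℝ≥0∞) < ⨆ k, T k) :
    patch T (fun k s => F k s + G k s) t = patch T F t + patch T G t := by
  obtain ⟨K, hK⟩ := exists_lt_of_lt_iSup ht
  rw [patch_eq_sum hT _ hK.le, patch_eq_sum hT _ hK.le, patch_eq_sum hT _ hK.le,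
    ← Finset.sum_add_distrib]
  exact Finset.sum_congr rfl fun k _ => by ring

lemma patch_sub {T : ℕ → ℝ≥0∞} (hT : Monotone T) (F G : ℕ → ℝ≥0 → ℝ) {t : ℝ≥0}
    (ht : (t : ℝ≥0∞) < ⨆ k, T k) :
    patch T (fun k s => F k s - G k s) t = patch T F t - patch T G t := by
  obtain ⟨K, hK⟩ := exists_lt_of_lt_iSup ht
  rw [patch_eq_sum hT _ hK.le, patch_eq_sum hT _ hK.le, patch_eq_sum hT _ hK.le,
    ← Finset.sum_sub_distrib]
  exact Finset.sum_congr rfl fun k _ => by ring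

lemma patch_const_mul (T : ℕ → ℝ≥0∞) (c : ℝ) (F : ℕ → ℝ≥0 → ℝ) (t : ℝ≥0) :
    patch T (fun k s => c * F k s) t = c * patch T F t := by
  simp only [patch, ← mul_sub, tsum_mul_left]

lemma patch_continuousOn {T : ℕ → ℝ≥0∞} (hT : Monotone T) {F : ℕ → ℝ≥0 → ℝ} {t : ℝ≥0}
    (ht : (t : ℝ≥0∞) < ⨆ k, T k) (hF : ∀ k, ContinuousOn (F k) (Set.Icc 0 t)) :
    ContinuousOn (patch T F) (Set.Icc 0 t) := by
  obtain ⟨K, hK⟩ := exists_lt_of_lt_iSup ht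
  have : ContinuousOn (fun s => ∑ k ∈ Finset.range K,
      (F k (minTime (T (k + 1)) s) - F k (minTime (T k) s))) (Set.Icc 0 t) := by
    refine continuousOn_finsetSum _ fun k _ => ?_
    have hm : ∀ a, Set.MapsTo (minTime a) (Set.Icc 0 t) (Set.Icc 0 t) := fun a s hs =>
      ⟨bot_le, (minTime_le a s).trans hs.2⟩
    exact ((hF k).comp (continuous_minTime _).continuousOn (hm _)).sub
      ((hF k).comp (continuous_minTime _).continuousOn (hm _))
  refine this.congr fun s hs => patch_eq_sum hT F ?_
  exact le_trans (by exact_mod_cast hs.2) hK.le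

/-! ### Quadratic variation sums -/

/-- The sum of squared increments of a path over the intervals of a partition. -/
def qvar (T : ℕ → ℝ≥0∞) (x : ℝ≥0 → ℝ) (t : ℝ≥0) : ℝ :=
  ∑' k, (x (minTime (T (k + 1)) t) - x (minTime (T k) t)) ^ 2

/-- The function of the `k`th interval vanishes at its left endpoint, so its increment from there is
the squared increment of `x`. -/
lemma qvar_eq_patch {T : ℕ → ℝ≥0∞} (hT : Monotone T) (x : ℝ≥0 → ℝ) (t : ℝ≥0) :
    qvar T x t = patch T (fun k s => (x s - x (T k).toNNReal) ^ 2) t := by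
  refine tsum_congr fun k => ?_
  rcases step_cases hT k t with ⟨h1, h2⟩ | ⟨u, v, hu, huv, hv, hvt, h1, h2⟩
  · simp [h1, h2]
  · simp only [h1, h2]; simp [← hu]

/-- The oscillation of `x` over the intervals of a partition, truncated at `t`, is at most `ε`. -/
def OscLE (T : ℕ → ℝ≥0∞) (x : ℝ≥0 → ℝ) (ε : ℝ) (t : ℝ≥0) : Prop :=
  ∀ (k : ℕ) (u v : ℝ≥0), T k ≤ u → (u : ℝ≥0∞) ≤ T (k + 1) → T k ≤ v → (v : ℝ≥0∞) ≤ T (k + 1) →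
    u ≤ t → v ≤ t → |x u - x v| ≤ ε

lemma OscLE.mono {T : ℕ → ℝ≥0∞} {x : ℝ≥0 → ℝ} {ε : ℝ} {s t : ℝ≥0} (h : OscLE T x ε t)
    (hst : s ≤ t) : OscLE T x ε s := fun k u v h1 h2 h3 h4 h5 h6 =>
  h k u v h1 h2 h3 h4 (h5.trans hst) (h6.trans hst)

lemma OscLE.start {T : ℕ → ℝ≥0∞} (hT : Monotone T) {x : ℝ≥0 → ℝ} {ε : ℝ} {t : ℝ≥0}
    (h : OscLE T x ε t) {k : ℕ} {u v : ℝ≥0} (hu : (u : ℝ≥0∞) = T k) (huv : u ≤ v)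
    (hv : (v : ℝ≥0∞) ≤ T (k + 1)) (hvt : v ≤ t) : |x v - x u| ≤ ε :=
  h k v u (hu.symm.le.trans (by exact_mod_cast huv)) hv hu.symm.le
    (hu.le.trans (hT k.le_succ)) hvt (huv.trans hvt)

lemma qvar_nonneg (T : ℕ → ℝ≥0∞) (x : ℝ≥0 → ℝ) (t : ℝ≥0) : 0 ≤ qvar T x t :=
  tsum_nonneg fun _ => sq_nonneg _

lemma abs_patch_le {T : ℕ → ℝ≥0∞} (hT : Monotone T) {F G : ℕ → ℝ≥0 → ℝ} {t : ℝ≥0}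
    (ht : (t : ℝ≥0∞) < ⨆ k, T k)
    (h : ∀ (k : ℕ) (u v : ℝ≥0), (u : ℝ≥0∞) = T k → u ≤ v → (v : ℝ≥0∞) ≤ T (k + 1) → v ≤ t →
      |F k v - F k u| ≤ G k v - G k u) : |patch T F t| ≤ patch T G t := by
  rw [abs_le]
  constructor
  · have := patch_le hT (F := fun k s => (-1) * F k s) (G := G) ht fun k u v h1 h2 h3 h4 => by
      have := (abs_le.mp (h k u v h1 h2 h3 h4)).1
      linarith
    rw [patch_const_mul] at this; linarith
  · exact patch_le hT ht fun k u v h1 h2 h3 h4 => (le_abs_self _).trans (h k u v h1 h2 h3 h4)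

/-- If the increments of `F k` are those of `x` corrected by `b` times the squared increment of
`x`, up to a cubic error, then so are the sums. -/
lemma patch_sub_qvar_le {T : ℕ → ℝ≥0∞} (hT : Monotone T) (hT0 : T 0 = 0) {F : ℕ → ℝ≥0 → ℝ}
    {x : ℝ≥0 → ℝ} {t : ℝ≥0} {ε b C : ℝ} (hC : 0 ≤ C) (ht : (t : ℝ≥0∞) < ⨆ k, T k)
    (hosc : OscLE T x ε t)
    (h : ∀ (k : ℕ) (u v : ℝ≥0), (u : ℝ≥0∞) = T k → u ≤ v → (v : ℝ≥0∞) ≤ T (k + 1) → v ≤ t →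
      |F k v - F k u - ((x v - x u) + b * (x v - x u) ^ 2)| ≤ C * |x v - x u| ^ 3) :
    |patch T F t - ((x t - x 0) + b * qvar T x t)| ≤ C * ε * qvar T x t := by
  rw [← patch_const hT hT0 x ht, qvar_eq_patch hT, ← patch_const_mul, ← patch_const_mul,
    ← patch_add hT _ _ ht, ← patch_sub hT _ _ ht]
  refine abs_patch_le hT ht fun k u v h1 h2 h3 h4 => ?_
  have hu : (T k).toNNReal = u := by rw [← h1]; simp
  have ho := hosc.start hT h1 h2 h3 h4
  rw [hu]
  calc |_| = |F k v - F k u - ((x v - x u) + b * (x v - x u) ^ 2)| := by congr 1; ring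
    _ ≤ C * |x v - x u| ^ 3 := h k u v h1 h2 h3 h4
    _ = C * |x v - x u| * (x v - x u) ^ 2 := by rw [← sq_abs (x v - x u)]; ring
    _ ≤ C * ε * (x v - x u) ^ 2 := by gcongr
    _ = _ := by ring

lemma sum_abs_le_variation {T : ℕ → ℝ≥0∞} (hT : Monotone T) {a : ℝ≥0 → ℝ} {t : ℝ≥0}
    (ha : BoundedVariationOn a (Set.Icc 0 t)) {s : ℝ≥0} (hs : s ≤ t) (K : ℕ) :
    ∑ k ∈ Finset.range K, |a (minTime (T (k + 1)) s) - a (minTime (T k) s)| ≤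
      (eVariationOn a (Set.Icc 0 t)).toReal := by
  have h := eVariationOn.sum_le (f := a) (s := Set.Icc 0 t) (u := fun k => minTime (T k) s) (n := K)
    (fun i j hij => minTime_mono_left (hT hij) s) (fun i => ⟨bot_le, (minTime_le _ _).trans hs⟩)
  have h2 := ENNReal.toReal_mono ha h
  rw [ENNReal.toReal_sum (fun i _ => edist_ne_top _ _)] at h2
  simpa [edist_dist, Real.dist_eq] using h2

/-- With Δ denoting increments, (Δx + Δa)² - (Δx)² = (2Δx + Δa)Δa is at most 3ε|Δa|, and the sum of
|Δa| is at most the variation of `a`. The bound is uniform in `s`. -/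
lemma abs_qvar_sub_le {T : ℕ → ℝ≥0∞} (hT : Monotone T) {x a z : ℝ≥0 → ℝ} {s t : ℝ≥0} {ε : ℝ}
    (ha : BoundedVariationOn a (Set.Icc 0 t)) (hs : s ≤ t) (ht : (t : ℝ≥0∞) < ⨆ k, T k)
    (hz : ∀ u ≤ t, z u = x u + a u)
    (hx : OscLE T x ε t) (hao : OscLE T a ε t) (hε : 0 ≤ ε) :
    |qvar T z s - qvar T x s| ≤ 3 * ε * (eVariationOn a (Set.Icc 0 t)).toReal := by
  obtain ⟨K, hK⟩ := exists_lt_of_lt_iSup ht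
  have hsK : (s : ℝ≥0∞) ≤ T K := le_trans (by exact_mod_cast hs) hK.le
  have hsum : ∀ y : ℝ≥0 → ℝ, qvar T y s =
      ∑ k ∈ Finset.range K, (y (minTime (T (k + 1)) s) - y (minTime (T k) s)) ^ 2 := fun y => by
    refine tsum_eq_sum fun k hk => ?_
    have hk : K ≤ k := by simpa using hk
    rw [minTime_of_le (hsK.trans (hT hk)), minTime_of_le (hsK.trans (hT (hk.trans k.le_succ)))]
    simp
  rw [hsum, hsum, ← Finset.sum_sub_distrib]
  refine (Finset.abs_sum_le_sum_abs _ _).trans ?_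
  refine le_trans ?_ (mul_le_mul_of_nonneg_left (sum_abs_le_variation hT ha hs K)
    (by positivity : 0 ≤ 3 * ε))
  rw [Finset.mul_sum]
  refine Finset.sum_le_sum fun k _ => ?_
  have hm : ∀ b, minTime b s ≤ t := fun b => (minTime_le _ _).trans hs
  rw [hz _ (hm _), hz _ (hm _)]
  rcases step_cases hT k s with ⟨h1, h2⟩ | ⟨u, v, hu, huv, hv, hvt, h1, h2⟩
  · simp [h1, h2]
  · rw [h1, h2]
    have h3 := hx.start hT hu huv hv (hvt.trans hs)
    have h4 := hao.start hT hu huv hv (hvt.trans hs)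
    have : (x v + a v - (x u + a u)) ^ 2 - (x v - x u) ^ 2 =
      (2 * (x v - x u) + (a v - a u)) * (a v - a u) := by ring
    rw [this, abs_mul]
    refine mul_le_mul_of_nonneg_right ?_ (abs_nonneg _)
    refine (abs_add_le _ _).trans ?_
    rw [abs_mul, abs_two]; linarith

/-- The sum of squares is not monotone in time, since the square over the interval in progress may
decrease. Only that one term can be lost, and it is at most `ε ^ 2`. -/
lemma qvar_sub_ge {T : ℕ → ℝ≥0∞} (hT : Monotone T) (hT0 : T 0 = 0) {x : ℝ≥0 → ℝ} {s t : ℝ≥0}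
    {ε : ℝ} (hx : OscLE T x ε t) (hst : s ≤ t) (ht : (t : ℝ≥0∞) < ⨆ k, T k) :
    qvar T x s - ε ^ 2 ≤ qvar T x t := by
  obtain ⟨K, hK⟩ := exists_lt_of_lt_iSup ht
  have hsK : (s : ℝ≥0∞) < T K := lt_of_le_of_lt (by exact_mod_cast hst) hK
  classical
  -- the interval that contains `s`
  have hex : ∃ k, (s : ℝ≥0∞) < T (k + 1) := by
    cases K with
    | zero => simp [hT0] at hsK
    | succ K => exact ⟨K, hsK⟩
  obtain ⟨k, hk, hmin⟩ : ∃ k, (s : ℝ≥0∞) < T (k + 1) ∧ T k ≤ s := by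
    refine ⟨Nat.find hex, Nat.find_spec hex, ?_⟩
    rcases Nat.eq_zero_or_pos (Nat.find hex) with h | h
    · rw [h, hT0]; exact bot_le
    · have := Nat.find_min hex (Nat.sub_lt h one_pos)
      rw [show Nat.find hex - 1 + 1 = Nat.find hex from Nat.sub_add_cancel h] at this
      exact not_lt.mp this
  have hloc := patch_local hT (fun k s => (x s - x (T k).toNNReal) ^ 2) (k := k)
    (u := (T k).toNNReal) (v := s)
  have hTk : T k ≠ ⊤ := ne_top_of_le_ne_top ENNReal.coe_ne_top hmin
  have hle : (T k).toNNReal ≤ s := by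
    rw [← ENNReal.coe_le_coe, ENNReal.coe_toNNReal hTk]; exact hmin
  have h1 := hloc (by rw [ENNReal.coe_toNNReal hTk]) hle hk.le
  rw [← qvar_eq_patch hT, ← qvar_eq_patch hT] at h1
  have h2 : (x s - x (T k).toNNReal) ^ 2 ≤ ε ^ 2 := by
    rw [← sq_abs]
    exact pow_le_pow_left₀ (abs_nonneg _)
      (hx.start hT (ENNReal.coe_toNNReal hTk) hle hk.le hst) 2
  -- Intervals before the `k`th are complete at `T k` and contribute the same squares at both times;
  -- the others contribute nothing at `T k`.
  have h3 : qvar T x (T k).toNNReal ≤ qvar T x t := by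
    have hT' : ∀ {w : ℝ≥0}, w ≤ t → qvar T x w = ∑ k ∈ Finset.range K,
        (x (minTime (T (k + 1)) w) - x (minTime (T k) w)) ^ 2 := fun {w} hw => by
      refine tsum_eq_sum fun i hi => ?_
      have hi : K ≤ i := by simpa using hi
      have hwK : (w : ℝ≥0∞) ≤ T K := le_trans (by exact_mod_cast hw) hK.le
      rw [minTime_of_le (hwK.trans (hT hi)), minTime_of_le (hwK.trans (hT (hi.trans i.le_succ)))]
      simp
    rw [hT' (hle.trans hst), hT' le_rfl]
    refine Finset.sum_le_sum fun i _ => ?_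
    rcases le_or_gt k i with hi | hi
    · have e : ((T k).toNNReal : ℝ≥0∞) = T k := ENNReal.coe_toNNReal hTk
      rw [minTime_of_le (e.le.trans (hT hi)), minTime_of_le (e.le.trans (hT (hi.trans i.le_succ)))]
      simpa using sq_nonneg _
    · have e : ((T k).toNNReal : ℝ≥0∞) = T k := ENNReal.coe_toNNReal hTk
      rw [minTime_congr (u := (T k).toNNReal) (v := t) ((hT hi).trans e.symm.le) (hle.trans hst),
        minTime_congr (u := (T k).toNNReal) (v := t) ((hT hi.le).trans e.symm.le) (hle.trans hst)]
  simp at h1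
  linarith

/-! ### Merging two sequences of times -/

/-- The indices of the current intervals of two partitions after `i` steps through their common
refinement. -/
def mergeIdx (T S : ℕ → ℝ≥0∞) : ℕ → ℕ × ℕ
  | 0 => (0, 0)
  | i + 1 =>
    if T ((mergeIdx T S i).1 + 1) ≤ S ((mergeIdx T S i).2 + 1) then
      ((mergeIdx T S i).1 + 1, (mergeIdx T S i).2)
    else ((mergeIdx T S i).1, (mergeIdx T S i).2 + 1)

/-- The common refinement of two partitions. -/
def mergeTime (T S : ℕ → ℝ≥0∞) (i : ℕ) : ℝ≥0∞ :=
  max (T (mergeIdx T S i).1) (S (mergeIdx T S i).2)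

section merge

variable {T S : ℕ → ℝ≥0∞}

lemma mergeIdx_succ (T S : ℕ → ℝ≥0∞) (i : ℕ) : mergeIdx T S (i + 1) =
    if T ((mergeIdx T S i).1 + 1) ≤ S ((mergeIdx T S i).2 + 1) then
      ((mergeIdx T S i).1 + 1, (mergeIdx T S i).2)
    else ((mergeIdx T S i).1, (mergeIdx T S i).2 + 1) := rfl

lemma mergeIdx_add (T S : ℕ → ℝ≥0∞) (i : ℕ) : (mergeIdx T S i).1 + (mergeIdx T S i).2 = i := by
  induction i with
  | zero => rfl
  | succ i ih => rw [mergeIdx_succ]; split_ifs <;> simp <;> omega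

lemma le_mergeTime_left (T S : ℕ → ℝ≥0∞) (i : ℕ) : T (mergeIdx T S i).1 ≤ mergeTime T S i :=
  le_max_left _ _

lemma le_mergeTime_right (T S : ℕ → ℝ≥0∞) (i : ℕ) : S (mergeIdx T S i).2 ≤ mergeTime T S i :=
  le_max_right _ _

lemma mergeTime_succ_of_le {i : ℕ}
    (h : mergeTime T S i ≤ min (T ((mergeIdx T S i).1 + 1)) (S ((mergeIdx T S i).2 + 1))) :
    mergeTime T S (i + 1) = min (T ((mergeIdx T S i).1 + 1)) (S ((mergeIdx T S i).2 + 1)) := by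
  have h1 := (le_mergeTime_left T S i).trans h
  have h2 := (le_mergeTime_right T S i).trans h
  rw [mergeTime, mergeIdx_succ]
  split_ifs with h
  · rw [min_eq_left h]
    exact max_eq_left (h2.trans (min_le_left _ _))
  · rw [min_eq_right (not_le.mp h).le]
    exact max_eq_right (h1.trans (min_le_right _ _))

/-- The invariant is that the merged time never exceeds the next time of either sequence. It puts
each merged interval inside one interval of `T` and one of `S`. -/
lemma mergeTime_aux (hT : Monotone T) (hS : Monotone S) (hT0 : T 0 = 0) (hS0 : S 0 = 0) (i : ℕ) :
    mergeTime T S i ≤ min (T ((mergeIdx T S i).1 + 1)) (S ((mergeIdx T S i).2 + 1)) ∧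
    mergeTime T S (i + 1) = min (T ((mergeIdx T S i).1 + 1)) (S ((mergeIdx T S i).2 + 1)) := by
  suffices h : mergeTime T S i ≤
      min (T ((mergeIdx T S i).1 + 1)) (S ((mergeIdx T S i).2 + 1)) from
    ⟨h, mergeTime_succ_of_le h⟩
  induction i with
  | zero => simp [mergeTime, mergeIdx, hT0, hS0]
  | succ i ih =>
    rw [mergeTime_succ_of_le ih, mergeIdx_succ]
    split_ifs with h
    · exact le_min ((min_le_left _ _).trans (hT (Nat.le_succ _))) (min_le_right _ _)
    · exact le_min (min_le_left _ _) ((min_le_right _ _).trans (hS (Nat.le_succ _)))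

lemma mergeTime_zero (hT0 : T 0 = 0) (hS0 : S 0 = 0) : mergeTime T S 0 = 0 := by
  simp [mergeTime, mergeIdx, hT0, hS0]

lemma mergeTime_mono (hT : Monotone T) (hS : Monotone S) (hT0 : T 0 = 0) (hS0 : S 0 = 0) :
    Monotone (mergeTime T S) :=
  monotone_nat_of_le_succ fun i => by
    rw [(mergeTime_aux hT hS hT0 hS0 i).2]; exact (mergeTime_aux hT hS hT0 hS0 i).1

lemma mergeTime_succ_le_left (hT : Monotone T) (hS : Monotone S) (hT0 : T 0 = 0) (hS0 : S 0 = 0)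
    (i : ℕ) : mergeTime T S (i + 1) ≤ T ((mergeIdx T S i).1 + 1) :=
  (mergeTime_aux hT hS hT0 hS0 i).2.le.trans (min_le_left _ _)

lemma mergeTime_succ_le_right (hT : Monotone T) (hS : Monotone S) (hT0 : T 0 = 0) (hS0 : S 0 = 0)
    (i : ℕ) : mergeTime T S (i + 1) ≤ S ((mergeIdx T S i).2 + 1) :=
  (mergeTime_aux hT hS hT0 hS0 i).2.le.trans (min_le_right _ _)

/-- Each step advances one index, so after `2 * K` steps one of the two is at least `K`. -/
lemma min_le_mergeTime (hT : Monotone T) (hS : Monotone S) (K : ℕ) :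
    min (T K) (S K) ≤ mergeTime T S (2 * K) := by
  have h := mergeIdx_add T S (2 * K)
  rcases le_or_gt K (mergeIdx T S (2 * K)).1 with h1 | h1
  · exact (min_le_left _ _).trans ((hT h1).trans (le_mergeTime_left _ _ _))
  · exact (min_le_right _ _).trans ((hS (by omega)).trans (le_mergeTime_right _ _ _))

lemma lt_iSup_mergeTime (hT : Monotone T) (hS : Monotone S) {t : ℝ≥0}
    (h1 : (t : ℝ≥0∞) < ⨆ k, T k) (h2 : (t : ℝ≥0∞) < ⨆ k, S k) :
    (t : ℝ≥0∞) < ⨆ k, mergeTime T S k := by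
  obtain ⟨K, hK⟩ := exists_lt_of_lt_iSup h1
  obtain ⟨L, hL⟩ := exists_lt_of_lt_iSup h2
  have := min_le_mergeTime hT hS (max K L)
  refine lt_of_lt_of_le (lt_min (hK.trans_le (hT (le_max_left _ _)))
    (hL.trans_le (hS (le_max_right _ _)))) (this.trans (le_iSup _ _))

end merge

variable {M : Market}

/-! ### Stopping times and the variables known at them -/

lemma AgreeUpTo.symm {ω ω' : M.Omega} {a : ℝ≥0∞} (h : AgreeUpTo ω ω' a) : AgreeUpTo ω' ω a :=
  fun s hs => (h s hs).symm

lemma AgreeUpTo.mono {ω ω' : M.Omega} {a b : ℝ≥0∞} (h : AgreeUpTo ω ω' b) (hab : a ≤ b) :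
    AgreeUpTo ω ω' a := fun s hs => h s (hs.trans hab)

lemma AgreeUpTo.eq_of_top {ω ω' : M.Omega} (h : AgreeUpTo ω ω' ⊤) : ω = ω' := by
  funext j
  exact ContinuousMap.ext fun s => congrFun (h s le_top) j

lemma AgreeUpTo.price_eq {ω ω' : M.Omega} {a : ℝ≥0∞} (h : AgreeUpTo ω ω' a)
    (j : Fin M.numTraded) {s : ℝ≥0} (hs : (s : ℝ≥0∞) ≤ a) : price ω j s = price ω' j s := by
  unfold price; rw [h s hs]

section stopping

variable {τ σ : M.Omega → ℝ≥0∞}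

/-- The order is decided at the earlier of the two times: agreement up to it fixes that time, and
the other one could change sides only by being fixed as well. -/
lemma IsStoppingTime.le_iff (hτ : IsStoppingTime τ) (hσ : IsStoppingTime σ) {ω ω' : M.Omega}
    (h : AgreeUpTo ω ω' (min (τ ω) (σ ω))) : τ ω ≤ σ ω ↔ τ ω' ≤ σ ω' := by
  rcases le_or_gt (τ ω) (σ ω) with h1 | h1
  · rw [min_eq_left h1] at h
    have e := hτ.2 _ _ h
    refine ⟨fun _ => ?_, fun _ => h1⟩
    by_contra! h2
    rw [← e] at h2
    have e2 := hσ.2 _ _ (h.symm.mono h2.le)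
    rw [e2] at h2
    exact absurd h1 (not_le.mpr h2)
  · rw [min_eq_right h1.le] at h
    have e := hσ.2 _ _ h
    refine ⟨fun h3 => absurd h3 (not_le.mpr h1), fun h2 => ?_⟩
    rw [← e] at h2
    have e2 := hτ.2 _ _ (h.symm.mono h2)
    rw [e2] at h2
    exact h2

lemma IsStoppingTime.min (hτ : IsStoppingTime τ) (hσ : IsStoppingTime σ) :
    IsStoppingTime fun ω => min (τ ω) (σ ω) := by
  refine ⟨hτ.1.min hσ.1, fun ω ω' h => ?_⟩
  beta_reduce at h ⊢
  have h1 := hτ.le_iff hσ h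
  rcases le_or_gt (τ ω) (σ ω) with h2 | h2
  · rw [min_eq_left h2] at h
    rw [min_eq_left h2, min_eq_left (h1.mp h2), hτ.2 _ _ h]
  · rw [min_eq_right h2.le] at h
    have h3 := not_le.mp (mt h1.mpr (not_le.mpr h2))
    rw [min_eq_right h2.le, min_eq_right h3.le, hσ.2 _ _ h]

lemma IsStoppingTime.max (hτ : IsStoppingTime τ) (hσ : IsStoppingTime σ) :
    IsStoppingTime fun ω => max (τ ω) (σ ω) := by
  refine ⟨hτ.1.max hσ.1, fun ω ω' h => ?_⟩
  beta_reduce at h ⊢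
  rw [hτ.2 _ _ (h.mono (le_max_left _ _)), hσ.2 _ _ (h.mono (le_max_right _ _))]

lemma isStoppingTime_const (a : ℝ≥0∞) : IsStoppingTime fun _ : M.Omega => a :=
  ⟨measurable_const, fun _ _ _ => rfl⟩

lemma IsStoppingTime.minTime_eq (hτ : IsStoppingTime τ) {ω ω' : M.Omega} {t : ℝ≥0}
    (h : AgreeUpTo ω ω' t) : minTime (τ ω) t = minTime (τ ω') t := by
  have := hτ.min (isStoppingTime_const (t : ℝ≥0∞))
  exact congrArg ENNReal.toNNReal (this.2 ω ω' (h.mono (min_le_right _ _)))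

lemma IsStoppingTime.lt_iff (hτ : IsStoppingTime τ) {ω ω' : M.Omega} {t : ℝ≥0}
    (h : AgreeUpTo ω ω' t) : (t : ℝ≥0∞) < τ ω ↔ (t : ℝ≥0∞) < τ ω' := by
  have := hτ.le_iff (isStoppingTime_const (t : ℝ≥0∞)) (h.mono (min_le_right _ _))
  simpa using not_congr this

end stopping

/-- `h` is measurable and determined by the path up to the time `τ`. -/
structure KnownAt {β : Type*} [MeasurableSpace β] (τ : M.Omega → ℝ≥0∞) (h : M.Omega → β) :
    Prop where
  measurable : Measurable h
  agree : ∀ ω ω' : M.Omega, AgreeUpTo ω ω' (τ ω) → h ω = h ω'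

section known

variable {β γ : Type*} [MeasurableSpace β] [MeasurableSpace γ] {τ σ : M.Omega → ℝ≥0∞}

lemma KnownAt.mono {h : M.Omega → β} (hh : KnownAt τ h) (hle : ∀ ω, τ ω ≤ σ ω) : KnownAt σ h :=
  ⟨hh.measurable, fun ω ω' hω => hh.agree ω ω' (hω.mono (hle ω))⟩

lemma KnownAt.comp {h : M.Omega → β} (hh : KnownAt τ h) {g : β → γ} (hg : Measurable g) :
    KnownAt τ fun ω => g (h ω) :=
  ⟨hg.comp hh.measurable, fun ω ω' hω => by rw [hh.agree ω ω' hω]⟩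

lemma KnownAt.prodMk {h : M.Omega → β} {k : M.Omega → γ} (hh : KnownAt τ h) (hk : KnownAt τ k) :
    KnownAt τ fun ω => (h ω, k ω) :=
  ⟨hh.measurable.prodMk hk.measurable, fun ω ω' hω => by rw [hh.agree ω ω' hω, hk.agree ω ω' hω]⟩

lemma KnownAt.const (b : β) : KnownAt τ fun _ : M.Omega => b :=
  ⟨measurable_const, fun _ _ _ => rfl⟩

lemma KnownAt.mul {f g : M.Omega → ℝ} (hf : KnownAt τ f) (hg : KnownAt τ g) :
    KnownAt τ fun ω => f ω * g ω := (hf.prodMk hg).comp (measurable_fst.mul measurable_snd)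

lemma KnownAt.sub {f g : M.Omega → ℝ} (hf : KnownAt τ f) (hg : KnownAt τ g) :
    KnownAt τ fun ω => f ω - g ω := (hf.prodMk hg).comp (measurable_fst.sub measurable_snd)

end known

/-- Sequences of stopping times that increase from `0`. -/
structure IsGrid (T : ℕ → M.Omega → ℝ≥0∞) : Prop where
  stopping : ∀ k, IsStoppingTime (T k)
  zero : ∀ ω, T 0 ω = 0
  mono : ∀ ω, Monotone fun k => T k ω

lemma IsPartition.isGrid {T : ℕ → M.Omega → ℝ≥0∞} (hT : IsPartition T) : IsGrid T :=
  ⟨hT.stopping, hT.zero, hT.mono⟩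

/-! ### Random grids and their common refinement -/

section grid

variable {T S : ℕ → M.Omega → ℝ≥0∞}

lemma IsGrid.lt_iSup_iff (hT : IsGrid T) {ω ω' : M.Omega} {t : ℝ≥0} (h : AgreeUpTo ω ω' t) :
    (t : ℝ≥0∞) < ⨆ k, T k ω ↔ (t : ℝ≥0∞) < ⨆ k, T k ω' := by
  rw [_root_.lt_iSup_iff, _root_.lt_iSup_iff]
  exact exists_congr fun k => (hT.stopping k).lt_iff h

/-- The indices of the current intervals of two grids after `i` steps of their refinement. -/
def idx (T S : ℕ → M.Omega → ℝ≥0∞) (i : ℕ) (ω : M.Omega) : ℕ × ℕ :=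
  mergeIdx (fun k => T k ω) (fun k => S k ω) i

/-- The common refinement of two grids. -/
def merge (T S : ℕ → M.Omega → ℝ≥0∞) (i : ℕ) (ω : M.Omega) : ℝ≥0∞ :=
  mergeTime (fun k => T k ω) (fun k => S k ω) i

lemma measurable_idx (hT : ∀ k, Measurable (T k)) (hS : ∀ k, Measurable (S k)) (i : ℕ) :
    Measurable (idx T S i) := by
  induction i with
  | zero => exact measurable_const
  | succ i ih =>
    have h : Measurable fun p : (ℕ × ℕ) × M.Omega =>
        if T (p.1.1 + 1) p.2 ≤ S (p.1.2 + 1) p.2 then (p.1.1 + 1, p.1.2)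
        else (p.1.1, p.1.2 + 1) := by
      refine measurable_from_prod_countable_right fun p => ?_
      exact Measurable.ite (measurableSet_le (hT (p.1 + 1)) (hS (p.2 + 1)))
        (measurable_const (a := (p.1 + 1, p.2))) (measurable_const (a := (p.1, p.2 + 1)))
    exact h.comp (ih.prodMk measurable_id)

lemma IsGrid.merge_mono (hT : IsGrid T) (hS : IsGrid S) (ω : M.Omega) :
    Monotone fun i => merge T S i ω :=
  mergeTime_mono (hT.mono ω) (hS.mono ω) (hT.zero ω) (hS.zero ω)

/-- The comparison that determines the next index is between two stopping times whose minimum is the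
next merged time, so the path up to that time decides it. -/
lemma IsGrid.idx_agree (hT : IsGrid T) (hS : IsGrid S) (i : ℕ) (ω ω' : M.Omega)
    (h : AgreeUpTo ω ω' (merge T S i ω)) : idx T S i ω = idx T S i ω' := by
  induction i with
  | zero => rfl
  | succ i ih =>
    have e := ih (h.mono (hT.merge_mono hS ω i.le_succ))
    have hm : merge T S (i + 1) ω = min (T ((idx T S i ω).1 + 1) ω) (S ((idx T S i ω).2 + 1) ω) :=
      (mergeTime_aux (hT.mono ω) (hS.mono ω) (hT.zero ω) (hS.zero ω) i).2
    rw [hm] at h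
    have h2 := (hT.stopping ((idx T S i ω).1 + 1)).le_iff (hS.stopping ((idx T S i ω).2 + 1)) h
    change mergeIdx _ _ (i + 1) = mergeIdx _ _ (i + 1)
    rw [mergeIdx_succ, mergeIdx_succ]
    change (if T ((idx T S i ω).1 + 1) ω ≤ S ((idx T S i ω).2 + 1) ω then _ else _) =
      (if T ((idx T S i ω').1 + 1) ω' ≤ S ((idx T S i ω').2 + 1) ω' then _ else _)
    rw [← e]
    simp only [h2]
    change (if _ then ((idx T S i ω).1 + 1, (idx T S i ω).2) else
      ((idx T S i ω).1, (idx T S i ω).2 + 1)) = (if _ then ((idx T S i ω').1 + 1, (idx T S i ω').2)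
        else ((idx T S i ω').1, (idx T S i ω').2 + 1))
    rw [← e]

lemma IsGrid.knownAt_select (hT : IsGrid T) (hS : IsGrid S) {β : Type*} [MeasurableSpace β]
    {F : ℕ × ℕ → M.Omega → β} (hF : ∀ p, KnownAt (fun ω => max (T p.1 ω) (S p.2 ω)) (F p)) (i : ℕ) :
    KnownAt (merge T S i) fun ω => F (idx T S i ω) ω := by
  refine ⟨?_, fun ω ω' h => ?_⟩
  · have h : Measurable fun p : (ℕ × ℕ) × M.Omega => F p.1 p.2 :=
      measurable_from_prod_countable_right fun p => (hF p).measurable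
    exact h.comp ((measurable_idx (fun k => (hT.stopping k).1) (fun k => (hS.stopping k).1) i).prodMk
      measurable_id)
  · rw [← hT.idx_agree hS i ω ω' h]
    exact (hF _).agree ω ω' h

lemma IsGrid.merge (hT : IsGrid T) (hS : IsGrid S) : IsGrid (merge T S) := by
  refine ⟨fun i => ?_, fun ω => mergeTime_zero (hT.zero ω) (hS.zero ω), hT.merge_mono hS⟩
  have h := hT.knownAt_select hS (F := fun p ω => max (T p.1 ω) (S p.2 ω)) (fun p =>
    ⟨((hT.stopping p.1).max (hS.stopping p.2)).1, ((hT.stopping p.1).max (hS.stopping p.2)).2⟩) i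
  exact ⟨h.measurable, h.agree⟩

/-- The two indices after `i` steps sum to `i`, so only finitely many of the bounds are involved. -/
lemma bounded_select {F : ℕ × ℕ → M.Omega → ℝ} (hF : ∀ p, ∃ C : ℝ, ∀ ω, |F p ω| ≤ C) (i : ℕ) :
    ∃ C : ℝ, ∀ ω, |F (idx T S i ω) ω| ≤ C := by
  choose C hC using hF
  refine ⟨∑ p ∈ Finset.range (i + 1) ×ˢ Finset.range (i + 1), |C p|, fun ω => ?_⟩
  refine (hC _ ω).trans ((le_abs_self _).trans ?_)
  have h := mergeIdx_add (fun k => T k ω) (fun k => S k ω) i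
  exact Finset.single_le_sum (f := fun p => |C p|) (fun _ _ => abs_nonneg _)
    (Finset.mem_product.mpr ⟨Finset.mem_range.mpr (by unfold idx; omega),
      Finset.mem_range.mpr (by unfold idx; omega)⟩)

end grid

/-! ### Simple capital processes -/

/-- `P` starts from `c`, and its increments over the intervals of the grid `T` are those of the
portfolios `h`. -/
structure IsSimpleAlong (c : ℝ) (P : ℝ≥0 → M.Omega → ℝ) (T : ℕ → M.Omega → ℝ≥0∞)
    (h : ℕ → M.Omega → Fin M.numTraded → ℝ) : Prop where
  grid : IsGrid T
  tendsto_top : ∀ ω, Tendsto (fun n => T n ω) atTop (𝓝 ⊤)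
  known : ∀ n j, KnownAt (T n) fun ω => h n ω j
  bounded : ∀ n j, ∃ C : ℝ, ∀ ω, |h n ω j| ≤ C
  zero : ∀ ω, P 0 ω = c
  increments : ∀ (ω : M.Omega) (k : ℕ) (u v : ℝ≥0), T k ω ≤ u → u ≤ v → (v : ℝ≥0∞) ≤ T (k + 1) ω →
    P v ω - P u ω = ∑ j, h k ω j * (price ω j v - price ω j u)

/-- `P` is a simple capital process with initial capital `c`. -/
def IsSimple (c : ℝ) (P : ℝ≥0 → M.Omega → ℝ) : Prop := ∃ T h, IsSimpleAlong c P T h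

lemma lt_iSup_of_tendsto_top {T : ℕ → ℝ≥0∞} (h : Tendsto T atTop (𝓝 ⊤)) (t : ℝ≥0) :
    (t : ℝ≥0∞) < ⨆ k, T k := by
  obtain ⟨k, hk⟩ := (h.eventually (lt_mem_nhds (ENNReal.coe_lt_top (r := t)))).exists
  exact hk.trans_le (le_iSup _ _)

lemma capital_eq_patch (G : SimpleStrategy M) (c : ℝ) (t : ℝ≥0) (ω : M.Omega) :
    capital G c t ω =
      c + patch (fun n => G.time n ω) (fun n s => ∑ j, G.bet n ω j * price ω j s) t := by
  simp only [capital, patch, mul_sub, Finset.sum_sub_distrib]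

lemma IsSimple.exists_capital {c : ℝ} {P : ℝ≥0 → M.Omega → ℝ} (hP : IsSimple c P) :
    ∃ G : SimpleStrategy M, ∀ t ω, capital G c t ω = P t ω := by
  obtain ⟨T, h, H⟩ := hP
  refine ⟨⟨T, h, H.grid.stopping, H.grid.mono, H.tendsto_top,
    fun n => measurable_pi_iff.mpr fun j => (H.known n j).measurable, fun n => ?_,
    fun n ω ω' hω => funext fun j => (H.known n j).agree ω ω' hω⟩, fun t ω => ?_⟩
  · choose C hC using H.bounded n
    refine ⟨∑ j, |C j|, fun ω j => (hC j ω).trans ((le_abs_self _).trans ?_)⟩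
    exact Finset.single_le_sum (f := fun j => |C j|) (fun _ _ => abs_nonneg _) (Finset.mem_univ j)
  · rw [capital_eq_patch]
    have := eq_add_patch (P := fun s => P s ω) (F := fun n s => ∑ j, h n ω j * price ω j s)
      (H.grid.mono ω) (H.grid.zero ω) (lt_iSup_of_tendsto_top (H.tendsto_top ω) t)
      fun k u v h1 h2 h3 _ => by
        rw [H.increments ω k u v h1.symm.le h2 h3, ← Finset.sum_sub_distrib]
        exact Finset.sum_congr rfl fun j _ => by ring
    rw [this, H.zero]

/-- A grid starts from `0`, whereas the first time of a strategy is arbitrary. An initial interval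
with the zero portfolio is therefore put in front. -/
lemma isSimple_capital (G : SimpleStrategy M) (c : ℝ) : IsSimple c (capital G c) := by
  refine ⟨fun n => Nat.casesOn n (fun _ => 0) G.time, fun n => Nat.casesOn n (fun _ _ => 0) G.bet,
    ⟨?_, fun ω => rfl, fun ω => ?_⟩, fun ω => ?_, ?_, ?_, fun ω => ?_, ?_⟩
  · rintro (_ | n)
    · exact isStoppingTime_const 0
    · exact G.stopping n
  · refine monotone_nat_of_le_succ ?_
    rintro (_ | n)
    · exact bot_le
    · exact G.mono ω n.le_succ
  · rw [← tendsto_add_atTop_iff_nat 1]; exact G.tendsto_top ω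
  · rintro (_ | n) j
    · exact KnownAt.const 0
    · exact ⟨measurable_pi_iff.mp (G.bet_measurable n) j,
        fun ω ω' h => congrFun (G.bet_stopped n ω ω' h) j⟩
  · rintro (_ | n) j
    · exact ⟨0, fun ω => by simp⟩
    · obtain ⟨C, hC⟩ := G.bet_bounded n
      exact ⟨C, fun ω => hC ω j⟩
  · simp [capital]
  · rintro ω (_ | k) u v h1 h2 h3
    · have h4 : (u : ℝ≥0∞) ≤ G.time 0 ω := le_trans (by exact_mod_cast h2) h3
      simp only [capital_eq_patch]
      rw [patch_eq_sum (G.mono ω) _ h4, patch_eq_sum (G.mono ω) _ (K := 0) h3]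
      simp
    · simp only [capital_eq_patch, add_sub_add_left_eq_sub]
      rw [patch_local (G.mono ω) _ h1 h2 h3, ← Finset.sum_sub_distrib]
      exact Finset.sum_congr rfl fun j _ => by ring

lemma isSimple_iff {c : ℝ} {P : ℝ≥0 → M.Omega → ℝ} :
    IsSimple c P ↔ ∃ G : SimpleStrategy M, P = capital G c :=
  ⟨fun h => h.exists_capital.imp fun _ hG => funext fun t => funext fun ω => (hG t ω).symm,
    fun ⟨G, hG⟩ => hG ▸ isSimple_capital G c⟩

lemma tendsto_merge_top {T S : ℕ → M.Omega → ℝ≥0∞} (hT : IsGrid T) (hS : IsGrid S) {ω : M.Omega}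
    (h1 : Tendsto (fun n => T n ω) atTop (𝓝 ⊤)) (h2 : Tendsto (fun n => S n ω) atTop (𝓝 ⊤)) :
    Tendsto (fun n => merge T S n ω) atTop (𝓝 ⊤) := by
  have h : ⨆ n, merge T S n ω = ⊤ := by
    refine ENNReal.eq_top_of_forall_nnreal_le fun t => ?_
    exact (lt_iSup_mergeTime (hT.mono ω) (hS.mono ω) (lt_iSup_of_tendsto_top h1 t)
      (lt_iSup_of_tendsto_top h2 t)).le
  rw [← h]
  exact tendsto_atTop_iSup (hT.merge_mono hS ω)

/-- Both portfolios are constant on the intervals of the common refinement and can be added there.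
-/
lemma IsSimple.add {c d : ℝ} {P Q : ℝ≥0 → M.Omega → ℝ} (hP : IsSimple c P) (hQ : IsSimple d Q) :
    IsSimple (c + d) fun t ω => P t ω + Q t ω := by
  obtain ⟨T, h, H⟩ := hP
  obtain ⟨S, k, K⟩ := hQ
  refine ⟨merge T S, fun i ω j => h (idx T S i ω).1 ω j + k (idx T S i ω).2 ω j,
    H.grid.merge K.grid, fun ω => tendsto_merge_top H.grid K.grid (H.tendsto_top ω) (K.tendsto_top ω),
    fun i j => ?_, fun i j => ?_, fun ω => by rw [H.zero, K.zero], fun ω i u v h1 h2 h3 => ?_⟩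
  · exact H.grid.knownAt_select K.grid (F := fun p ω => h p.1 ω j + k p.2 ω j) (fun p =>
      (((H.known p.1 j).mono fun ω => le_max_left _ _).prodMk
        ((K.known p.2 j).mono fun ω => le_max_right _ _)).comp
        (measurable_fst.add measurable_snd)) i
  · refine bounded_select (F := fun p ω => h p.1 ω j + k p.2 ω j) (fun p => ?_) i
    obtain ⟨C, hC⟩ := H.bounded p.1 j
    obtain ⟨D, hD⟩ := K.bounded p.2 j
    exact ⟨C + D, fun ω => (abs_add_le _ _).trans (add_le_add (hC ω) (hD ω))⟩
  · have e1 := H.increments ω (idx T S i ω).1 u v ((le_mergeTime_left _ _ i).trans h1) h2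
      (h3.trans (mergeTime_succ_le_left (H.grid.mono ω) (K.grid.mono ω) (H.grid.zero ω)
        (K.grid.zero ω) i))
    have e2 := K.increments ω (idx T S i ω).2 u v ((le_mergeTime_right _ _ i).trans h1) h2
      (h3.trans (mergeTime_succ_le_right (H.grid.mono ω) (K.grid.mono ω) (H.grid.zero ω)
        (K.grid.zero ω) i))
    rw [add_sub_add_comm, e1, e2, ← Finset.sum_add_distrib]
    exact Finset.sum_congr rfl fun j _ => by ring

/-- Simple integrals of simple capital processes are simple capital processes. -/
lemma IsSimple.integral {c d : ℝ} {P : ℝ≥0 → M.Omega → ℝ} (hP : IsSimple c P)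
    {T : ℕ → M.Omega → ℝ≥0∞} (hT : IsGrid T) (hTtop : ∀ ω, Tendsto (fun n => T n ω) atTop (𝓝 ⊤))
    {f : ℕ → M.Omega → ℝ} (hf : ∀ n, KnownAt (T n) (f n)) (hfb : ∀ n, ∃ C : ℝ, ∀ ω, |f n ω| ≤ C) :
    IsSimple d fun t ω => d + patch (fun n => T n ω) (fun n s => f n ω * P s ω) t := by
  obtain ⟨S, k, K⟩ := hP
  refine ⟨merge T S, fun i ω j => f (idx T S i ω).1 ω * k (idx T S i ω).2 ω j,
    hT.merge K.grid, fun ω => tendsto_merge_top hT K.grid (hTtop ω) (K.tendsto_top ω),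
    fun i j => ?_, fun i j => ?_, fun ω => by simp [patch_zero], fun ω i u v h1 h2 h3 => ?_⟩
  · exact hT.knownAt_select K.grid (F := fun p ω => f p.1 ω * k p.2 ω j) (fun p =>
      ((hf p.1).mono fun ω => le_max_left _ _).mul
        ((K.known p.2 j).mono fun ω => le_max_right _ _)) i
  · refine bounded_select (F := fun p ω => f p.1 ω * k p.2 ω j) (fun p => ?_) i
    obtain ⟨C, hC⟩ := hfb p.1
    obtain ⟨D, hD⟩ := K.bounded p.2 j
    refine ⟨C * D, fun ω => ?_⟩
    rw [abs_mul]
    exact mul_le_mul (hC ω) (hD ω) (abs_nonneg _) ((abs_nonneg _).trans (hC ω))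
  · rw [add_sub_add_left_eq_sub, patch_local (hT.mono ω) _ ((le_mergeTime_left _ _ i).trans h1) h2
      (h3.trans (mergeTime_succ_le_left (hT.mono ω) (K.grid.mono ω) (hT.zero ω) (K.grid.zero ω) i))]
    have e2 := K.increments ω (idx T S i ω).2 u v ((le_mergeTime_right _ _ i).trans h1) h2
      (h3.trans (mergeTime_succ_le_right (hT.mono ω) (K.grid.mono ω) (hT.zero ω)
        (K.grid.zero ω) i))
    rw [← mul_sub]
    change f (idx T S i ω).1 ω * _ = _
    rw [e2, Finset.mul_sum]
    exact Finset.sum_congr rfl fun j _ => by ring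

lemma IsSimple.const_mul {c : ℝ} {P : ℝ≥0 → M.Omega → ℝ} (hP : IsSimple c P) (a : ℝ) :
    IsSimple (a * c) fun t ω => a * P t ω := by
  obtain ⟨T, h, H⟩ := hP
  refine ⟨T, fun n ω j => a * h n ω j, H.grid, H.tendsto_top,
    fun n j => (KnownAt.const a).mul (H.known n j), fun n j => ?_, fun ω => by rw [H.zero],
    fun ω k u v h1 h2 h3 => ?_⟩
  · obtain ⟨C, hC⟩ := H.bounded n j
    exact ⟨|a| * C, fun ω => by rw [abs_mul]; exact mul_le_mul_of_nonneg_left (hC ω) (abs_nonneg _)⟩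
  · rw [← mul_sub, H.increments ω k u v h1 h2 h3, Finset.mul_sum]
    exact Finset.sum_congr rfl fun j _ => by ring

/-! ### Stopping simple capital processes -/

/-- The grid `0, σ, ⊤, ⊤, …`. -/
def stopGrid (σ : M.Omega → ℝ≥0∞) : ℕ → M.Omega → ℝ≥0∞
  | 0 => fun _ => 0
  | 1 => σ
  | _ + 2 => fun _ => ⊤

lemma isGrid_stopGrid {σ : M.Omega → ℝ≥0∞} (hσ : IsStoppingTime σ) : IsGrid (stopGrid σ) := by
  refine ⟨?_, fun ω => rfl, fun ω => monotone_nat_of_le_succ ?_⟩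
  · rintro (_ | _ | n)
    exacts [isStoppingTime_const 0, hσ, isStoppingTime_const ⊤]
  · rintro (_ | _ | n)
    exacts [bot_le, le_top, le_top]

lemma stopGrid_tendsto (σ : M.Omega → ℝ≥0∞) (ω : M.Omega) :
    Tendsto (fun n => stopGrid σ n ω) atTop (𝓝 ⊤) := by
  rw [← tendsto_add_atTop_iff_nat 2]; exact tendsto_const_nhds

/-- The portfolio that holds one unit until the first time of a grid. -/
def holdFirst (n : ℕ) (_ : M.Omega) : ℝ := if n = 0 then 1 else 0

lemma patch_stopGrid {σ : M.Omega → ℝ≥0∞} (hσ : IsStoppingTime σ) (x : ℝ≥0 → ℝ) (t : ℝ≥0)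
    (ω : M.Omega) : patch (fun n => stopGrid σ n ω) (fun n s => holdFirst n ω * x s) t =
      x (minTime (σ ω) t) - x 0 := by
  rw [patch_eq_sum ((isGrid_stopGrid hσ).mono ω) _ (K := 2) le_top]
  simp [stopGrid, holdFirst]

lemma knownAt_holdFirst (τ : M.Omega → ℝ≥0∞) (n : ℕ) : KnownAt τ (holdFirst (M := M) n) :=
  KnownAt.const (if n = 0 then (1 : ℝ) else 0)

lemma bounded_holdFirst (n : ℕ) : ∃ C : ℝ, ∀ ω : M.Omega, |holdFirst n ω| ≤ C :=
  ⟨1, fun ω => by unfold holdFirst; split_ifs <;> simp⟩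

lemma IsSimple.zero {c : ℝ} {P : ℝ≥0 → M.Omega → ℝ} (hP : IsSimple c P) (ω : M.Omega) :
    P 0 ω = c := by
  obtain ⟨T, h, H⟩ := hP
  exact H.zero ω

lemma IsSimple.stopped {c : ℝ} {P : ℝ≥0 → M.Omega → ℝ} (hP : IsSimple c P) {σ : M.Omega → ℝ≥0∞}
    (hσ : IsStoppingTime σ) : IsSimple c fun t ω => P (minTime (σ ω) t) ω := by
  have h := hP.integral (d := c) (isGrid_stopGrid hσ) (stopGrid_tendsto σ)
    (fun n => knownAt_holdFirst _ n) bounded_holdFirst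
  convert h using 3 with t ω
  rw [patch_stopGrid hσ (fun s => P s ω) t ω, hP.zero]; ring

lemma isSimple_const (c : ℝ) : IsSimple c fun (_ : ℝ≥0) (_ : M.Omega) => c := by
  refine ⟨stopGrid fun _ => 0, fun _ _ _ => 0, isGrid_stopGrid (isStoppingTime_const 0),
    stopGrid_tendsto _, fun n j => KnownAt.const 0, fun n j => ⟨0, fun ω => by simp⟩, fun _ => rfl,
    fun ω k u v _ _ _ => by simp⟩

/-! ### Nonnegative supermartingales and properties that hold quasi-always -/

lemma IsSimple.isNonnegSupermartingale {c : ℝ} {P : ℝ≥0 → M.Omega → ℝ} (hP : IsSimple c P)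
    (h0 : ∀ t ω, 0 ≤ P t ω) : IsNonnegSupermartingale fun t ω => ENNReal.ofReal (P t ω) := by
  obtain ⟨G, rfl⟩ := isSimple_iff.mp hP
  exact .simple G c h0

lemma isNonnegSupermartingale_const (c : ℝ≥0) :
    IsNonnegSupermartingale fun (_ : ℝ≥0) (_ : M.Omega) => (c : ℝ≥0∞) := by
  have := (isSimple_const (M := M) c).isNonnegSupermartingale fun _ _ => c.2
  simpa using this

lemma ennreal_add_liminf (a : ℝ≥0∞) (u : ℕ → ℝ≥0∞) :
    a + liminf u atTop = liminf (fun k => a + u k) atTop :=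
  (liminf_const_add atTop u a (by isBoundedDefault) (by isBoundedDefault)).symm

/-- Adding a fixed term commutes with lower limits, so the limits are treated in one argument at a
time; this avoids comparing the sum of two lower limits with the lower limit of a sum. -/
lemma IsNonnegSupermartingale.add {X Y : ℝ≥0 → M.Omega → ℝ≥0∞} (hX : IsNonnegSupermartingale X)
    (hY : IsNonnegSupermartingale Y) : IsNonnegSupermartingale fun t ω => X t ω + Y t ω := by
  induction hX with
  | simple G c hG =>
    induction hY with
    | simple G' c' hG' =>
      have := ((isSimple_capital G c).add (isSimple_capital G' c')).isNonnegSupermartingale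
        fun t ω => add_nonneg (hG t ω) (hG' t ω)
      convert this using 3 with t ω
      exact (ENNReal.ofReal_add (hG t ω) (hG' t ω)).symm
    | liminf Y hY ih =>
      simp only [ennreal_add_liminf]
      exact .liminf _ ih
  | liminf X hX ih =>
    simp only [add_comm _ (Y _ _), ennreal_add_liminf]
    simp only [add_comm (Y _ _)]
    exact .liminf _ ih

lemma IsNonnegSupermartingale.const_mul {X : ℝ≥0 → M.Omega → ℝ≥0∞}
    (hX : IsNonnegSupermartingale X) (a : ℝ≥0) :
    IsNonnegSupermartingale fun t ω => a * X t ω := by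
  induction hX with
  | simple G c hG =>
    have := ((isSimple_capital G c).const_mul a).isNonnegSupermartingale
      fun t ω => mul_nonneg a.2 (hG t ω)
    convert this using 3 with t ω
    rw [ENNReal.ofReal_mul (p := (a : ℝ)) a.2, ENNReal.ofReal_coe_nnreal]
  | liminf X hX ih =>
    simp only [← ENNReal.liminf_const_mul_of_ne_top ENNReal.coe_ne_top]
    exact .liminf _ ih

lemma IsNonnegSupermartingale.tsum {X : ℕ → ℝ≥0 → M.Omega → ℝ≥0∞}
    (hX : ∀ n, IsNonnegSupermartingale (X n)) :
    IsNonnegSupermartingale fun t ω => ∑' n, X n t ω := by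
  have h : ∀ n, IsNonnegSupermartingale fun t ω => ∑ i ∈ Finset.range n, X i t ω := by
    intro n
    induction n with
    | zero => simpa using isNonnegSupermartingale_const (M := M) 0
    | succ n ih => simp only [Finset.sum_range_succ]; exact ih.add (hX n)
  have h2 := IsNonnegSupermartingale.liminf _ h
  convert h2 using 3 with t ω
  exact (ENNReal.tendsto_nat_tsum fun n => X n t ω).liminf_eq.symm

lemma QuasiAlways.of_supermartingale {E : ℝ≥0 → M.Omega → Prop} {S : ℝ≥0 → M.Omega → ℝ≥0∞}
    (hS : IsNonnegSupermartingale S) {u : ℝ≥0∞} (hu : u ≠ ⊤) (h0 : ∀ ω, S 0 ω = u)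
    (h : ∀ t ω, ¬ E t ω → S t ω = ⊤) : QuasiAlways E := by
  lift u to ℝ≥0 using hu
  -- Adding `1` allows the normalization even when `u = 0`.
  refine ⟨_, (hS.add (isNonnegSupermartingale_const 1)).const_mul (u + 1)⁻¹, fun ω => ?_,
    fun t ω ht => ?_⟩
  · rw [h0]
    norm_cast
    exact inv_mul_cancel₀ (by positivity)
  · rw [h t ω ht, top_add, ENNReal.mul_top]
    norm_cast
    positivity

lemma QuasiAlways.mono {E F : ℝ≥0 → M.Omega → Prop} (h : QuasiAlways E)
    (hEF : ∀ t ω, E t ω → F t ω) : QuasiAlways F := by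
  obtain ⟨X, h1, h2, h3⟩ := h
  exact ⟨X, h1, h2, fun t ω hF => h3 t ω (mt (hEF t ω) hF)⟩

/-- The sum of the witnesses with weights `2⁻¹ ^ n` starts from a finite value and is infinite as
soon as one of them is. -/
lemma QuasiAlways.all {E : ℕ → ℝ≥0 → M.Omega → Prop} (h : ∀ n, QuasiAlways (E n)) :
    QuasiAlways fun t ω => ∀ n, E n t ω := by
  choose X h1 h2 h3 using h
  refine .of_supermartingale (S := fun t ω => ∑' n, ((2⁻¹ ^ n : ℝ≥0) : ℝ≥0∞) * X n t ω)
    (u := ∑' n : ℕ, (2⁻¹ : ℝ≥0∞) ^ n)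
    (IsNonnegSupermartingale.tsum fun n => (h1 n).const_mul _) ?_ (fun ω => ?_) fun t ω ht => ?_
  · rw [ENNReal.tsum_geometric]; norm_num
  · refine tsum_congr fun n => ?_
    rw [h2, mul_one]
    rw [ENNReal.coe_pow, ENNReal.coe_inv two_ne_zero, ENNReal.coe_ofNat]
  · push Not at ht
    obtain ⟨n, hn⟩ := ht
    refine ENNReal.tsum_eq_top_of_eq_top ⟨n, ?_⟩
    rw [h3 n t ω hn, ENNReal.mul_top]
    norm_cast
    positivity

lemma QuasiAlways.and {E F : ℝ≥0 → M.Omega → Prop} (hE : QuasiAlways E) (hF : QuasiAlways F) :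
    QuasiAlways fun t ω => E t ω ∧ F t ω := by
  have := QuasiAlways.all (E := fun n => if n = 0 then E else F) fun n => by
    split_ifs <;> assumption
  exact this.mono fun t ω h => ⟨h 0, h 1⟩

lemma QuasiAlways.at_zero {E : ℝ≥0 → M.Omega → Prop} (h : QuasiAlways E) (ω : M.Omega) :
    E 0 ω := by
  obtain ⟨X, _, h2, h3⟩ := h
  by_contra hE
  have := h3 0 ω hE
  rw [h2] at this
  exact ENNReal.one_ne_top this

lemma QuasiAlways.of_forall {E : ℝ≥0 → M.Omega → Prop} (h : ∀ t ω, E t ω) : QuasiAlways E :=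
  .of_supermartingale (isNonnegSupermartingale_const 1) ENNReal.coe_ne_top (fun _ => rfl)
    fun t ω ht => absurd (h t ω) ht

/-! ### Continuous processes with a cemetery state -/

open Classical in
/-- The process with effective domain `D` and values `f`. -/
def mkProc (D : ℝ≥0 → M.Omega → Prop) (f : ℝ≥0 → M.Omega → ℝ) : ExtProc M := fun t ω =>
  if D t ω then some (f t ω) else none

@[simp] lemma inDom_mkProc {D : ℝ≥0 → M.Omega → Prop} {f : ℝ≥0 → M.Omega → ℝ} {t : ℝ≥0}
    {ω : M.Omega} : InDom (mkProc D f) t ω ↔ D t ω := by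
  unfold InDom mkProc; split_ifs with h <;> simp [h]

lemma val_mkProc {D : ℝ≥0 → M.Omega → Prop} {f : ℝ≥0 → M.Omega → ℝ} {t : ℝ≥0}
    {ω : M.Omega} (h : D t ω) : val (mkProc D f) t ω = f t ω := by
  unfold val mkProc; rw [if_pos h]; rfl

lemma extProc_eq_iff {X Y : ExtProc M} {t : ℝ≥0} {ω ω' : M.Omega} :
    X t ω = Y t ω' ↔ (InDom X t ω ↔ InDom Y t ω') ∧ (InDom X t ω → val X t ω = val Y t ω') := by
  unfold InDom val
  cases X t ω <;> cases Y t ω' <;> simp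

lemma extProc_ext {X Y : ExtProc M} (h1 : ∀ t ω, InDom X t ω ↔ InDom Y t ω)
    (h2 : ∀ t ω, InDom X t ω → val X t ω = val Y t ω) : X = Y :=
  funext fun t => funext fun ω => extProc_eq_iff.mpr ⟨h1 t ω, h2 t ω⟩

/-- The conditions on the effective domain of a continuous process. -/
structure IsEffDomain (D : ℝ≥0 → M.Omega → Prop) : Prop where
  adapted : ∀ (t : ℝ≥0) (ω ω' : M.Omega), AgreeUpTo ω ω' t → (D t ω ↔ D t ω')
  quasiAlways : QuasiAlways D
  down : ∀ (ω : M.Omega) (s t : ℝ≥0), s ≤ t → D t ω → D s ω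

lemma IsEffDomain.and {D E : ℝ≥0 → M.Omega → Prop} (hD : IsEffDomain D) (hE : IsEffDomain E) :
    IsEffDomain fun t ω => D t ω ∧ E t ω :=
  ⟨fun t ω ω' h => and_congr (hD.adapted t ω ω' h) (hE.adapted t ω ω' h),
    hD.quasiAlways.and hE.quasiAlways,
    fun ω s t h ⟨h1, h2⟩ => ⟨hD.down ω s t h h1, hE.down ω s t h h2⟩⟩

lemma IsEffDomain.all {D : ℕ → ℝ≥0 → M.Omega → Prop} (hD : ∀ n, IsEffDomain (D n)) :
    IsEffDomain fun t ω => ∀ n, D n t ω :=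
  ⟨fun t ω ω' h => forall_congr' fun n => (hD n).adapted t ω ω' h,
    QuasiAlways.all fun n => (hD n).quasiAlways,
    fun ω s t h h1 n => (hD n).down ω s t h (h1 n)⟩

lemma IsContinuousProcess.down {X : ExtProc M} (hX : IsContinuousProcess X) {ω : M.Omega}
    {s t : ℝ≥0} (hst : s ≤ t) (h : InDom X t ω) : InDom X s ω :=
  (isPreconnected_iff_ordConnected.mp (hX.connected ω).isPreconnected).out (hX.zero_mem ω) h
    ⟨bot_le, hst⟩

lemma IsContinuousProcess.isEffDomain {X : ExtProc M} (hX : IsContinuousProcess X) :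
    IsEffDomain (InDom X) :=
  ⟨fun t ω ω' h => by unfold InDom; rw [hX.adapted t ω ω' h], hX.quasiAlways_real,
    fun _ _ _ h => hX.down h⟩

lemma IsContinuousProcess.val_adapted {X : ExtProc M} (hX : IsContinuousProcess X) {t : ℝ≥0}
    {ω ω' : M.Omega} (h : AgreeUpTo ω ω' t) : val X t ω = val X t ω' := by
  unfold val; rw [hX.adapted t ω ω' h]

lemma IsContinuousProcess.continuousOn_Icc {X : ExtProc M} (hX : IsContinuousProcess X)
    {t : ℝ≥0} {ω : M.Omega} (h : InDom X t ω) :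
    ContinuousOn (fun s => val X s ω) (Set.Icc 0 t) :=
  (hX.continuousOn ω).mono fun _ hs => hX.down hs.2 h

lemma IsContinuousProcess.of_isEffDomain {X : ExtProc M} (hD : IsEffDomain (InDom X))
    (had : ∀ t ω ω', AgreeUpTo ω ω' (t : ℝ≥0) → InDom X t ω → val X t ω = val X t ω')
    (hc : ∀ t ω, InDom X t ω → ContinuousOn (fun s => val X s ω) (Set.Icc 0 t)) :
    IsContinuousProcess X := by
  have h0 := hD.quasiAlways.at_zero
  refine ⟨fun t ω ω' h => extProc_eq_iff.mpr ⟨hD.adapted t ω ω' h, had t ω ω' h⟩,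
    hD.quasiAlways, h0, fun ω => ⟨⟨0, h0 ω⟩, ?_⟩, fun ω t ht => ?_⟩
  · exact isPreconnected_iff_ordConnected.mpr
      ⟨fun a _ b hb c hc => hD.down ω c b hc.2 hb⟩
  -- If the domain extends beyond `t`, some `[0, u]` in it is a neighbourhood of `t`; otherwise the
  -- whole domain lies in `[0, t]`.
  · by_cases h : ∃ u, t < u ∧ InDom X u ω
    · obtain ⟨u, htu, hu⟩ := h
      have h1 := hc u ω hu t ⟨bot_le, htu.le⟩
      refine (h1.continuousAt ?_).continuousWithinAt
      filter_upwards [Iio_mem_nhds htu] with s hs using ⟨bot_le, hs.le⟩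
    · push Not at h
      exact (hc t ω ht t ⟨bot_le, le_rfl⟩).mono fun s hs =>
        ⟨bot_le, not_lt.mp fun hts => h s hts hs⟩

lemma IsPartition.isEffDomain {T : ℕ → M.Omega → ℝ≥0∞} (hT : IsPartition T) :
    IsEffDomain fun t ω => (t : ℝ≥0∞) < ⨆ k, T k ω :=
  ⟨fun _ _ _ h => hT.isGrid.lt_iSup_iff h, hT.quasiAlways_gt,
    fun _ s t h h1 => lt_of_le_of_lt (by exact_mod_cast h) h1⟩

/-! ### Continuous martingales -/

lemma continuous_price (ω : M.Omega) (j : Fin M.numTraded) : Continuous (price ω j) :=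
  (ω (Fin.castLE M.numTraded_le j)).continuous

lemma capital_adapted (G : SimpleStrategy M) (c : ℝ) {t : ℝ≥0} {ω ω' : M.Omega}
    (h : AgreeUpTo ω ω' t) : capital G c t ω = capital G c t ω' := by
  unfold capital
  congr 1
  refine tsum_congr fun n => Finset.sum_congr rfl fun j _ => ?_
  have e : ∀ m, price ω j (minTime (G.time m ω) t) = price ω' j (minTime (G.time m ω') t) :=
    fun m => by
      rw [← (G.stopping m).minTime_eq h]
      exact h.price_eq j (by exact_mod_cast minTime_le _ _)
  rcases le_or_gt (G.time n ω) t with h1 | h1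
  · rw [e, e, G.bet_stopped n ω ω' (h.mono h1)]
  · have h2 := ((G.stopping n).lt_iff h).mp h1
    have h3 := h1.trans_le (G.mono ω n.le_succ)
    have h4 := h2.trans_le (G.mono ω' n.le_succ)
    rw [minTime_of_le h1.le, minTime_of_le h2.le, minTime_of_le h3.le, minTime_of_le h4.le]
    simp

lemma continuous_capital (G : SimpleStrategy M) (c : ℝ) (ω : M.Omega) :
    Continuous fun t => capital G c t ω := by
  simp only [capital_eq_patch]
  refine continuous_const.add (continuous_iff_continuousAt.mpr fun t => ?_)
  have h := patch_continuousOn (G.mono ω) (F := fun n s => ∑ j, G.bet n ω j * price ω j s)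
    (lt_iSup_of_tendsto_top (G.tendsto_top ω) (t + 1)) fun k =>
      (continuous_finsetSum _ fun j _ => (continuous_price ω j).const_mul _).continuousOn
  have h1 : t < t + 1 := lt_add_one t
  refine (h t ⟨bot_le, h1.le⟩).continuousAt ?_
  filter_upwards [Iio_mem_nhds h1] with s hs using ⟨bot_le, hs.le⟩

lemma IsContinuousMartingale.isContinuous {X : ExtProc M}
    (hX : IsContinuousMartingale X) : IsContinuousProcess X := by
  cases hX with
  | simple G c =>
    refine .of_isEffDomain ⟨fun _ _ _ _ => Iff.rfl, .of_forall fun _ _ => rfl, fun _ _ _ _ _ => rfl⟩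
      (fun t ω ω' h _ => capital_adapted G c h) fun t ω _ => (continuous_capital G c ω).continuousOn
  | lim X Xs hX _ _ _ => exact hX

lemma IsSimple.isContinuousMartingale {c : ℝ} {P : ℝ≥0 → M.Omega → ℝ} (hP : IsSimple c P) :
    IsContinuousMartingale (mkProc (fun _ _ => True) P) := by
  obtain ⟨G, rfl⟩ := isSimple_iff.mp hP
  have := IsContinuousMartingale.simple G c
  convert this using 1
  exact extProc_ext (fun t ω => ⟨fun _ => rfl, fun _ => inDom_mkProc.mpr trivial⟩)
    fun t ω _ => by rw [val_mkProc trivial]; rfl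

/-- Adaptedness and continuity of `f` on `D` are inherited from the approximations, so only the
domain has to be examined. -/
lemma IsContinuousMartingale.of_tendsto {D : ℝ≥0 → M.Omega → Prop} {f : ℝ≥0 → M.Omega → ℝ}
    {Xs : ℕ → ExtProc M} (hD : IsEffDomain D) (hXs : ∀ k, IsContinuousMartingale (Xs k))
    (hdom : ∀ k t ω, D t ω → InDom (Xs k) t ω)
    (hlim : ∀ t ω, D t ω →
      TendstoUniformlyOn (fun k s => val (Xs k) s ω) (fun s => f s ω) atTop (Set.Icc 0 t)) :
    IsContinuousMartingale (mkProc D f) := by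
  have hv : ∀ t ω, D t ω → Set.EqOn (fun s => f s ω) (fun s => val (mkProc D f) s ω)
      (Set.Icc 0 t) := fun t ω h s hs => (val_mkProc (hD.down ω s t hs.2 h)).symm
  have hlim' : ∀ t ω, D t ω → TendstoUniformlyOn (fun k s => val (Xs k) s ω)
      (fun s => val (mkProc D f) s ω) atTop (Set.Icc 0 t) := fun t ω h =>
    (hlim t ω h).congr_right (hv t ω h)
  refine .lim _ Xs (.of_isEffDomain ?_ (fun t ω ω' h ht => ?_) fun t ω ht => ?_) hXs
    (fun k t ω h => hdom k t ω (inDom_mkProc.mp h)) fun t ω h => hlim' t ω (inDom_mkProc.mp h)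
  · have : InDom (mkProc D f) = D := funext fun t => funext fun ω => propext inDom_mkProc
    rwa [this]
  · rw [inDom_mkProc] at ht
    have h1 := (hlim' t ω ht).tendsto_at (x := t) ⟨bot_le, le_rfl⟩
    have h2 := (hlim' t ω' ((hD.adapted t ω ω' h).mp ht)).tendsto_at (x := t) ⟨bot_le, le_rfl⟩
    refine tendsto_nhds_unique h1 (h2.congr fun k => ?_)
    exact ((hXs k).isContinuous.val_adapted h).symm
  · rw [inDom_mkProc] at ht
    exact (hlim' t ω ht).continuousOn (Frequently.of_forall fun k =>
      (hXs k).isContinuous.continuousOn_Icc (hdom k t ω ht))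

lemma IsContinuousMartingale.restrict {X : ExtProc M} (hX : IsContinuousMartingale X)
    {D : ℝ≥0 → M.Omega → Prop} {f : ℝ≥0 → M.Omega → ℝ} (hD : IsEffDomain D)
    (h : ∀ t ω, D t ω → InDom X t ω) (hf : ∀ t ω, D t ω → f t ω = val X t ω) :
    IsContinuousMartingale (mkProc D f) := by
  refine .of_tendsto (Xs := fun _ => X) hD (fun _ => hX) (fun _ => h) fun t ω ht => ?_
  refine Metric.tendstoUniformlyOn_iff.mpr fun ε hε => Eventually.of_forall fun k s hs => ?_
  rw [hf s ω (hD.down ω s t hs.2 ht), dist_self]; exact hε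

lemma IsContinuousMartingale.add {X Y : ExtProc M} (hX : IsContinuousMartingale X)
    (hY : IsContinuousMartingale Y) :
    IsContinuousMartingale (mkProc (fun t ω => InDom X t ω ∧ InDom Y t ω)
      fun t ω => val X t ω + val Y t ω) := by
  induction hX with
  | simple G c =>
    induction hY with
    | simple G' c' =>
      have := ((isSimple_capital G c).add (isSimple_capital G' c')).isContinuousMartingale
      exact this.restrict (((IsContinuousMartingale.simple G c).isContinuous.isEffDomain).and
        ((IsContinuousMartingale.simple G' c').isContinuous.isEffDomain)) (by simp)
        fun t ω _ => by rw [val_mkProc trivial]; rfl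
    | lim Y Ys hY hYs hdom hlim ih =>
      have hD := ((IsContinuousMartingale.simple G c).isContinuous.isEffDomain).and
        hY.isEffDomain
      refine .of_tendsto hD ih (fun k t ω h => inDom_mkProc.mpr ⟨h.1, hdom k t ω h.2⟩)
        fun t ω h => ?_
      refine (TendstoUniformlyOn.congr (F := fun k s => capital G c s ω + val (Ys k) s ω) ?_
        (Eventually.of_forall fun k s hs => ?_))
      · refine Metric.tendstoUniformlyOn_iff.mpr fun ε hε => ?_
        filter_upwards [Metric.tendstoUniformlyOn_iff.mp (hlim t ω h.2) ε hε] with k hk s hs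
        have := hk s hs
        rw [Real.dist_eq] at this ⊢
        convert this using 2
        change capital G c s ω + _ - _ = _
        ring
      · have := hD.down ω s t hs.2 h
        beta_reduce
        rw [val_mkProc]
        · rfl
        · exact ⟨this.1, hdom k s ω this.2⟩
  | lim X Xs hX hXs hdom hlim ih =>
    have hD := hX.isEffDomain.and hY.isContinuous.isEffDomain
    refine .of_tendsto hD ih (fun k t ω h => inDom_mkProc.mpr ⟨hdom k t ω h.1, h.2⟩)
      fun t ω h => ?_
    refine (TendstoUniformlyOn.congr (F := fun k s => val (Xs k) s ω + val Y s ω) ?_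
      (Eventually.of_forall fun k s hs => ?_))
    · refine Metric.tendstoUniformlyOn_iff.mpr fun ε hε => ?_
      filter_upwards [Metric.tendstoUniformlyOn_iff.mp (hlim t ω h.1) ε hε] with k hk s hs
      have := hk s hs
      rw [Real.dist_eq] at this ⊢
      convert this using 2
      ring
    · have := hD.down ω s t hs.2 h
      beta_reduce
      rw [val_mkProc]
      exact ⟨hdom k s ω this.1, this.2⟩

/-- Deterministic initial capital survives limits. It allows `c` to serve as a constant in bets,
levels and bounds that must not depend on `ω`. -/
lemma IsContinuousMartingale.exists_initial {X : ExtProc M} (hX : IsContinuousMartingale X) :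
    ∃ c : ℝ, ∀ ω, val X 0 ω = c := by
  induction hX with
  | simple G c => exact ⟨c, fun ω => (isSimple_capital G c).zero ω⟩
  | lim X Xs hX hXs hdom hlim ih =>
    choose c hc using ih
    have h : ∀ ω, Tendsto c atTop (𝓝 (val X 0 ω)) := fun ω => by
      have := (hlim 0 ω (hX.zero_mem ω)).tendsto_at (x := 0) ⟨le_rfl, le_rfl⟩
      simpa only [hc] using this
    by_cases hne : Nonempty M.Omega
    · obtain ⟨ω₀⟩ := hne
      exact ⟨val X 0 ω₀, fun ω => tendsto_nhds_unique (h ω) (h ω₀)⟩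
    · exact ⟨0, fun ω => absurd ⟨ω⟩ hne⟩

/-! ### Simple integrals of continuous martingales -/

lemma tendstoUniformlyOn_patch {T : ℕ → ℝ≥0∞} (hT : Monotone T) {xs : ℕ → ℝ≥0 → ℝ} {x : ℝ≥0 → ℝ}
    {t : ℝ≥0} (ht : (t : ℝ≥0∞) < ⨆ k, T k)
    (h : TendstoUniformlyOn xs x atTop (Set.Icc 0 t)) (c : ℝ) (f : ℕ → ℝ) :
    TendstoUniformlyOn (fun i s => c + patch T (fun k s => f k * xs i s) s)
      (fun s => c + patch T (fun k s => f k * x s) s) atTop (Set.Icc 0 t) := by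
  obtain ⟨K, hK⟩ := exists_lt_of_lt_iSup ht
  refine Metric.tendstoUniformlyOn_iff.mpr fun ε hε => ?_
  -- Each of the finitely many intervals meeting `[0, t]` contributes two endpoint errors, so the
  -- total error is at most `2 * A` times the uniform one.
  set A := ∑ k ∈ Finset.range K, |f k| with hA
  have hA0 : 0 ≤ A := Finset.sum_nonneg fun _ _ => abs_nonneg _
  filter_upwards [Metric.tendstoUniformlyOn_iff.mp h (ε / (2 * A + 1)) (by positivity)] with i hi s hs
  have hsK : (s : ℝ≥0∞) ≤ T K := le_trans (by exact_mod_cast hs.2) hK.le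
  rw [Real.dist_eq, add_sub_add_left_eq_sub, patch_eq_sum hT _ hsK, patch_eq_sum hT _ hsK,
    ← Finset.sum_sub_distrib]
  have hb : ∀ a, |x (minTime a s) - xs i (minTime a s)| ≤ ε / (2 * A + 1) := fun a =>
    (hi _ ⟨bot_le, (minTime_le _ _).trans hs.2⟩).le
  calc |_| ≤ ∑ k ∈ Finset.range K, |f k| * (2 * (ε / (2 * A + 1))) := by
        refine (Finset.abs_sum_le_sum_abs _ _).trans (Finset.sum_le_sum fun k _ => ?_)
        rw [← mul_sub, ← mul_sub, ← mul_sub, abs_mul]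
        refine mul_le_mul_of_nonneg_left ?_ (abs_nonneg _)
        have h1 := abs_le.mp (hb (T k))
        have h2 := abs_le.mp (hb (T (k + 1)))
        rw [abs_le]; constructor <;> linarith
    _ = 2 * A * (ε / (2 * A + 1)) := by rw [← Finset.sum_mul]; ring
    _ < ε := by
        rw [← mul_div_assoc, div_lt_iff₀ (by positivity)]
        nlinarith

/-- Simple integrals of continuous martingales along grids that exhaust the time axis. -/
lemma IsContinuousMartingale.integral_of_tendsto {X : ExtProc M} (hX : IsContinuousMartingale X)
    {T : ℕ → M.Omega → ℝ≥0∞} (hT : IsGrid T) (hTtop : ∀ ω, Tendsto (fun n => T n ω) atTop (𝓝 ⊤))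
    {f : ℕ → M.Omega → ℝ} (hf : ∀ n, KnownAt (T n) (f n)) (hfb : ∀ n, ∃ C : ℝ, ∀ ω, |f n ω| ≤ C)
    (c : ℝ) : IsContinuousMartingale (mkProc (InDom X) fun t ω =>
      c + patch (fun n => T n ω) (fun n s => f n ω * val X s ω) t) := by
  induction hX with
  | simple G d =>
    refine ((isSimple_capital G d).integral (d := c) hT hTtop hf hfb).isContinuousMartingale.restrict
      (IsContinuousMartingale.simple G d).isContinuous.isEffDomain (by simp)
      fun t ω _ => by rw [val_mkProc trivial]; rfl
  | lim X Xs hX hXs hdom hlim ih =>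
    refine .of_tendsto hX.isEffDomain ih (fun k t ω h => inDom_mkProc.mpr (hdom k t ω h))
      fun t ω h => ?_
    refine (tendstoUniformlyOn_patch (hT.mono ω) (lt_iSup_of_tendsto_top (hTtop ω) t)
      (hlim t ω h) c _).congr (Eventually.of_forall fun k s hs => ?_)
    beta_reduce
    rw [val_mkProc (hdom k s ω (hX.down hs.2 h))]

/-- The grid that consists of the first `K` times of `T`. -/
def truncGrid (T : ℕ → M.Omega → ℝ≥0∞) (K k : ℕ) (ω : M.Omega) : ℝ≥0∞ :=
  if k ≤ K then T k ω else ⊤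

lemma IsGrid.truncGrid {T : ℕ → M.Omega → ℝ≥0∞} (hT : IsGrid T) (K : ℕ) :
    IsGrid (truncGrid T K) := by
  refine ⟨fun k => ?_, fun ω => by simp [Market.truncGrid, hT.zero], fun ω i j hij => ?_⟩
  · unfold Market.truncGrid
    split_ifs
    exacts [hT.stopping k, isStoppingTime_const ⊤]
  · simp only [Market.truncGrid]
    split_ifs with h1 h2
    · exact hT.mono ω hij
    · exact le_top
    · omega
    · exact le_rfl

/-- Simple integrals of continuous martingales along partitions. -/
lemma IsContinuousMartingale.integral {X : ExtProc M} (hX : IsContinuousMartingale X)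
    {T : ℕ → M.Omega → ℝ≥0∞} (hT : IsPartition T)
    {f : ℕ → M.Omega → ℝ} (hf : ∀ n, KnownAt (T n) (f n)) (hfb : ∀ n, ∃ C : ℝ, ∀ ω, |f n ω| ≤ C)
    (c : ℝ) : IsContinuousMartingale (mkProc
      (fun t ω => InDom X t ω ∧ (t : ℝ≥0∞) < ⨆ k, T k ω) fun t ω =>
      c + patch (fun n => T n ω) (fun n s => f n ω * val X s ω) t) := by
  have hD := hX.isContinuous.isEffDomain
  -- A partition exhausts the time axis only quasi-always, whereas a strategy must do so for each
  -- `ω`. The integral is therefore taken over the first `K` intervals; on `[0, t]` it no longer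
  -- depends on `K` once the `K`th time exceeds `t`.
  refine .of_tendsto (hD.and hT.isEffDomain) (fun K => hX.integral_of_tendsto
    (T := truncGrid T K) (f := fun k ω => if k < K then f k ω else 0) (hT.isGrid.truncGrid K)
    (fun ω => ?_) (fun n => ?_) (fun n => ?_) c) (fun k t ω h => inDom_mkProc.mpr h.1)
    fun t ω h => ?_
  · rw [← tendsto_add_atTop_iff_nat (K + 1)]
    refine tendsto_const_nhds.congr fun n => ?_
    rw [Market.truncGrid, if_neg (by omega)]
  · by_cases h : n < K
    · have e : Market.truncGrid T K n = T n := by funext ω; simp [Market.truncGrid, h.le]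
      simpa [h, e] using hf n
    · simpa [h] using KnownAt.const 0
  · by_cases h : n < K
    · simpa [h] using hfb n
    · exact ⟨0, fun ω => by simp [h]⟩
  · obtain ⟨K₀, hK₀⟩ := exists_lt_of_lt_iSup h.2
    refine Metric.tendstoUniformlyOn_iff.mpr fun ε hε => ?_
    filter_upwards [eventually_ge_atTop K₀] with K hK s hs
    rw [val_mkProc (hD.down ω s t hs.2 h.1)]
    have hs' : (s : ℝ≥0∞) ≤ T K₀ ω := le_trans (by exact_mod_cast hs.2) hK₀.le
    have hs'' : (s : ℝ≥0∞) ≤ truncGrid T K K₀ ω := by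
      rwa [Market.truncGrid, if_pos hK]
    rw [patch_eq_sum (hT.mono ω) _ hs', patch_eq_sum ((hT.isGrid.truncGrid K).mono ω) _ hs'']
    have : ∀ k ∈ Finset.range K₀, f k ω * val X (minTime (T (k + 1) ω) s) ω -
        f k ω * val X (minTime (T k ω) s) ω =
        (if k < K then f k ω else 0) * val X (minTime (truncGrid T K (k + 1) ω) s) ω -
        (if k < K then f k ω else 0) * val X (minTime (truncGrid T K k ω) s) ω := by
      intro k hk
      have hk : k < K := (Finset.mem_range.mp hk).trans_le hK
      rw [Market.truncGrid, Market.truncGrid, if_pos hk, if_pos (by omega), if_pos (by omega)]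
    rw [Finset.sum_congr rfl this, dist_self]
    exact hε

/-- Scaling is the simple integral with the bet `a` held forever, which spares another induction. -/
lemma IsContinuousMartingale.const_mul {X : ExtProc M} (hX : IsContinuousMartingale X) (a : ℝ) :
    IsContinuousMartingale (mkProc (InDom X) fun t ω => a * val X t ω) := by
  obtain ⟨c, hc⟩ := hX.exists_initial
  have h := hX.integral_of_tendsto (T := stopGrid fun _ => ⊤)
    (isGrid_stopGrid (isStoppingTime_const ⊤)) (stopGrid_tendsto _)
    (f := fun n ω => a * holdFirst n ω) (fun n => (KnownAt.const a).mul (knownAt_holdFirst _ n))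
    (fun n => by
      obtain ⟨C, hC⟩ := bounded_holdFirst (M := M) n
      exact ⟨|a| * C, fun ω => by
        rw [abs_mul]; exact mul_le_mul_of_nonneg_left (hC ω) (abs_nonneg _)⟩) (a * c)
  refine h.restrict hX.isContinuous.isEffDomain (fun t ω h => inDom_mkProc.mpr h)
    fun t ω ht => ?_
  rw [val_mkProc ht]
  simp only [mul_assoc]
  rw [patch_const_mul, patch_stopGrid (isStoppingTime_const ⊤) (fun s => val X s ω), hc,
    minTime_of_le le_top]
  ring

/-! ### Measurable versions -/

/-- Jointly measurable and adapted real-valued functions. -/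
structure IsMeasAdapted (f : ℝ≥0 → M.Omega → ℝ) : Prop where
  measurable : Measurable fun p : ℝ≥0 × M.Omega => f p.1 p.2
  adapted : ∀ t ω ω', AgreeUpTo ω ω' (t : ℝ≥0) → f t ω = f t ω'

lemma measurable_price (j : Fin M.numTraded) :
    Measurable fun p : ℝ≥0 × M.Omega => price p.2 j p.1 := by
  have h : ∀ t, Measurable fun ω : M.Omega => price ω j t := fun t => by
    have h1 : Measurable fun ω : M.Omega => path ω t := by
      refine Measurable.mono (comap_measurable _) (le_iSup (fun t : ℝ≥0 =>
        MeasurableSpace.comap (fun ω : M.Omega => path ω t) MeasurableSpace.pi) t) le_rfl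
    exact measurable_pi_iff.mp h1 _
  exact MeasureTheory.measurable_uncurry_of_continuous_of_measurable (u := fun (t : ℝ≥0) (ω : M.Omega) =>
    price ω j t) (fun ω => continuous_price ω j) h

lemma measurable_minTime {τ : M.Omega → ℝ≥0∞} (hτ : Measurable τ) :
    Measurable fun p : ℝ≥0 × M.Omega => minTime (τ p.2) p.1 := by
  unfold minTime; fun_prop

lemma isMeasAdapted_capital (G : SimpleStrategy M) (c : ℝ) : IsMeasAdapted (capital G c) := by
  refine ⟨?_, fun t ω ω' h => capital_adapted G c h⟩
  have h : ∀ N : ℕ, Measurable fun p : ℝ≥0 × M.Omega => c + ∑ n ∈ Finset.range N,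
      ∑ j, G.bet n p.2 j * (price p.2 j (minTime (G.time (n + 1) p.2) p.1) -
        price p.2 j (minTime (G.time n p.2) p.1)) := by
    intro N
    refine measurable_const.add (Finset.measurable_sum _ fun n _ => Finset.measurable_sum _
      fun j _ => ?_)
    refine ((measurable_pi_iff.mp (G.bet_measurable n) j).comp measurable_snd).mul (Measurable.sub ?_ ?_)
    · exact (measurable_price j).comp
        ((measurable_minTime (G.stopping (n + 1)).1).prodMk measurable_snd)
    · exact (measurable_price j).comp
        ((measurable_minTime (G.stopping n).1).prodMk measurable_snd)
  refine measurable_of_tendsto_metrizable h (tendsto_pi_nhds.mpr fun p => ?_)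
  obtain ⟨K, hK⟩ := exists_lt_of_lt_iSup (lt_iSup_of_tendsto_top (G.tendsto_top p.2) p.1)
  refine (HasSum.tendsto_sum_nat ?_).const_add c
  refine (summable_of_ne_finset_zero (s := Finset.range K) fun k hk => ?_).hasSum
  have hk : K ≤ k := by simpa using hk
  rw [minTime_of_le (hK.le.trans (G.mono p.2 hk)),
    minTime_of_le (hK.le.trans (G.mono p.2 (hk.trans k.le_succ)))]
  simp

/-- Bets based on `X` have to be measurable in `ω`, but the effective domain of a limit is not known
to be measurable. Limits of versions of the approximations, with the default value of `limUnder`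
where there is no convergence, are measurable and adapted everywhere. -/
lemma IsContinuousMartingale.exists_version {X : ExtProc M} (hX : IsContinuousMartingale X) :
    ∃ f : ℝ≥0 → M.Omega → ℝ, IsMeasAdapted f ∧ ∀ t ω, InDom X t ω → val X t ω = f t ω := by
  induction hX with
  | simple G c => exact ⟨capital G c, isMeasAdapted_capital G c, fun t ω _ => rfl⟩
  | lim X Xs hX hXs hdom hlim ih =>
    choose f hf hv using ih
    refine ⟨fun t ω => limUnder atTop fun k => f k t ω, ⟨?_, fun t ω ω' h => ?_⟩, fun t ω h => ?_⟩
    · exact (MeasureTheory.StronglyMeasurable.limUnder (f := fun k (p : ℝ≥0 × M.Omega) => f k p.1 p.2)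
        fun k => (hf k).measurable.stronglyMeasurable).measurable
    · simp only [fun k => (hf k).adapted t ω ω' h]
    · refine (Tendsto.limUnder_eq ?_).symm
      refine ((hlim t ω h).tendsto_at (x := t) ⟨bot_le, le_rfl⟩).congr fun k => ?_
      exact hv k t ω (hdom k t ω h)

section MeasAdapted

variable {f g : ℝ≥0 → M.Omega → ℝ}

lemma IsMeasAdapted.knownAt (hf : IsMeasAdapted f) {τ : M.Omega → ℝ≥0∞} (hτ : IsStoppingTime τ) :
    KnownAt τ fun ω => f (τ ω).toNNReal ω := by
  refine ⟨hf.measurable.comp (hτ.1.ennreal_toNNReal.prodMk measurable_id), fun ω ω' h => ?_⟩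
  rw [← hτ.2 ω ω' h]
  rcases eq_or_ne (τ ω) ⊤ with h1 | h1
  · rw [h1] at h; rw [h.eq_of_top]
  · exact hf.adapted _ ω ω' (by rwa [ENNReal.coe_toNNReal h1])

lemma IsMeasAdapted.comp₂ (hf : IsMeasAdapted f) (hg : IsMeasAdapted g) {φ : ℝ → ℝ → ℝ}
    (hφ : Measurable (Function.uncurry φ)) : IsMeasAdapted fun t ω => φ (f t ω) (g t ω) :=
  ⟨hφ.comp (hf.measurable.prodMk hg.measurable),
    fun t ω ω' h => by rw [hf.adapted t ω ω' h, hg.adapted t ω ω' h]⟩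

lemma IsMeasAdapted.comp (hf : IsMeasAdapted f) {φ : ℝ → ℝ} (hφ : Measurable φ) :
    IsMeasAdapted fun t ω => φ (f t ω) :=
  ⟨hφ.comp hf.measurable, fun t ω ω' h => by rw [hf.adapted t ω ω' h]⟩

lemma IsMeasAdapted.stopped (hf : IsMeasAdapted f) {τ : M.Omega → ℝ≥0∞} (hτ : IsStoppingTime τ) :
    IsMeasAdapted fun t ω => f (minTime (τ ω) t) ω := by
  refine ⟨hf.measurable.comp ((measurable_minTime hτ.1).prodMk measurable_snd), fun t ω ω' h => ?_⟩
  rw [← hτ.minTime_eq h]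
  exact hf.adapted _ _ _ (h.mono (by exact_mod_cast minTime_le _ _))

end MeasAdapted

/-! ### Hitting times -/

lemma exists_left_of_continuousOn {x : ℝ≥0 → ℝ} {s t : ℝ≥0} (hc : ContinuousOn x (Set.Icc 0 t))
    (hst : s ≤ t) (hs : 0 < s) {U : Set ℝ} (hU : U ∈ 𝓝 (x s)) :
    ∃ l < s, ∀ r, l < r → r ≤ s → x r ∈ U := by
  have h := (hc s ⟨bot_le, hst⟩).mono (Set.Icc_subset_Icc_right hst) hU
  rw [mem_map, nhdsWithin_Icc_eq_nhdsLE hs] at h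
  obtain ⟨l, hl, hl2⟩ := (mem_nhdsLE_iff_exists_Ioc_subset' hs).mp h
  exact ⟨l, hl, fun r h1 h2 => hl2 ⟨h1, h2⟩⟩

lemma exists_right_of_continuousOn {x : ℝ≥0 → ℝ} {s t : ℝ≥0} (hc : ContinuousOn x (Set.Icc 0 t))
    (hst : s < t) {U : Set ℝ} (hU : U ∈ 𝓝 (x s)) :
    ∃ u, s < u ∧ ∀ r, s ≤ r → r < u → x r ∈ U := by
  have h := (hc s ⟨bot_le, hst.le⟩).mono (Set.Icc_subset_Icc_left (bot_le (a := s))) hU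
  rw [mem_map, nhdsWithin_Icc_eq_nhdsGE hst] at h
  obtain ⟨u, hu, hu2⟩ := (mem_nhdsGE_iff_exists_Ico_subset' hst).mp h
  exact ⟨u, hu, fun r h1 h2 => hu2 ⟨h1, h2⟩⟩

/-- The infimum of the times in a countable dense set at which `g` exceeds `b`. -/
def denseHit (g : ℝ≥0 → M.Omega → ℝ) (b : ℝ) (ω : M.Omega) : ℝ≥0∞ :=
  ⨅ n : ℕ, if b < g (TopologicalSpace.denseSeq ℝ≥0 n) ω then
    ((TopologicalSpace.denseSeq ℝ≥0 n : ℝ≥0) : ℝ≥0∞) else ⊤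

section hitting

variable {g : ℝ≥0 → M.Omega → ℝ}

lemma measurable_denseHit (hg : IsMeasAdapted g) (b : ℝ) : Measurable (denseHit g b) := by
  refine Measurable.iInf fun n => Measurable.ite ?_ measurable_const measurable_const
  exact measurableSet_lt measurable_const (hg.measurable.comp (measurable_const.prodMk measurable_id))

lemma denseHit_lt_iff {b : ℝ} {ω : M.Omega} {c : ℝ≥0∞} :
    denseHit g b ω < c ↔ ∃ n, b < g (TopologicalSpace.denseSeq ℝ≥0 n) ω ∧
      ((TopologicalSpace.denseSeq ℝ≥0 n : ℝ≥0) : ℝ≥0∞) < c := by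
  unfold denseHit
  rw [iInf_lt_iff]
  refine exists_congr fun n => ?_
  split_ifs with h
  · simp [h]
  · simp [h]

lemma denseHit_le {b : ℝ} {ω : M.Omega} {n : ℕ}
    (h : b < g (TopologicalSpace.denseSeq ℝ≥0 n) ω) :
    denseHit g b ω ≤ (TopologicalSpace.denseSeq ℝ≥0 n : ℝ≥0) := by
  refine (iInf_le _ n).trans ?_
  rw [if_pos h]

lemma le_denseHit {b : ℝ} {ω : M.Omega} {c : ℝ≥0∞}
    (h : ∀ n, b < g (TopologicalSpace.denseSeq ℝ≥0 n) ω →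
      c ≤ (TopologicalSpace.denseSeq ℝ≥0 n : ℝ≥0)) : c ≤ denseHit g b ω := by
  refine le_iInf fun n => ?_
  split_ifs with h1
  exacts [h n h1, le_top]

lemma denseHit_mono {b b' : ℝ} (h : b ≤ b') (ω : M.Omega) : denseHit g b ω ≤ denseHit g b' ω :=
  le_denseHit fun _ hn => denseHit_le (h.trans_lt hn)

/-- Dense times may approach the infimum from the right, so agreement strictly beyond the infimum is
what transfers it to the other path. -/
lemma denseHit_le_of_agree (hg : IsMeasAdapted g) {b : ℝ} {ω ω' : M.Omega} {c : ℝ≥0∞}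
    (h : AgreeUpTo ω ω' c) (hc : denseHit g b ω < c) : denseHit g b ω' ≤ denseHit g b ω := by
  refine le_of_forall_gt fun r hr => ?_
  obtain ⟨n, h1, h2⟩ := denseHit_lt_iff.mp (lt_min hr hc)
  refine denseHit_lt_iff.mpr ⟨n, ?_, h2.trans_le (min_le_left _ _)⟩
  rwa [← hg.adapted _ ω ω' (h.mono (h2.le.trans (min_le_right _ _)))]

lemma le_of_le_denseHit {b : ℝ} {ω : M.Omega} {s t : ℝ≥0}
    (hc : ContinuousOn (fun s => g s ω) (Set.Icc 0 t)) (hst : s ≤ t) (hs : 0 < s)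
    (h : (s : ℝ≥0∞) ≤ denseHit g b ω) : g s ω ≤ b := by
  by_contra! hb
  obtain ⟨l, hl, hl2⟩ := exists_left_of_continuousOn hc hst hs (Ioi_mem_nhds hb)
  obtain ⟨_, ⟨n, rfl⟩, h1, h2⟩ :=
    (TopologicalSpace.denseRange_denseSeq ℝ≥0).exists_between hl
  have := h.trans (denseHit_le (hl2 _ h1 h2.le))
  exact absurd h2 (not_lt.mpr (by exact_mod_cast this))

lemma lt_denseHit {b : ℝ} {ω : M.Omega} {s t : ℝ≥0}
    (hc : ContinuousOn (fun s => g s ω) (Set.Icc 0 t)) (hst : s < t)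
    (h : (s : ℝ≥0∞) ≤ denseHit g b ω) (hb : g s ω < b) : (s : ℝ≥0∞) < denseHit g b ω := by
  obtain ⟨u, hu, hu2⟩ := exists_right_of_continuousOn hc hst (Iio_mem_nhds hb)
  refine lt_of_lt_of_le (by exact_mod_cast hu : (s : ℝ≥0∞) < u) (le_denseHit fun n hn => ?_)
  by_contra! h1
  have h2 := h.trans (denseHit_le hn)
  exact absurd hn (not_lt.mpr (le_of_lt (hu2 _ (by exact_mod_cast h2) (by exact_mod_cast h1))))

/-- A stopping time at which `g` reaches the level `a`, along the continuous paths of `g`. -/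
lemma exists_hitting (hg : IsMeasAdapted g) {a : ℝ} (h0 : ∀ ω, g 0 ω < a) :
    ∃ τ : M.Omega → ℝ≥0∞, IsStoppingTime τ ∧
      (∀ ω t, ContinuousOn (fun s => g s ω) (Set.Icc 0 t) →
        ((t : ℝ≥0∞) ≤ τ ω → g t ω ≤ a) ∧ (τ ω = t → a ≤ g t ω)) ∧
      ∀ ω (c : ℝ≥0∞) (b : ℝ), b < a → (∀ s : ℝ≥0, (s : ℝ≥0∞) < c → g s ω ≤ b) → c ≤ τ ω := by
  classical
  set b : ℕ → ℝ := fun m => a - (1 / 2) ^ m with hb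
  have hblt : ∀ m, b m < a := fun m => by simp only [hb]; linarith [pow_pos (one_half_pos (α := ℝ)) m]
  have hbmono : Monotone b := fun i j hij => by
    have := pow_le_pow_of_le_one (by norm_num : (0 : ℝ) ≤ 1 / 2) (by norm_num) hij
    simp only [hb]; linarith
  have hex : ∀ y < a, ∃ m, y < b m := fun y hy => by
    obtain ⟨m, hm⟩ := exists_pow_lt_of_lt_one (sub_pos.mpr hy) (by norm_num : (1 / 2 : ℝ) < 1)
    exact ⟨m, by simp only [hb]; linarith⟩
  -- Hitting times of levels `b m` increasing to `a`: the supremum is to be the time of reaching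
  -- `a`, and countably many dense times keep it measurable.
  set τ₀ : M.Omega → ℝ≥0∞ := fun ω => ⨆ m, denseHit g (b m) ω with hτ₀
  have hle : ∀ m ω, denseHit g (b m) ω ≤ τ₀ ω := fun m ω => le_iSup (fun m => denseHit g (b m) ω) m
  have hτ₀m : Measurable τ₀ := Measurable.iSup fun m => measurable_denseHit hg _
  -- On `A` all the approximating times precede `τ₀`, so agreement up to `τ₀` determines them.
  -- Outside `A` the time is set to `⊤`, where agreement means equality of the paths. This makes it
  -- a stopping time even though `g` may be discontinuous.
  set A : Set M.Omega := {ω | ∀ m, denseHit g (b m) ω < τ₀ ω} with hA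
  have hAm : MeasurableSet A := by
    rw [hA, Set.ofPred_forall]
    exact MeasurableSet.iInter fun m => measurableSet_lt (measurable_denseHit hg _) hτ₀m
  refine ⟨fun ω => if ω ∈ A then τ₀ ω else ⊤, ⟨?_, fun ω ω' h => ?_⟩, fun ω t hc => ⟨fun ht => ?_,
    fun ht => ?_⟩, fun ω c y hy hcy => ?_⟩
  · exact Measurable.ite hAm hτ₀m measurable_const
  · beta_reduce at h ⊢
    by_cases hω : ω ∈ A
    · rw [if_pos hω] at h
      have e : ∀ m, denseHit g (b m) ω' = denseHit g (b m) ω := fun m => by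
        have h1 := denseHit_le_of_agree hg h (hω m)
        exact le_antisymm h1 (denseHit_le_of_agree hg h.symm (h1.trans_lt (hω m)))
      have e0 : τ₀ ω' = τ₀ ω := by simp only [hτ₀, e]
      have hω' : ω' ∈ A := fun m => by rw [e, e0]; exact hω m
      rw [if_pos hω, if_pos hω', e0]
    · rw [if_neg hω] at h
      rw [h.eq_of_top]
  · have key : ∀ s ≤ t, (s : ℝ≥0∞) ≤ τ₀ ω → g s ω ≤ a := by
      intro s hst hs
      rcases eq_or_lt_of_le (bot_le (a := s)) with h | h
      · rw [← h]; exact (h0 ω).le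
      by_contra! hlt
      obtain ⟨l, hl, hl2⟩ := exists_left_of_continuousOn hc hst h (Ioi_mem_nhds hlt)
      obtain ⟨r, hr1, hr2⟩ := exists_between hl
      have h3 : (r : ℝ≥0∞) < τ₀ ω := lt_of_lt_of_le (by exact_mod_cast hr2) hs
      obtain ⟨m, hm⟩ := lt_iSup_iff.mp h3
      have := le_of_le_denseHit hc (hr2.le.trans hst) (bot_le.trans_lt hr1) hm.le
      exact absurd (hl2 r hr1 hr2.le) (not_lt.mpr (this.trans (hblt m).le))
    rcases le_or_gt (t : ℝ≥0∞) (τ₀ ω) with h | h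
    · exact key t le_rfl h
    -- Here `τ₀ ω < t` and `ω ∉ A`, so the level `b m₀` is already hit only at `τ₀`. By continuity
    -- `g` is below `a` at `τ₀` and stays below some higher level for a while after it, so that
    -- level is hit later than `τ₀`, contrary to the supremum.
    exfalso
    have hω : ω ∉ A := fun hω => by
      beta_reduce at ht; rw [if_pos hω] at ht; exact absurd h (not_lt.mpr ht)
    simp only [hA, Set.mem_ofPred_eq, not_forall, not_lt] at hω
    obtain ⟨m₀, hm₀⟩ := hω
    lift τ₀ ω to ℝ≥0 using ne_top_of_lt h with s₀ hs₀
    have hst : s₀ < t := by exact_mod_cast h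
    have hlt : g s₀ ω < a := by
      rcases eq_or_lt_of_le (bot_le (a := s₀)) with h1 | h1
      · rw [← h1]; exact h0 ω
      · exact (le_of_le_denseHit hc hst.le h1 hm₀).trans_lt (hblt m₀)
    obtain ⟨m, hm⟩ := hex _ hlt
    have h2 : g s₀ ω < b (max m m₀) := hm.trans_le (hbmono (le_max_left _ _))
    have h3 := lt_denseHit hc hst (hm₀.trans (denseHit_mono (hbmono (le_max_right m m₀)) ω)) h2
    have h4 := hle (max m m₀) ω
    rw [← hs₀] at h4
    exact absurd h3 (not_lt.mpr h4)
  · by_cases hω : ω ∈ A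
    · beta_reduce at ht
      rw [if_pos hω] at ht
      by_contra! hlt
      have ht0 : 0 < t := by
        have h1 := hω 0
        rw [ht] at h1
        exact_mod_cast pos_of_gt h1
      obtain ⟨m, hm⟩ := hex _ hlt
      obtain ⟨l, hl, hl2⟩ := exists_left_of_continuousOn hc le_rfl ht0 (Iio_mem_nhds hm)
      have h1 : (l : ℝ≥0∞) < τ₀ ω := by rw [ht]; exact_mod_cast hl
      obtain ⟨m', hm'⟩ := lt_iSup_iff.mp h1
      have h2 : (l : ℝ≥0∞) < denseHit g (b (max m m')) ω :=
        hm'.trans_le (denseHit_mono (hbmono (le_max_right _ _)) ω)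
      have h3 := hω (max m m')
      -- On `A` every level is exceeded at dense times arbitrarily close to `τ₀` from the left,
      -- against `g < b m` on `(l, t]`.
      obtain ⟨n, hn1, hn2⟩ := denseHit_lt_iff.mp h3
      have h4 := h2.trans_le (denseHit_le hn1)
      rw [ht] at hn2
      have h5 := hl2 _ (by exact_mod_cast h4) (by exact_mod_cast hn2.le)
      exact absurd hn1 (not_lt.mpr (le_of_lt (lt_of_lt_of_le h5 (hbmono (le_max_left _ _)))))
    · beta_reduce at ht
      rw [if_neg hω] at ht
      exact absurd ht ENNReal.top_ne_coe
  · have h1 : c ≤ τ₀ ω := by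
      obtain ⟨m, hm⟩ := hex y hy
      refine le_trans (le_denseHit fun n hn => ?_) (hle m ω)
      by_contra! h
      exact absurd hn (not_lt.mpr ((hcy _ h).trans hm.le))
    beta_reduce
    split_ifs
    exacts [h1, le_top]

end hitting

/-! ### Fine grids -/

section fine

variable {f g : ℝ≥0 → M.Omega → ℝ}

lemma minTime_toNNReal {a : ℝ≥0∞} {s : ℝ≥0} (h : a ≤ s) : minTime a s = a.toNNReal := by
  unfold minTime; rw [min_eq_left h]

/-- This is the hitting time of the level `a` by the larger of the two displacements since `τ`.
Truncation at `τ` makes the displacements vanish up to `τ`, so the new time is not earlier. -/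
lemma exists_next_time (hf : IsMeasAdapted f) (hg : IsMeasAdapted g) {a : ℝ} (ha : 0 < a)
    {τ : M.Omega → ℝ≥0∞} (hτ : IsStoppingTime τ) :
    ∃ σ : M.Omega → ℝ≥0∞, IsStoppingTime σ ∧ (∀ ω, τ ω ≤ σ ω) ∧
      ∀ ω (t : ℝ≥0), ContinuousOn (fun s => f s ω) (Set.Icc 0 t) →
        ContinuousOn (fun s => g s ω) (Set.Icc 0 t) →
        (τ ω ≤ t → (t : ℝ≥0∞) ≤ σ ω → |f t ω - f (τ ω).toNNReal ω| ≤ a ∧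
          |g t ω - g (τ ω).toNNReal ω| ≤ a) ∧
        (σ ω = t → a ≤ |f t ω - f (τ ω).toNNReal ω| ∨ a ≤ |g t ω - g (τ ω).toNNReal ω|) := by
  set G : ℝ≥0 → M.Omega → ℝ := fun t ω =>
    max |f t ω - f (minTime (τ ω) t) ω| |g t ω - g (minTime (τ ω) t) ω| with hG
  have hGm : IsMeasAdapted G := by
    have h1 := (hf.comp₂ (hf.stopped hτ) (φ := fun x y => |x - y|)
      (by unfold Function.uncurry; fun_prop))
    have h2 := (hg.comp₂ (hg.stopped hτ) (φ := fun x y => |x - y|)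
      (by unfold Function.uncurry; fun_prop))
    exact h1.comp₂ h2 (φ := max) (measurable_fst.max measurable_snd)
  obtain ⟨σ, hσ, h1, h2⟩ := exists_hitting hGm (a := a) fun ω => by simp [hG, ha]
  have hle : ∀ ω, τ ω ≤ σ ω := fun ω => h2 ω (τ ω) 0 ha fun s hs => by
    simp [hG, minTime_of_le hs.le]
  refine ⟨σ, hσ, hle, fun ω t hcf hcg => ?_⟩
  have hm : Set.MapsTo (minTime (τ ω)) (Set.Icc 0 t) (Set.Icc 0 t) := fun s hs =>
    ⟨bot_le, (minTime_le _ s).trans hs.2⟩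
  have hc : ContinuousOn (fun s => G s ω) (Set.Icc 0 t) :=
    (hcf.sub (hcf.comp (continuous_minTime _).continuousOn hm)).abs.sup
      (hcg.sub (hcg.comp (continuous_minTime _).continuousOn hm)).abs
  obtain ⟨h3, h4⟩ := h1 ω t hc
  refine ⟨fun ht1 ht2 => ?_, fun ht => ?_⟩
  · have := h3 ht2
    rwa [hG, max_le_iff, minTime_toNNReal ht1] at this
  · have := h4 ht
    rwa [hG, le_max_iff, minTime_toNNReal ((hle ω).trans ht.le)] at this

/-- Each interval ends when `f` or `g` has moved by `ε / 2`, which bounds oscillations by `ε`. If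
the times stayed below `t` they would converge, and continuity would make the displacements tend to
zero. -/
lemma exists_fine_grid (hf : IsMeasAdapted f) (hg : IsMeasAdapted g) {ε : ℝ} (hε : 0 < ε) :
    ∃ T : ℕ → M.Omega → ℝ≥0∞, IsGrid T ∧
      ∀ ω (t : ℝ≥0), ContinuousOn (fun s => f s ω) (Set.Icc 0 t) →
        ContinuousOn (fun s => g s ω) (Set.Icc 0 t) →
        OscLE (fun k => T k ω) (fun s => f s ω) ε t ∧ OscLE (fun k => T k ω) (fun s => g s ω) ε t ∧
        (t : ℝ≥0∞) < ⨆ k, T k ω := by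
  choose next hn1 hn2 hn3 using fun τ : {τ : M.Omega → ℝ≥0∞ // IsStoppingTime τ} =>
    exists_next_time hf hg (half_pos hε) τ.2
  let T' : ℕ → {τ : M.Omega → ℝ≥0∞ // IsStoppingTime τ} := fun k =>
    Nat.rec ⟨fun _ => 0, isStoppingTime_const 0⟩ (fun _ τ => ⟨next τ, hn1 τ⟩) k
  have hmono : ∀ ω, Monotone fun k => (T' k).1 ω := fun ω =>
    monotone_nat_of_le_succ fun k => hn2 (T' k) ω
  refine ⟨fun k => (T' k).1, ⟨fun k => (T' k).2, fun ω => rfl, hmono⟩, fun ω t hcf hcg => ?_⟩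
  have hstep : ∀ k (s : ℝ≥0), s ≤ t → _ := fun k s hs =>
    hn3 (T' k) ω s (hcf.mono (Set.Icc_subset_Icc_right hs)) (hcg.mono (Set.Icc_subset_Icc_right hs))
  refine ⟨fun k u v h1 h2 h3 h4 h5 h6 => ?_, fun k u v h1 h2 h3 h4 h5 h6 => ?_, ?_⟩
  · have e1 := abs_le.mp ((hstep k u h5).1 h1 h2).1
    have e2 := abs_le.mp ((hstep k v h6).1 h3 h4).1
    rw [abs_le]; constructor <;> linarith
  · have e1 := abs_le.mp ((hstep k u h5).1 h1 h2).2
    have e2 := abs_le.mp ((hstep k v h6).1 h3 h4).2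
    rw [abs_le]; constructor <;> linarith
  · by_contra! hle
    have hTle : ∀ k, (T' k).1 ω ≤ t := fun k => (le_iSup (fun k => (T' k).1 ω) k).trans hle
    set u : ℕ → ℝ≥0 := fun k => ((T' k).1 ω).toNNReal with hu
    have hcoe : ∀ k, ((u k : ℝ≥0) : ℝ≥0∞) = (T' k).1 ω := fun k =>
      ENNReal.coe_toNNReal (ne_top_of_le_ne_top ENNReal.coe_ne_top (hTle k))
    have hut : ∀ k, u k ≤ t := fun k => by
      rw [← ENNReal.coe_le_coe, hcoe]; exact hTle k
    have humono : Monotone u := fun i j hij => by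
      rw [← ENNReal.coe_le_coe, hcoe, hcoe]; exact hmono ω hij
    have hlim := tendsto_atTop_ciSup humono ⟨t, by rintro _ ⟨k, rfl⟩; exact hut k⟩
    set L := ⨆ k, u k
    have hL : L ∈ Set.Icc 0 t := ⟨bot_le, ciSup_le hut⟩
    have hw : Tendsto u atTop (𝓝[Set.Icc 0 t] L) :=
      tendsto_nhdsWithin_iff.mpr ⟨hlim, Eventually.of_forall fun k => ⟨bot_le, hut k⟩⟩
    have diff : ∀ x : ℝ≥0 → ℝ, ContinuousOn x (Set.Icc 0 t) →
        ∀ᶠ k in atTop, |x (u (k + 1)) - x (u k)| < ε / 2 := fun x hx => by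
      have h1 := (hx L hL).tendsto.comp hw
      have h2 := ((h1.comp (tendsto_add_atTop_nat 1)).sub h1).abs
      rw [sub_self, abs_zero] at h2
      exact h2.eventually (gt_mem_nhds (half_pos hε))
    obtain ⟨k, hk1, hk2⟩ := ((diff _ hcf).and (diff _ hcg)).exists
    rcases (hstep k (u (k + 1)) (hut (k + 1))).2 (hcoe (k + 1)).symm with h | h
    · exact absurd hk1 (not_lt.mpr h)
    · exact absurd hk2 (not_lt.mpr h)

end fine

lemma IsContinuousMartingale.version_continuousOn {X : ExtProc M} (hX : IsContinuousProcess X)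
    {f : ℝ≥0 → M.Omega → ℝ} (hf : ∀ t ω, InDom X t ω → val X t ω = f t ω) {t : ℝ≥0} {ω : M.Omega}
    (h : InDom X t ω) : ContinuousOn (fun s => f s ω) (Set.Icc 0 t) :=
  (hX.continuousOn_Icc h).congr fun s hs => (hf s ω (hX.down hs.2 h)).symm

/-! ### Continuous martingales bounded below as supermartingales -/

/-- In the limit step the approximations need not be bounded below. They are stopped on reaching
`-(a + ε)`, which uniform convergence to `X ≥ -a` eventually prevents from happening before `σ` and
`t`; then `ε` tends to `0`. Arbitrary `a` and `σ` are in the statement so that the induction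
hypothesis applies to the extra stopping. -/
lemma IsContinuousMartingale.exists_supermartingale {X : ExtProc M}
    (hX : IsContinuousMartingale X) : ∀ (a : ℝ) (σ : M.Omega → ℝ≥0∞), IsStoppingTime σ →
      (∀ t ω, InDom X t ω → (t : ℝ≥0∞) ≤ σ ω → -a ≤ val X t ω) →
      ∃ S : ℝ≥0 → M.Omega → ℝ≥0∞, IsNonnegSupermartingale S ∧
        ∀ t ω, InDom X t ω → S t ω = ENNReal.ofReal (val X (minTime (σ ω) t) ω + a) := by
  induction hX with
  | simple G c =>
    intro a σ hσ h
    have hP := ((isSimple_capital G c).stopped hσ).add (isSimple_const a)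
    refine ⟨_, hP.isNonnegSupermartingale fun t ω => ?_, fun t ω _ => rfl⟩
    have := h (minTime (σ ω) t) ω rfl (coe_minTime_le _ _)
    change -a ≤ capital G c _ ω at this
    linarith
  | lim X Xs hX hXs hdom hlim ih =>
    intro a σ hσ h
    have key : ∀ ε : ℝ, 0 < ε → ∃ S : ℝ≥0 → M.Omega → ℝ≥0∞, IsNonnegSupermartingale S ∧
        ∀ t ω, InDom X t ω → S t ω = ENNReal.ofReal (val X (minTime (σ ω) t) ω + (a + ε)) := by
      intro ε hε
      have hmart : IsContinuousMartingale X := .lim X Xs hX hXs hdom hlim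
      choose f hf hfv using fun k => (hXs k).exists_version
      -- A hitting time needs a start strictly below the level for all `ω` at once; the initial
      -- values are deterministic, so one path suffices.
      have hev : ∀ᶠ k in atTop, ∀ ω, -f k 0 ω < a + ε := by
        choose c hc using fun k => (hXs k).exists_initial
        let ω₀ : M.Omega := fun _ => 0
        have h1 := (hlim 0 ω₀ (hX.zero_mem ω₀)).tendsto_at (x := 0) ⟨le_rfl, le_rfl⟩
        have h2 := h 0 ω₀ (hX.zero_mem ω₀) bot_le
        filter_upwards [h1.eventually (lt_mem_nhds (by linarith : -(a + ε) < val X 0 ω₀))] with k hk ω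
        rw [← hfv k 0 ω ((hXs k).isContinuous.zero_mem ω), hc, ← hc k ω₀]
        linarith
      obtain ⟨k₀, hk₀⟩ := eventually_atTop.mp hev
      choose τ hτ hτ1 _ using fun k : ℕ => exists_hitting ((hf (k₀ + k)).comp measurable_neg)
        (hk₀ (k₀ + k) (Nat.le_add_right _ _))
      have hcont : ∀ k t ω, InDom (Xs (k₀ + k)) t ω →
          ContinuousOn (fun s => -f (k₀ + k) s ω) (Set.Icc 0 t) := fun k t ω ht =>
        (IsContinuousMartingale.version_continuousOn (hXs _).isContinuous (hfv _) ht).neg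
      choose S hS1 hS2 using fun k : ℕ => ih (k₀ + k) (a + ε) (fun ω => min (σ ω) (τ k ω))
        (hσ.min (hτ k)) fun t ω ht htσ => by
          have := (hτ1 k ω t (hcont k t ω ht)).1 (htσ.trans (min_le_right _ _))
          rw [hfv _ t ω ht]; linarith
      refine ⟨_, .liminf S hS1, fun t ω ht => ?_⟩
      have hunif := (Metric.tendstoUniformlyOn_iff.mp (hlim t ω ht) ε hε)
      have hunif2 := (tendsto_add_atTop_nat k₀).eventually hunif
      have hstopped : ∀ᶠ k in atTop, S k t ω =
          ENNReal.ofReal (val (Xs (k₀ + k)) (minTime (σ ω) t) ω + (a + ε)) := by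
        filter_upwards [hunif2] with k hk
        rw [hS2 k t ω (hdom _ t ω ht)]
        congr 3
        by_cases hle : min (σ ω) (t : ℝ≥0∞) ≤ τ k ω
        · unfold minTime
          rw [min_right_comm, min_eq_left hle]
        -- At the hitting time `s` the approximation is at most `-(a + ε)` while `X` is at least
        -- `-a`, against their distance being less than `ε`.
        · exfalso
          push Not at hle
          have hlt := lt_min_iff.mp hle
          obtain ⟨s, hs⟩ : ∃ s : ℝ≥0, (s : ℝ≥0∞) = τ k ω :=
            ⟨_, ENNReal.coe_toNNReal (ne_top_of_lt hlt.2)⟩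
          rw [← hs] at hlt
          have hst : s ≤ t := by exact_mod_cast hlt.2.le
          have hsX := hX.down hst ht
          have h1 := (hτ1 k ω s (hcont k s ω (hdom _ s ω hsX))).2 hs.symm
          have h2 := h s ω hsX hlt.1.le
          have h3 := hk s ⟨bot_le, hst⟩
          rw [← hfv _ s ω (hdom _ s ω hsX)] at h1
          rw [add_comm k k₀, Real.dist_eq, abs_lt] at h3
          linarith
      have hmem : minTime (σ ω) t ∈ Set.Icc 0 t := ⟨bot_le, minTime_le _ _⟩
      have htend : Tendsto (fun k => ENNReal.ofReal
          (val (Xs (k₀ + k)) (minTime (σ ω) t) ω + (a + ε))) atTop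
          (𝓝 (ENNReal.ofReal (val X (minTime (σ ω) t) ω + (a + ε)))) := by
        refine (ENNReal.continuous_ofReal.tendsto _).comp (Tendsto.add_const _ ?_)
        have h1 := (hlim t ω ht).tendsto_at hmem
        have h2 := h1.comp (tendsto_add_atTop_nat k₀)
        refine h2.congr fun k => ?_
        simp [add_comm]
      exact (htend.congr' (hstopped.mono fun _ h => h.symm)).liminf_eq
    choose S hS1 hS2 using fun m : ℕ => key ((1 / 2) ^ m) (by positivity)
    refine ⟨_, .liminf S hS1, fun t ω ht => ?_⟩
    refine Tendsto.liminf_eq ?_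
    simp only [hS2 _ t ω ht]
    refine (ENNReal.continuous_ofReal.tendsto _).comp (Tendsto.const_add _ ?_)
    simpa using (tendsto_pow_atTop_nhds_zero_of_lt_one (by norm_num : (0 : ℝ) ≤ 1 / 2)
      (by norm_num)).const_add a

/-! ### Comparison of simple integrals of close integrands -/

/-- The nearest point of `[-B, B]`. -/
def clip (B y : ℝ) : ℝ := max (-B) (min B y)

lemma measurable_clip (B : ℝ) : Measurable (clip B) :=
  measurable_const.max (measurable_const.min measurable_id)

lemma clip_of_abs_le {B y : ℝ} (h : |y| ≤ B) : clip B y = y := by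
  rw [abs_le] at h
  unfold clip
  rw [min_eq_right h.2, max_eq_right h.1]

lemma abs_clip_le {B : ℝ} (hB : 0 ≤ B) (y : ℝ) : |clip B y| ≤ B := by
  rw [abs_le]
  exact ⟨le_max_left _ _, max_le (by linarith) (min_le_left _ _)⟩

lemma patch_merge {T S : ℕ → ℝ≥0∞} (hT : Monotone T) (hS : Monotone S) (hT0 : T 0 = 0)
    (hS0 : S 0 = 0) (p q : ℕ → ℝ) (x : ℝ≥0 → ℝ) {t : ℝ≥0} (h1 : (t : ℝ≥0∞) < ⨆ k, T k)
    (h2 : (t : ℝ≥0∞) < ⨆ k, S k) :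
    patch (mergeTime T S) (fun i s => (q (mergeIdx T S i).2 - p (mergeIdx T S i).1) * x s) t =
      patch S (fun l s => q l * x s) t - patch T (fun k s => p k * x s) t := by
  have := eq_add_patch (mergeTime_mono hT hS hT0 hS0) (mergeTime_zero hT0 hS0)
    (P := fun t => patch S (fun l s => q l * x s) t - patch T (fun k s => p k * x s) t)
    (F := fun i s => (q (mergeIdx T S i).2 - p (mergeIdx T S i).1) * x s)
    (lt_iSup_mergeTime hT hS h1 h2) fun i u v hu huv hv _ => by
      have e1 := patch_local hT (fun k s => p k * x s)
        ((le_mergeTime_left T S i).trans hu.symm.le) huv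
        (hv.trans (mergeTime_succ_le_left hT hS hT0 hS0 i))
      have e2 := patch_local hS (fun k s => q k * x s)
        ((le_mergeTime_right T S i).trans hu.symm.le) huv
        (hv.trans (mergeTime_succ_le_right hT hS hT0 hS0 i))
      linear_combination e2 - e1
  simp only [patch_zero, sub_zero, zero_add] at this
  exact this.symm

lemma IsPartition.merge {T S : ℕ → M.Omega → ℝ≥0∞} (hT : IsPartition T) (hS : IsPartition S) :
    IsPartition (merge T S) := by
  have h := hT.isGrid.merge hS.isGrid
  exact ⟨h.stopping, h.zero, h.mono, (hT.quasiAlways_gt.and hS.quasiAlways_gt).mono fun t ω ht =>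
    lt_iSup_mergeTime (hT.mono ω) (hS.mono ω) ht.1 ht.2⟩

/-- If the integrands `p` and `q` differ by at most `δ` and the integrator moves by at most `K`
before `σ`, there is a supermartingale that starts from `δ² K²` and is at least `l²` once the
integrals have differed by more than `l` before `σ`. -/
lemma IsContinuousMartingale.exists_supermartingale_of_close {X : ExtProc M}
    (hX : IsContinuousMartingale X) {T S : ℕ → M.Omega → ℝ≥0∞} (hT : IsPartition T)
    (hS : IsPartition S) {p q : ℕ → M.Omega → ℝ} (hp : ∀ n, KnownAt (T n) (p n))
    (hpb : ∀ n, ∃ C : ℝ, ∀ ω, |p n ω| ≤ C) (hq : ∀ n, KnownAt (S n) (q n))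
    (hqb : ∀ n, ∃ C : ℝ, ∀ ω, |q n ω| ≤ C) {σ : M.Omega → ℝ≥0∞} (hσ : IsStoppingTime σ)
    {K δ l : ℝ} (hδ : 0 ≤ δ) (hl : 0 < l)
    (hK : ∀ t ω, InDom X t ω → (t : ℝ≥0∞) ≤ σ ω → |val X t ω - val X 0 ω| ≤ K)
    (hpq : ∀ t ω, InDom X t ω → (t : ℝ≥0∞) ≤ σ ω → ∀ i j, T i ω ≤ t → (t : ℝ≥0∞) ≤ T (i + 1) ω →
      S j ω ≤ t → (t : ℝ≥0∞) ≤ S (j + 1) ω → |q j ω - p i ω| ≤ δ) :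
    ∃ Z : ℝ≥0 → M.Omega → ℝ≥0∞, IsNonnegSupermartingale Z ∧
      (∀ ω, Z 0 ω = ENNReal.ofReal (δ ^ 2 * K ^ 2)) ∧
      ∀ t ω, InDom X t ω → (t : ℝ≥0∞) < ⨆ k, T k ω → (t : ℝ≥0∞) < ⨆ k, S k ω →
        ∀ s ≤ t, (s : ℝ≥0∞) ≤ σ ω →
          l < |patch (fun k => S k ω) (fun k s => q k ω * val X s ω) s -
            patch (fun k => T k ω) (fun k s => p k ω * val X s ω) s| →
          ENNReal.ofReal (l ^ 2) ≤ Z t ω := by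
  have hXp := hX.isContinuous
  have hG := hT.merge hS
  set G := merge T S with hGdef
  set d : ℕ → M.Omega → ℝ := fun i ω => q (idx T S i ω).2 ω - p (idx T S i ω).1 ω with hd
  have hdk : ∀ i, KnownAt (G i) (d i) := fun i =>
    hT.isGrid.knownAt_select hS.isGrid (F := fun r ω => q r.2 ω - p r.1 ω) (fun r =>
      ((hq r.2).mono fun ω => le_max_right _ _).sub ((hp r.1).mono fun ω => le_max_left _ _)) i
  have hdb : ∀ i, ∃ C : ℝ, ∀ ω, |d i ω| ≤ C := fun i =>
    bounded_select (F := fun r ω => q r.2 ω - p r.1 ω) (fun r => by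
      obtain ⟨C, hC⟩ := hqb r.2
      obtain ⟨C', hC'⟩ := hpb r.1
      exact ⟨C + C', fun ω => (abs_sub _ _).trans (add_le_add (hC ω) (hC' ω))⟩) i
  have hDm := hX.integral hG hdk hdb 0
  set E : ℝ≥0 → M.Omega → Prop := fun t ω => InDom X t ω ∧ (t : ℝ≥0∞) < ⨆ k, G k ω with hE
  have hEd : IsEffDomain E := hXp.isEffDomain.and hG.isEffDomain
  set D : ℝ≥0 → M.Omega → ℝ := fun t ω => patch (fun n => G n ω) (fun n s => d n ω * val X s ω) t
    with hD
  obtain ⟨Dv, hDv, hDe⟩ := hDm.exists_version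
  obtain ⟨xv, hxv, hxe⟩ := hX.exists_version
  obtain ⟨c, hc⟩ := hX.exists_initial
  have hDe' : ∀ t ω, E t ω → Dv t ω = D t ω := fun t ω h => by
    rw [← hDe t ω (inDom_mkProc.mpr h), val_mkProc h, zero_add]
  -- `B` bounds the bet 2(Dd - δ²(X - c)) as long as |D| ≤ l, |d| ≤ δ and |X - c| ≤ K, so clipping
  -- at `B` has no effect before `σ` and `ρ`.
  set B : ℝ := 2 * (l * δ + δ ^ 2 * K) with hB
  have hE0 : ∀ ω, E 0 ω := hEd.quasiAlways.at_zero
  have hK0 : 0 ≤ K := by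
    let ω₀ : M.Omega := fun _ => 0
    exact (abs_nonneg _).trans (hK 0 ω₀ (hE0 ω₀).1 bot_le)
  have hB0 : 0 ≤ B := by positivity
  set h : ℕ → M.Omega → ℝ := fun i ω => clip B (2 * (Dv (G i ω).toNNReal ω * d i ω -
    δ ^ 2 * (xv (G i ω).toNNReal ω - c))) with hh
  have hhk : ∀ i, KnownAt (G i) (h i) := fun i => by
    have h1 := (hDv.knownAt (hG.stopping i)).mul (hdk i)
    have h2 := (KnownAt.const (δ ^ 2)).mul ((hxv.knownAt (hG.stopping i)).sub (KnownAt.const c))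
    exact (((KnownAt.const 2).mul (h1.sub h2))).comp (measurable_clip B)
  have hUm := hX.integral hG hhk (fun i => ⟨B, fun ω => abs_clip_le hB0 _⟩) (δ ^ 2 * K ^ 2)
  obtain ⟨ρ, hρ, hρ1, -⟩ := exists_hitting (hDv.comp (φ := fun y => |y|) (by fun_prop)) (a := l)
    fun ω => by simp [hDe' 0 ω (hE0 ω), hD, patch_zero, hl]
  have hDc : ∀ t ω, E t ω → ContinuousOn (fun s => |Dv s ω|) (Set.Icc 0 t) := fun t ω ht =>
    (IsContinuousMartingale.version_continuousOn hDm.isContinuous hDe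
      (inDom_mkProc.mpr ht)).abs
  -- Over an interval of the refinement, with Δ the increment of X from its left endpoint, D²
  -- changes by 2DdΔ + d²Δ² and δ²(X - c)² by 2δ²(X - c)Δ + δ²Δ². As d² ≤ δ², the quadratic terms
  -- compare and the increment of the difference is at most 2(Dd - δ²(X - c))Δ.
  have key : ∀ t ω, E t ω → (t : ℝ≥0∞) ≤ min (σ ω) (ρ ω) → D t ω ^ 2 ≤ δ ^ 2 * K ^ 2 +
      patch (fun n => G n ω) (fun n s => h n ω * val X s ω) t := by
    intro t ω ht hle
    have h1 := patch_le (hG.mono ω) (F := fun _ s => D s ω ^ 2 - δ ^ 2 * (val X s ω - c) ^ 2)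
      (G := fun n s => h n ω * val X s ω) ht.2 fun i u v hu huv hv hvt => by
        have hut := huv.trans hvt
        have hEu := hEd.down ω u t hut ht
        have huκ : (u : ℝ≥0∞) ≤ min (σ ω) (ρ ω) := le_trans (by exact_mod_cast hut) hle
        have e1 : D v ω - D u ω = d i ω * val X v ω - d i ω * val X u ω :=
          patch_local (hG.mono ω) _ hu.symm.le huv hv
        have hdi : |d i ω| ≤ δ := hpq u ω hEu.1 (huκ.trans (min_le_left _ _)) _ _
          ((le_mergeTime_left _ _ i).trans hu.symm.le)
          (hu.le.trans (mergeTime_aux (hT.mono ω) (hS.mono ω) (hT.zero ω) (hS.zero ω) i).1 |>.trans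
            (min_le_left _ _))
          ((le_mergeTime_right _ _ i).trans hu.symm.le)
          (hu.le.trans (mergeTime_aux (hT.mono ω) (hS.mono ω) (hT.zero ω) (hS.zero ω) i).1 |>.trans
            (min_le_right _ _))
        have hx := hK u ω hEu.1 (huκ.trans (min_le_left _ _))
        rw [hc] at hx
        have hDl := (hρ1 ω u (hDc u ω hEu)).1 (huκ.trans (min_le_right _ _))
        have hhi : h i ω = 2 * (D u ω * d i ω - δ ^ 2 * (val X u ω - c)) := by
          simp only [hh, ← hu, ENNReal.toNNReal_coe]
          rw [hDe' u ω hEu] at hDl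
          rw [hDe' u ω hEu, ← hxe u ω hEu.1]
          refine clip_of_abs_le ?_
          rw [abs_mul, abs_two, hB]
          refine mul_le_mul_of_nonneg_left ((abs_sub _ _).trans ?_) (by norm_num)
          rw [abs_mul, abs_mul, abs_of_nonneg (sq_nonneg δ)]
          gcongr
        have hsq : d i ω ^ 2 ≤ δ ^ 2 := by rw [← sq_abs]; gcongr
        have e2 : D v ω = D u ω + d i ω * (val X v ω - val X u ω) := by linarith
        rw [hhi, e2]
        nlinarith [mul_le_mul_of_nonneg_right hsq (sq_nonneg (val X v ω - val X u ω))]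
    rw [patch_const (hG.mono ω) (hG.zero ω) (fun s => D s ω ^ 2 - δ ^ 2 * (val X s ω - c) ^ 2) ht.2]
      at h1
    have h2 : D 0 ω = 0 := patch_zero _ _
    have h3 : (val X t ω - c) ^ 2 ≤ K ^ 2 := by
      rw [← sq_abs, ← hc ω]
      exact pow_le_pow_left₀ (abs_nonneg _) (hK t ω ht.1 (hle.trans (min_le_left _ _))) 2
    rw [h2, hc] at h1
    nlinarith [mul_le_mul_of_nonneg_left h3 (sq_nonneg δ)]
  obtain ⟨Z, hZ, hZe⟩ := hUm.exists_supermartingale 0 _ (hσ.min hρ) fun t ω ht hle => by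
    rw [inDom_mkProc] at ht
    rw [val_mkProc ht, neg_zero]
    exact (sq_nonneg _).trans (key t ω ht hle)
  refine ⟨Z, hZ, fun ω => ?_, fun t ω htX htT htS s hst hsσ hlt => ?_⟩
  · rw [hZe 0 ω (inDom_mkProc.mpr (hE0 ω)), minTime_zero_right, val_mkProc (hE0 ω), patch_zero]
    simp
  · have htE : E t ω := ⟨htX, lt_iSup_mergeTime (hT.mono ω) (hS.mono ω) htT htS⟩
    have hsE := hEd.down ω s t hst htE
    have hst' : (s : ℝ≥0∞) ≤ t := by exact_mod_cast hst
    have hDs : D s ω = _ := patch_merge (hT.mono ω) (hS.mono ω) (hT.zero ω) (hS.zero ω)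
      (fun k => p k ω) (fun k => q k ω) (fun s => val X s ω) (hst'.trans_lt htT)
      (hst'.trans_lt htS)
    rw [← hDs] at hlt
    have hρs : ρ ω < s := by
      by_contra! hle
      have := (hρ1 ω s (hDc s ω hsE)).1 hle
      rw [hDe' s ω hsE] at this
      exact absurd hlt (not_lt.mpr this)
    -- The supermartingale is frozen at `ρ`, so the value reached when |D| = l is still there at
    -- `t`.
    obtain ⟨r, hr⟩ : ∃ r : ℝ≥0, (r : ℝ≥0∞) = ρ ω := ⟨_, ENNReal.coe_toNNReal (ne_top_of_lt hρs)⟩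
    have hrs : r ≤ s := by rw [← hr] at hρs; exact_mod_cast hρs.le
    have hrE := hEd.down ω r t (hrs.trans hst) htE
    have hmin : minTime (min (σ ω) (ρ ω)) t = r :=
      minTime_of_ge (hr.trans (min_eq_right (hρs.le.trans hsσ)).symm) (hrs.trans hst)
    rw [hZe t ω (inDom_mkProc.mpr htE), hmin, val_mkProc hrE, add_zero]
    refine ENNReal.ofReal_le_ofReal (le_trans ?_ (key r ω hrE ?_))
    · have := (hρ1 ω r (hDc r ω hrE)).2 hr.symm
      rw [hDe' r ω hrE] at this
      rw [← sq_abs (D r ω)]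
      exact pow_le_pow_left₀ hl.le this 2
    · rw [hr]; exact le_min (hρs.le.trans hsσ) le_rfl

lemma exists_tendstoUniformlyOn {F : ℕ → ℝ≥0 → ℝ} {A : Set ℝ≥0}
    (h : ∀ᶠ n in atTop, ∀ s ∈ A, |F (n + 1) s - F n s| ≤ (3 / 4) ^ n) :
    ∃ f, TendstoUniformlyOn F f atTop A := by
  obtain ⟨N, hN⟩ := eventually_atTop.mp h
  have hd : ∀ s ∈ A, ∀ n, dist (F (N + n) s) (F (N + (n + 1)) s) ≤ 1 * (3 / 4) ^ n := by
    intro s hs n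
    rw [dist_comm, Real.dist_eq, one_mul, ← add_assoc]
    refine (hN (N + n) (Nat.le_add_right _ _) s hs).trans ?_
    exact pow_le_pow_of_le_one (by norm_num) (by norm_num) (Nat.le_add_left _ _)
  have hex : ∀ s, ∃ a, s ∈ A → Tendsto (fun n => F (N + n) s) atTop (𝓝 a) := fun s => by
    by_cases hs : s ∈ A
    · obtain ⟨a, ha⟩ := cauchySeq_tendsto_of_complete
        (cauchySeq_of_le_geometric (3 / 4) 1 (by norm_num) (hd s hs))
      exact ⟨a, fun _ => ha⟩
    · exact ⟨0, fun h => absurd h hs⟩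
  choose f hf using hex
  refine ⟨f, Metric.tendstoUniformlyOn_iff.mpr fun ε hε => ?_⟩
  have h0 : Tendsto (fun n : ℕ => 1 * (3 / 4 : ℝ) ^ n / (1 - 3 / 4)) atTop (𝓝 0) := by
    have := ((tendsto_pow_atTop_nhds_zero_of_lt_one (by norm_num : (0 : ℝ) ≤ 3 / 4)
      (by norm_num)).const_mul 1).div_const (1 - 3 / 4)
    simpa using this
  obtain ⟨N', hN'⟩ := eventually_atTop.mp (h0.eventually (gt_mem_nhds hε))
  filter_upwards [eventually_ge_atTop (N + N')] with n hn s hs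
  obtain ⟨m, rfl⟩ := Nat.exists_eq_add_of_le (le_of_add_le_left hn : N ≤ n)
  rw [dist_comm]
  exact (dist_le_of_le_geometric_of_tendsto (3 / 4) 1 (by norm_num) (hd s hs) (hf s hs) m).trans_lt
    (hN' m (by omega))

/-- Simple integrals along a sequence of partitions converge uniformly on compact intervals
quasi-always if the integrands converge geometrically before each of a sequence of stopping
times. -/
theorem IsContinuousMartingale.quasiAlways_tendsto {X : ExtProc M} (hX : IsContinuousMartingale X)
    {T : ℕ → ℕ → M.Omega → ℝ≥0∞} (hT : ∀ n, IsPartition (T n)) {p : ℕ → ℕ → M.Omega → ℝ}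
    (hp : ∀ n k, KnownAt (T n k) (p n k)) (hpb : ∀ n k, ∃ C : ℝ, ∀ ω, |p n k ω| ≤ C)
    {σ : ℕ → M.Omega → ℝ≥0∞} (hσ : ∀ m, IsStoppingTime (σ m)) {K C : ℕ → ℝ} (hC : ∀ m, 0 ≤ C m)
    (hcov : ∀ t ω, InDom X t ω → ∃ m, (t : ℝ≥0∞) ≤ σ m ω)
    (hK : ∀ m t ω, InDom X t ω → (t : ℝ≥0∞) ≤ σ m ω → |val X t ω - val X 0 ω| ≤ K m)
    (hpq : ∀ m n t ω, InDom X t ω → (t : ℝ≥0∞) ≤ σ m ω → ∀ i j, T n i ω ≤ t →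
      (t : ℝ≥0∞) ≤ T n (i + 1) ω → T (n + 1) j ω ≤ t → (t : ℝ≥0∞) ≤ T (n + 1) (j + 1) ω →
      |p (n + 1) j ω - p n i ω| ≤ C m * (1 / 2) ^ n) :
    QuasiAlways fun t ω => InDom X t ω ∧ (∀ n, (t : ℝ≥0∞) < ⨆ k, T n k ω) ∧
      ∃ f, TendstoUniformlyOn (fun n s => patch (fun k => T n k ω)
        (fun k s => p n k ω * val X s ω) s) f atTop (Set.Icc 0 t) := by
  have hB := hX.isContinuous.isEffDomain.and (IsEffDomain.all fun n => (hT n).isEffDomain)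
  have main : ∀ m, QuasiAlways fun t ω => (InDom X t ω ∧ ∀ n, (t : ℝ≥0∞) < ⨆ k, T n k ω) →
      (t : ℝ≥0∞) ≤ σ m ω → ∃ f, TendstoUniformlyOn (fun n s => patch (fun k => T n k ω)
        (fun k s => p n k ω * val X s ω) s) f atTop (Set.Icc 0 t) := by
    intro m
    choose Z hZ hZ0 hZl using fun n : ℕ => hX.exists_supermartingale_of_close (hT n) (hT (n + 1))
      (hp n) (hpb n) (hp (n + 1)) (hpb (n + 1)) (hσ m) (K := K m) (δ := C m * (1 / 2) ^ n)
      (l := (3 / 4) ^ n) (mul_nonneg (hC m) (by positivity)) (by positivity) (hK m) (hpq m n)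
    -- With weight 2^n the initial values are C²K² 2^n 4^{-n}, which are summable, while an error
    -- above (3/4)^n makes the term at least (9/8)^n ≥ 1. A finite sum thus allows only finitely
    -- many such errors.
    refine .of_supermartingale (S := fun t ω => ∑' n, ((2 ^ n : ℝ≥0) : ℝ≥0∞) * Z n t ω)
      (u := ∑' n : ℕ, ENNReal.ofReal (C m ^ 2 * K m ^ 2 * (1 / 2) ^ n))
      (IsNonnegSupermartingale.tsum fun n => (hZ n).const_mul _) ?_ (fun ω => ?_) fun t ω ht => ?_
    · exact ((summable_geometric_of_lt_one (by norm_num) (by norm_num)).mul_left _).tsum_ofReal_ne_top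
    · refine tsum_congr fun n => ?_
      rw [hZ0, ← ENNReal.ofReal_coe_nnreal, ← ENNReal.ofReal_mul (by positivity)]
      congr 1
      push_cast
      rw [mul_pow, ← pow_mul, mul_comm n 2, pow_mul]
      have : (2 : ℝ) ^ n * ((1 / 2) ^ 2) ^ n = (1 / 2) ^ n := by rw [← mul_pow]; norm_num
      linear_combination C m ^ 2 * K m ^ 2 * this
    · push Not at ht
      obtain ⟨⟨htX, htT⟩, htσ, hconv⟩ := ht
      by_contra hne
      have h0 := ENNReal.tendsto_atTop_zero_of_tsum_ne_top hne
      have h1 := h0.eventually (gt_mem_nhds one_pos)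
      obtain ⟨f, hf⟩ : ∃ f, TendstoUniformlyOn (fun n s => patch (fun k => T n k ω)
          (fun k s => p n k ω * val X s ω) s) f atTop (Set.Icc 0 t) := by
        refine exists_tendstoUniformlyOn ?_
        filter_upwards [h1] with n hn s hs
        by_contra! hlt
        have h2 := hZl n t ω htX (htT n) (htT (n + 1)) s hs.2
          (le_trans (by exact_mod_cast hs.2) htσ) hlt
        refine absurd hn (not_lt.mpr (le_trans ?_ (mul_le_mul_right h2 _)))
        rw [← ENNReal.ofReal_coe_nnreal, ← ENNReal.ofReal_mul (by positivity), ENNReal.one_le_ofReal]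
        push_cast
        rw [← pow_mul, mul_comm n 2, pow_mul, ← mul_pow]
        exact one_le_pow₀ (by norm_num)
      exact hconv f hf
  refine (hB.quasiAlways.and (QuasiAlways.all main)).mono fun t ω ⟨h1, h2⟩ => ⟨h1.1, h1.2, ?_⟩
  obtain ⟨m, hm⟩ := hcov t ω h1.1
  exact h2 m h1 hm

/-! ### Bounded variation -/

lemma boundedVariationOn_add {x y : ℝ≥0 → ℝ} {s : Set ℝ≥0} (hx : BoundedVariationOn x s)
    (hy : BoundedVariationOn y s) : BoundedVariationOn (fun t => x t + y t) s := by
  refine ne_top_of_le_ne_top (ENNReal.add_ne_top.mpr ⟨hx, hy⟩) (iSup_le fun p => ?_)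
  refine (Finset.sum_le_sum fun i _ => edist_add_add_le _ _ _ _).trans ?_
  rw [Finset.sum_add_distrib]
  exact add_le_add (eVariationOn.sum_le p.2.2.1 p.2.2.2) (eVariationOn.sum_le p.2.2.1 p.2.2.2)

lemma boundedVariationOn_const_mul {x : ℝ≥0 → ℝ} {s : Set ℝ≥0} (hx : BoundedVariationOn x s)
    (a : ℝ) : BoundedVariationOn (fun t => a * x t) s :=
  (lipschitzWith_smul a).comp_boundedVariationOn hx

lemma boundedVariationOn_of_monotoneOn {x : ℝ≥0 → ℝ} {t : ℝ≥0} (hx : MonotoneOn x (Set.Icc 0 t)) :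
    BoundedVariationOn x (Set.Icc 0 t) := by
  have := hx.locallyBoundedVariationOn 0 t ⟨le_rfl, bot_le⟩ ⟨bot_le, le_rfl⟩
  rwa [Set.inter_self] at this

lemma boundedVariationOn_congr {x y : ℝ≥0 → ℝ} {s : Set ℝ≥0} (hx : BoundedVariationOn x s)
    (h : Set.EqOn y x s) : BoundedVariationOn y s := by
  unfold BoundedVariationOn at *
  rwa [eVariationOn.congr h]

/-! ### The quadratic variation process -/

lemma IsFine.oscLE {T : ℕ → ℕ → M.Omega → ℝ≥0∞} {X : ExtProc M} (hT : IsFine T X)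
    (hX : IsContinuousProcess X) (n : ℕ) {t : ℝ≥0} {ω : M.Omega} (ht : InDom X t ω) :
    OscLE (fun k => T n k ω) (fun s => val X s ω) ((1 / 2) ^ (n + 1)) t :=
  fun k u v h1 h2 h3 h4 h5 h6 => by
    have hu := hX.down h5 ht
    have hv := hX.down h6 ht
    have e1 := hT.2 n k ω u v hu hv ⟨h1, h2⟩ ⟨h3, h4⟩
    have e2 := hT.2 n k ω v u hv hu ⟨h3, h4⟩ ⟨h1, h2⟩
    rw [abs_le]; constructor <;> linarith

/-- The bound at the `k`th time depends only on `k`, so bets can be clipped at deterministic levels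
without being changed on the effective domain. -/
lemma OscLE.abs_sub_zero_le {T : ℕ → ℝ≥0∞} (hT : Monotone T) (hT0 : T 0 = 0) {x : ℝ≥0 → ℝ} {ε : ℝ}
    {t : ℝ≥0} (h : OscLE T x ε t) : ∀ (k : ℕ) (u : ℝ≥0), (u : ℝ≥0∞) = T k → u ≤ t →
      |x u - x 0| ≤ k * ε
  | 0, u, hu, _ => by
    rw [hT0] at hu
    have : u = 0 := by exact_mod_cast hu
    simp [this]
  | k + 1, u, hu, hut => by
    have hle : T k ≤ u := (hT k.le_succ).trans hu.symm.le
    obtain ⟨w, hw⟩ : ∃ w : ℝ≥0, (w : ℝ≥0∞) = T k :=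
      ⟨_, ENNReal.coe_toNNReal (ne_top_of_le_ne_top ENNReal.coe_ne_top hle)⟩
    have hwu : w ≤ u := by rw [← hw] at hle; exact_mod_cast hle
    have h1 := h.abs_sub_zero_le hT hT0 k w hw (hwu.trans hut)
    have h2 := h.start hT hw hwu hu.le hut
    have := abs_add_le (x u - x w) (x w - x 0)
    rw [sub_add_sub_cancel] at this
    push_cast
    linarith

/-- The common domain of the approximations to the quadratic variation on which they converge. -/
def QuadDom (T : ℕ → ℕ → M.Omega → ℝ≥0∞) (X : ExtProc M) (t : ℝ≥0) (ω : M.Omega) : Prop :=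
  InDom X t ω ∧ (∀ n, (t : ℝ≥0∞) < ⨆ k, T n k ω) ∧
    ∃ f, TendstoUniformlyOn (fun n s => qvar (fun k => T n k ω) (fun s => val X s ω) s) f atTop
      (Set.Icc 0 t)

lemma inDom_quadVarApprox {T : ℕ → M.Omega → ℝ≥0∞} {X : ExtProc M} {t : ℝ≥0} {ω : M.Omega} :
    InDom (quadVarApprox T X) t ω ↔ InDom X t ω ∧ (t : ℝ≥0∞) < ⨆ k, T k ω := by
  unfold quadVarApprox
  rw [InDom]
  split_ifs with h <;> simp [h]

lemma val_quadVarApprox {T : ℕ → M.Omega → ℝ≥0∞} {X : ExtProc M} {t : ℝ≥0} {ω : M.Omega}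
    (h : InDom X t ω) (ht : (t : ℝ≥0∞) < ⨆ k, T k ω) :
    val (quadVarApprox T X) t ω = qvar (fun k => T k ω) (fun s => val X s ω) t := by
  unfold quadVarApprox
  rw [val, if_pos ⟨h, ht⟩]; rfl

lemma inDom_ucLimit {X : ℕ → ExtProc M} {t : ℝ≥0} {ω : M.Omega} :
    InDom (ucLimit X) t ω ↔ (∀ k, InDom (X k) t ω) ∧
      ∃ f : ℝ≥0 → ℝ, TendstoUniformlyOn (fun k s => val (X k) s ω) f atTop (Set.Icc 0 t) := by
  unfold ucLimit
  rw [InDom]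
  split_ifs with h
  · exact ⟨fun _ => h, fun _ => rfl⟩
  · exact ⟨fun h => by simp at h, fun h' => absurd h' h⟩

lemma val_ucLimit {X : ℕ → ExtProc M} {t : ℝ≥0} {ω : M.Omega} (h : InDom (ucLimit X) t ω) :
    val (ucLimit X) t ω = limUnder atTop fun k => val (X k) t ω := by
  unfold val ucLimit
  rw [if_pos (inDom_ucLimit.mp h)]; rfl

lemma coe_le_trans_lt {s t : ℝ≥0} {a : ℝ≥0∞} (hst : s ≤ t) (h : (t : ℝ≥0∞) < a) :
    (s : ℝ≥0∞) < a := lt_of_le_of_lt (by exact_mod_cast hst) h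

section quadVar

variable {X : ExtProc M} {T : ℕ → ℕ → M.Omega → ℝ≥0∞} {t : ℝ≥0} {ω : M.Omega}

lemma inDom_quadVar (hX : IsContinuousProcess X) :
    InDom (quadVar T X) t ω ↔ QuadDom T X t ω := by
  rw [quadVar, inDom_ucLimit]
  simp only [inDom_quadVarApprox]
  constructor
  · rintro ⟨h, f, hf⟩
    refine ⟨(h 0).1, fun n => (h n).2, f, hf.congr (Eventually.of_forall fun n s hs => ?_)⟩
    exact val_quadVarApprox (hX.down hs.2 (h 0).1) (coe_le_trans_lt hs.2 (h n).2)
  · rintro ⟨h, hT, f, hf⟩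
    refine ⟨fun n => ⟨h, hT n⟩, f, hf.congr (Eventually.of_forall fun n s hs => ?_)⟩
    exact (val_quadVarApprox (hX.down hs.2 h) (coe_le_trans_lt hs.2 (hT n))).symm

lemma QuadDom.mono {s : ℝ≥0} (hX : IsContinuousProcess X) (h : QuadDom T X t ω) (hst : s ≤ t) :
    QuadDom T X s ω :=
  ⟨hX.down hst h.1, fun n => coe_le_trans_lt hst (h.2.1 n),
    h.2.2.imp fun _ hf => hf.mono (Set.Icc_subset_Icc_right hst)⟩

lemma tendsto_quadVar (hX : IsContinuousProcess X) (h : QuadDom T X t ω) :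
    TendstoUniformlyOn (fun n s => qvar (fun k => T n k ω) (fun s => val X s ω) s)
      (fun s => val (quadVar T X) s ω) atTop (Set.Icc 0 t) := by
  obtain ⟨f, hf⟩ := h.2.2
  refine hf.congr_right fun s hs => ?_
  have hs' := (inDom_quadVar hX).mpr (h.mono hX hs.2)
  rw [quadVar, val_ucLimit hs']
  refine (Tendsto.limUnder_eq ((hf.tendsto_at hs).congr fun n => ?_)).symm
  exact (val_quadVarApprox (hX.down hs.2 h.1) (coe_le_trans_lt hs.2 (h.2.1 n))).symm

lemma ucLimit_congr {X : ℕ → ExtProc M} {ω ω' : M.Omega}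
    (h : ∀ k s, s ≤ t → X k s ω = X k s ω') : ucLimit X t ω = ucLimit X t ω' := by
  have hv : ∀ k s, s ≤ t → val (X k) s ω = val (X k) s ω' := fun k s hs => by
    unfold val; rw [h k s hs]
  have hd : ∀ k, InDom (X k) t ω ↔ InDom (X k) t ω' := fun k => by
    unfold InDom; rw [h k t le_rfl]
  refine extProc_eq_iff.mpr ⟨?_, fun _ => ?_⟩
  · rw [inDom_ucLimit, inDom_ucLimit]
    refine and_congr (forall_congr' hd) (exists_congr fun f => ⟨fun hf => ?_, fun hf => ?_⟩)
    · exact hf.congr (Eventually.of_forall fun n s hs => hv n s hs.2)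
    · exact hf.congr (Eventually.of_forall fun n s hs => (hv n s hs.2).symm)
  · have e : InDom (ucLimit X) t ω := by assumption
    have e' : InDom (ucLimit X) t ω' := by
      rw [inDom_ucLimit] at e ⊢
      exact ⟨fun k => (hd k).mp (e.1 k), e.2.imp fun f hf =>
        hf.congr (Eventually.of_forall fun n s hs => hv n s hs.2)⟩
    rw [val_ucLimit e, val_ucLimit e']
    simp only [hv _ t le_rfl]

lemma isAdapted_quadVar (hX : IsContinuousProcess X) (hT : ∀ n, IsGrid (T n)) :
    IsAdapted (quadVar T X) := by
  intro t ω ω' h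
  refine ucLimit_congr fun n s hs => ?_
  have h' : AgreeUpTo ω ω' s := h.mono (by exact_mod_cast hs)
  refine extProc_eq_iff.mpr ⟨?_, fun hd => ?_⟩
  · rw [inDom_quadVarApprox, inDom_quadVarApprox, (hT n).lt_iSup_iff h', InDom, InDom,
      hX.adapted s ω ω' h']
  · rw [inDom_quadVarApprox] at hd
    have hd' : InDom X s ω' ∧ (s : ℝ≥0∞) < ⨆ k, T n k ω' := by
      rwa [InDom, hX.adapted s ω ω' h', (hT n).lt_iSup_iff h'] at hd
    rw [val_quadVarApprox hd.1 hd.2, val_quadVarApprox hd'.1 hd'.2]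
    refine tsum_congr fun k => ?_
    have e : ∀ k, val X (minTime (T n k ω) s) ω = val X (minTime (T n k ω') s) ω' := fun k => by
      rw [← ((hT n).stopping k).minTime_eq h']
      exact hX.val_adapted (h'.mono (by exact_mod_cast minTime_le _ _))
    simp only [e]

lemma quadVar_zero (hX : IsContinuousProcess X) (h : QuadDom T X 0 ω) :
    val (quadVar T X) 0 ω = 0 := by
  have := (tendsto_quadVar hX h).tendsto_at (x := 0) ⟨le_rfl, le_rfl⟩
  refine tendsto_nhds_unique this ?_
  simp [qvar]

/-- The sums of squares are monotone up to `ε n ^ 2`, and this defect disappears in the limit.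
Monotonicity is what makes the quadratic variation a process of finite variation. -/
lemma quadVar_monotoneOn (hX : IsContinuousProcess X) (hT : ∀ n, IsGrid (T n)) {ε : ℕ → ℝ}
    (hε : Tendsto ε atTop (𝓝 0))
    (hosc : ∀ n, OscLE (fun k => T n k ω) (fun s => val X s ω) (ε n) t) (h : QuadDom T X t ω) :
    MonotoneOn (fun s => val (quadVar T X) s ω) (Set.Icc 0 t) := by
  intro u hu v hv huv
  have h1 := ((tendsto_quadVar hX h).tendsto_at hu).sub (hε.pow 2)
  have h2 := (tendsto_quadVar hX h).tendsto_at hv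
  rw [zero_pow two_ne_zero, sub_zero] at h1
  exact le_of_tendsto_of_tendsto' h1 h2 fun n => qvar_sub_ge ((hT n).mono ω) ((hT n).zero ω)
    ((hosc n).mono hv.2) huv (coe_le_trans_lt hv.2 (h.2.1 n))

lemma quadVar_bounded (hX : IsContinuousProcess X) (hT : ∀ n, IsGrid (T n)) {ε : ℕ → ℝ}
    (hε : Tendsto ε atTop (𝓝 0))
    (hosc : ∀ n, OscLE (fun k => T n k ω) (fun s => val X s ω) (ε n) t) (h : QuadDom T X t ω) :
    ∃ B, ∀ s ∈ Set.Icc 0 t, 0 ≤ val (quadVar T X) s ω ∧ val (quadVar T X) s ω ≤ B := by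
  have hm := quadVar_monotoneOn hX hT hε hosc h
  refine ⟨_, fun s hs => ⟨?_, hm hs ⟨bot_le, le_rfl⟩ hs.2⟩⟩
  exact ge_of_tendsto' ((tendsto_quadVar hX h).tendsto_at hs) fun n => qvar_nonneg _ _ _

end quadVar

lemma IsFine.isGrid {T : ℕ → ℕ → M.Omega → ℝ≥0∞} {X : ExtProc M} (hT : IsFine T X) (n : ℕ) :
    IsGrid (T n) := (hT.1 n).isGrid

lemma tendsto_half_pow (m : ℕ) : Tendsto (fun n : ℕ => (1 / 2 : ℝ) ^ (n + m)) atTop (𝓝 0) :=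
  (tendsto_pow_atTop_nhds_zero_of_lt_one (by norm_num) (by norm_num)).comp
    (tendsto_add_atTop_nat m)

/-- The sum of squares in terms of a simple integral. -/
lemma qvar_eq {T : ℕ → ℝ≥0∞} (hT : Monotone T) (hT0 : T 0 = 0) (x : ℝ≥0 → ℝ) {t : ℝ≥0}
    (ht : (t : ℝ≥0∞) < ⨆ k, T k) : qvar T x t = x t ^ 2 - x 0 ^ 2 -
      2 * patch T (fun k s => x (T k).toNNReal * x s) t := by
  rw [← patch_const hT hT0 (fun s => x s ^ 2) ht, ← patch_const_mul, ← patch_sub hT _ _ ht,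
    qvar_eq_patch hT]
  refine patch_congr hT fun k u v hu _ _ _ => ?_
  rw [← hu]
  simp only [ENNReal.toNNReal_coe]
  ring

/-- Stopping times that localize a continuous adapted function. -/
lemma exists_localizing {f : ℝ≥0 → M.Omega → ℝ} (hf : IsMeasAdapted f) (h0 : ∀ ω, f 0 ω = 0) :
    ∃ σ : ℕ → M.Omega → ℝ≥0∞, (∀ m, IsStoppingTime (σ m)) ∧
      ∀ ω (t : ℝ≥0), ContinuousOn (fun s => f s ω) (Set.Icc 0 t) →
        (∀ m : ℕ, (t : ℝ≥0∞) ≤ σ m ω → |f t ω| ≤ m + 1) ∧ ∃ m, (t : ℝ≥0∞) ≤ σ m ω := by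
  choose σ h1 h2 h3 using fun m : ℕ => exists_hitting (hf.comp (φ := fun y => |y|) (by fun_prop))
    (a := m + 1) fun ω => by rw [h0, abs_zero]; positivity
  refine ⟨σ, h1, fun ω t hc => ⟨fun m hm => (h2 m ω t hc.abs).1 hm, ?_⟩⟩
  obtain ⟨B, hB⟩ := isCompact_Icc.exists_bound_of_continuousOn hc
  obtain ⟨m, hm⟩ := exists_nat_gt B
  refine ⟨m, h3 m ω t B (by linarith) fun s hs => hB s ⟨bot_le, ?_⟩⟩
  exact_mod_cast hs.le

/-- Along a fine sequence of partitions the approximations to the quadratic variation of a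
continuous martingale converge quasi-always. -/
theorem IsContinuousMartingale.quasiAlways_quadDom {X : ExtProc M} (hX : IsContinuousMartingale X)
    {T : ℕ → ℕ → M.Omega → ℝ≥0∞} (hT : IsFine T X) : QuasiAlways (QuadDom T X) := by
  have hXp := hX.isContinuous
  obtain ⟨f, hf, hfe⟩ := hX.exists_version
  obtain ⟨c, hc⟩ := hX.exists_initial
  have hf0 : ∀ ω, f 0 ω = c := fun ω => by rw [← hfe 0 ω (hXp.zero_mem ω), hc]
  obtain ⟨σ, hσ, hloc⟩ := exists_localizing (hf.comp (φ := fun y => y - c) (by fun_prop))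
    fun ω => by simp [hf0]
  have hcont : ∀ t ω, InDom X t ω → ContinuousOn (fun s => f s ω - c) (Set.Icc 0 t) :=
    fun t ω ht => (version_continuousOn hXp hfe ht).sub continuousOn_const
  -- By `qvar_eq` the sums of squares converge if the integrals of X against itself do. On the
  -- domain the clipping level `|c| + k` is never exceeded at the `k`th time.
  set p : ℕ → ℕ → M.Omega → ℝ := fun n k ω => clip (|c| + k) (f (T n k ω).toNNReal ω) with hp
  have hpe : ∀ n k ω (u t : ℝ≥0), (u : ℝ≥0∞) = T n k ω → u ≤ t → InDom X t ω →
      p n k ω = val X u ω := fun n k ω u t hu hut ht => by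
    have h1 := (hT.oscLE hXp n ht).abs_sub_zero_le ((hT.1 n).mono ω) ((hT.1 n).zero ω) k u hu hut
    simp only [hp]
    rw [← hu, ENNReal.toNNReal_coe, ← hfe u ω (hXp.down hut ht)]
    refine clip_of_abs_le ?_
    rw [hc] at h1
    have h2 : (k : ℝ) * (1 / 2) ^ (n + 1) ≤ k :=
      mul_le_of_le_one_right (by positivity) (pow_le_one₀ (by norm_num) (by norm_num))
    have := abs_add_le (val X u ω - c) c
    rw [sub_add_cancel] at this
    linarith
  have main := hX.quasiAlways_tendsto hT.1 (p := p)
    (fun n k => (hf.knownAt ((hT.1 n).stopping k)).comp (measurable_clip _))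
    (fun n k => ⟨|c| + k, fun ω => abs_clip_le (by positivity) _⟩) hσ
    (K := fun m => m + 1) (C := fun _ => 1) (fun _ => zero_le_one)
    (fun t ω ht => (hloc ω t (hcont t ω ht)).2) (fun m t ω ht hle => by
      rw [hc, hfe t ω ht]; exact (hloc ω t (hcont t ω ht)).1 m hle)
    fun m n t ω ht _ i j h1 h2 h3 h4 => by
      obtain ⟨u, hu⟩ : ∃ u : ℝ≥0, (u : ℝ≥0∞) = T n i ω :=
        ⟨_, ENNReal.coe_toNNReal (ne_top_of_le_ne_top ENNReal.coe_ne_top h1)⟩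
      obtain ⟨v, hv⟩ : ∃ v : ℝ≥0, (v : ℝ≥0∞) = T (n + 1) j ω :=
        ⟨_, ENNReal.coe_toNNReal (ne_top_of_le_ne_top ENNReal.coe_ne_top h3)⟩
      have hut : u ≤ t := by rw [← hu] at h1; exact_mod_cast h1
      have hvt : v ≤ t := by rw [← hv] at h3; exact_mod_cast h3
      -- Both bets are close to the value of X at the same `t`; the errors add up to 2^{-n-1} +
      -- 2^{-n-2} ≤ 2^{-n}.
      have e1 := abs_le.mp ((hT.oscLE hXp n ht).start ((hT.1 n).mono ω) hu hut h2 le_rfl)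
      have e2 := abs_le.mp ((hT.oscLE hXp (n + 1) ht).start ((hT.1 (n + 1)).mono ω) hv hvt h4 le_rfl)
      rw [hpe n i ω u t hu hut ht, hpe (n + 1) j ω v t hv hvt ht, one_mul, abs_le]
      have : (0 : ℝ) < (1 / 2) ^ n := by positivity
      rw [pow_succ, pow_succ] at e2
      rw [pow_succ] at e1
      constructor <;> linarith
  refine main.mono fun t ω ⟨h1, h2, F, hF⟩ => ⟨h1, h2,
    fun s => val X s ω ^ 2 - c ^ 2 - 2 * F s, ?_⟩
  refine Metric.tendstoUniformlyOn_iff.mpr fun ε hε => ?_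
  filter_upwards [Metric.tendstoUniformlyOn_iff.mp hF (ε / 2) (half_pos hε)] with n hn s hs
  have h3 := hn s hs
  rw [qvar_eq ((hT.1 n).mono ω) ((hT.1 n).zero ω) _ (coe_le_trans_lt hs.2 (h2 n)), hc]
  have h4 : patch (fun k => T n k ω) (fun k s => val X (T n k ω).toNNReal ω * val X s ω) s =
      patch (fun k => T n k ω) (fun k s => p n k ω * val X s ω) s :=
    patch_congr ((hT.1 n).mono ω) fun k u v hu huv _ hv => by
      rw [hpe n k ω u t hu (huv.trans (hv.trans hs.2)) h1, ← hu, ENNReal.toNNReal_coe]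
  rw [h4]
  rw [Real.dist_eq] at h3 ⊢
  rw [show ∀ a b F P : ℝ, a - b - 2 * F - (a - b - 2 * P) = -(2 * (F - P)) by intros; ring, abs_neg,
    abs_mul, abs_two]
  linarith

lemma isEffDomain_quadDom {X : ExtProc M} (hX : IsContinuousProcess X)
    {T : ℕ → ℕ → M.Omega → ℝ≥0∞} (hT : ∀ n, IsGrid (T n)) (h : QuasiAlways (QuadDom T X)) :
    IsEffDomain (QuadDom T X) := by
  refine ⟨fun t ω ω' hω => ?_, h, fun ω s t hst ht => ht.mono hX hst⟩
  rw [← inDom_quadVar hX, ← inDom_quadVar hX, InDom, InDom, isAdapted_quadVar hX hT t ω ω' hω]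

/-- `X² - [X]` is a continuous martingale. -/
lemma IsContinuousMartingale.sq_sub_quadVar {X : ExtProc M} (hX : IsContinuousMartingale X)
    {T : ℕ → ℕ → M.Omega → ℝ≥0∞} (hT : IsFine T X) :
    IsContinuousMartingale (mkProc (QuadDom T X) fun t ω =>
      val X t ω ^ 2 - val (quadVar T X) t ω) := by
  have hXp := hX.isContinuous
  obtain ⟨f, hf, hfe⟩ := hX.exists_version
  obtain ⟨c, hc⟩ := hX.exists_initial
  -- By `qvar_eq`, the integral of 2X against X started from c² is X² minus the `n`th sum of
  -- squares.
  have hm := fun n => hX.integral (hT.1 n) (f := fun k ω => clip (2 * (|c| + k))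
      (2 * f (T n k ω).toNNReal ω))
    (fun k => ((KnownAt.const 2).mul (hf.knownAt ((hT.1 n).stopping k))).comp (measurable_clip _))
    (fun k => ⟨2 * (|c| + k), fun ω => abs_clip_le (by positivity) _⟩) (c ^ 2)
  refine .of_tendsto (isEffDomain_quadDom hXp hT.isGrid (hX.quasiAlways_quadDom hT)) hm
    (fun n t ω ht => inDom_mkProc.mpr ⟨ht.1, ht.2.1 n⟩) fun t ω ht => ?_
  refine Metric.tendstoUniformlyOn_iff.mpr fun ε hε => ?_
  filter_upwards [Metric.tendstoUniformlyOn_iff.mp (tendsto_quadVar hXp ht) ε hε] with n hn s hs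
  have h3 := hn s hs
  have hsd := ht.mono hXp hs.2
  rw [val_mkProc ⟨hsd.1, hsd.2.1 n⟩]
  rw [qvar_eq ((hT.1 n).mono ω) ((hT.1 n).zero ω) _ (hsd.2.1 n), hc] at h3
  have h4 : patch (fun k => T n k ω) (fun k s => 2 * (val X (T n k ω).toNNReal ω * val X s ω)) s =
      patch (fun k => T n k ω) (fun k s => clip (2 * (|c| + k)) (2 * f (T n k ω).toNNReal ω) *
        val X s ω) s :=
    patch_congr ((hT.1 n).mono ω) fun k u v hu huv _ hv => by
      have hut : u ≤ t := huv.trans (hv.trans hs.2)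
      have h1 := (hT.oscLE hXp n ht.1).abs_sub_zero_le ((hT.1 n).mono ω) ((hT.1 n).zero ω) k u hu hut
      rw [hc] at h1
      have h2 : (k : ℝ) * (1 / 2) ^ (n + 1) ≤ k :=
        mul_le_of_le_one_right (by positivity) (pow_le_one₀ (by norm_num) (by norm_num))
      have h5 := abs_add_le (val X u ω - c) c
      rw [sub_add_cancel] at h5
      rw [← hu, ENNReal.toNNReal_coe, ← hfe u ω (hXp.down hut ht.1), clip_of_abs_le]
      · ring
      · rw [abs_mul, abs_two]; linarith
  rw [← h4, patch_const_mul]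
  rw [Real.dist_eq] at h3 ⊢
  rw [← abs_neg]
  convert h3 using 2
  ring

/-! ### Existence of fine sequences of partitions -/

lemma exists_isFine_pair {X Y : ExtProc M} (hX : IsContinuousProcess X) (hY : IsContinuousProcess Y)
    (hdom : ∀ t ω, InDom X t ω ↔ InDom Y t ω) {f g : ℝ≥0 → M.Omega → ℝ} (hf : IsMeasAdapted f)
    (hg : IsMeasAdapted g) (hfe : ∀ t ω, InDom X t ω → val X t ω = f t ω)
    (hge : ∀ t ω, InDom Y t ω → val Y t ω = g t ω) : ∃ T, IsFine T X ∧ IsFine T Y := by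
  choose T hT1 hT2 using fun n : ℕ => exists_fine_grid hf hg (ε := (1 / 2) ^ (n + 1)) (by positivity)
  have hc : ∀ t ω, InDom X t ω → ContinuousOn (fun s => f s ω) (Set.Icc 0 t) ∧
      ContinuousOn (fun s => g s ω) (Set.Icc 0 t) := fun t ω h =>
    ⟨IsContinuousMartingale.version_continuousOn hX hfe h,
      IsContinuousMartingale.version_continuousOn hY hge ((hdom t ω).mp h)⟩
  have hP : ∀ n, IsPartition (T n) := fun n => ⟨(hT1 n).stopping, (hT1 n).zero, (hT1 n).mono,
    hX.quasiAlways_real.mono fun t ω h => (hT2 n ω t (hc t ω h).1 (hc t ω h).2).2.2⟩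
  refine ⟨T, ⟨hP, fun n k ω s t hs ht h1 h2 => ?_⟩, ⟨hP, fun n k ω s t hs ht h1 h2 => ?_⟩⟩
  · have hm : InDom X (max s t) ω := by rcases max_cases s t with h | h <;> rw [h.1] <;> assumption
    rw [hfe s ω hs, hfe t ω ht]
    exact (le_abs_self _).trans ((hT2 n ω _ (hc _ ω hm).1 (hc _ ω hm).2).1 k s t h1.1 h1.2 h2.1 h2.2
      (le_max_left _ _) (le_max_right _ _))
  · have hm : InDom Y (max s t) ω := by rcases max_cases s t with h | h <;> rw [h.1] <;> assumption
    rw [← hdom] at hm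
    rw [hge s ω hs, hge t ω ht]
    exact (le_abs_self _).trans ((hT2 n ω _ (hc _ ω hm).1 (hc _ ω hm).2).2.1 k s t h1.1 h1.2 h2.1
      h2.2 (le_max_left _ _) (le_max_right _ _))

lemma IsContinuousMartingale.exists_isFine {X : ExtProc M} (hX : IsContinuousMartingale X) :
    ∃ T, IsFine T X := by
  obtain ⟨f, hf, hfe⟩ := hX.exists_version
  obtain ⟨T, h, -⟩ := exists_isFine_pair hX.isContinuous hX.isContinuous
    (fun _ _ => Iff.rfl) hf hf hfe hfe
  exact ⟨T, h⟩

/-! ### Uniform limits -/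

lemma tendstoUniformlyOn_of_abs_sub_le {F G : ℕ → ℝ≥0 → ℝ} {f : ℝ≥0 → ℝ} {A : Set ℝ≥0} {e : ℕ → ℝ}
    (hF : TendstoUniformlyOn F f atTop A) (he : Tendsto e atTop (𝓝 0))
    (h : ∀ n, ∀ s ∈ A, |G n s - F n s| ≤ e n) : TendstoUniformlyOn G f atTop A := by
  refine Metric.tendstoUniformlyOn_iff.mpr fun ε hε => ?_
  filter_upwards [Metric.tendstoUniformlyOn_iff.mp hF (ε / 2) (half_pos hε),
    he.eventually (gt_mem_nhds (half_pos hε))] with n h1 h2 s hs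
  have h3 := h1 s hs
  have h4 := h n s hs
  rw [Real.dist_eq, abs_lt] at *
  rw [abs_le] at h4
  constructor <;> linarith

/-- Near their limit the `Q n` are at most `B + 1`, so the errors `e n * Q n` vanish uniformly. `Q
n` stands for sums of squares and `e n` for a multiple of the mesh. -/
lemma tendstoUniformlyOn_of_cubic {F Q : ℕ → ℝ≥0 → ℝ} {g q : ℝ≥0 → ℝ} {A : Set ℝ≥0} {e : ℕ → ℝ}
    {b B : ℝ} (hQ : TendstoUniformlyOn Q q atTop A) (hq : ∀ s ∈ A, q s ≤ B)
    (he : Tendsto e atTop (𝓝 0)) (he0 : ∀ n, 0 ≤ e n)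
    (h : ∀ n, ∀ s ∈ A, |F n s - (g s + b * Q n s)| ≤ e n * Q n s) :
    TendstoUniformlyOn F (fun s => g s + b * q s) atTop A := by
  refine Metric.tendstoUniformlyOn_iff.mpr fun ε hε => ?_
  have he' : Tendsto (fun n => e n * (B + 1)) atTop (𝓝 0) := by simpa using he.mul_const (B + 1)
  filter_upwards [Metric.tendstoUniformlyOn_iff.mp hQ (ε / (2 * (|b| + 1))) (by positivity),
    Metric.tendstoUniformlyOn_iff.mp hQ 1 one_pos,
    he'.eventually (gt_mem_nhds (half_pos hε))] with n h1 h2 h3 s hs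
  have h4 := h1 s hs
  have h5 := h2 s hs
  have h6 := hq s hs
  rw [Real.dist_eq] at *
  have h7 : e n * Q n s ≤ e n * (B + 1) :=
    mul_le_mul_of_nonneg_left (by linarith [(abs_lt.mp h5).1]) (he0 n)
  have h8 : |b * (q s - Q n s)| ≤ ε / 2 := by
    rw [abs_mul]
    calc |b| * |q s - Q n s| ≤ (|b| + 1) * (ε / (2 * (|b| + 1))) :=
          mul_le_mul (by linarith) h4.le (abs_nonneg _) (by positivity)
      _ = ε / 2 := by field_simp
  have h9 := (h n s hs).trans h7
  rw [abs_le] at h8 h9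
  rw [abs_lt]
  constructor <;> linarith

lemma tendstoUniformlyOn_exp {F : ℕ → ℝ≥0 → ℝ} {f : ℝ≥0 → ℝ} {A : Set ℝ≥0} {B : ℝ}
    (hF : TendstoUniformlyOn F f atTop A) (hf : ∀ s ∈ A, f s ≤ B) :
    TendstoUniformlyOn (fun n s => Real.exp (F n s)) (fun s => Real.exp (f s)) atTop A := by
  refine Metric.tendstoUniformlyOn_iff.mpr fun ε hε => ?_
  have hB := Real.exp_pos B
  filter_upwards [Metric.tendstoUniformlyOn_iff.mp hF 1 one_pos,
    Metric.tendstoUniformlyOn_iff.mp hF (ε / (2 * Real.exp B)) (by positivity)] with n h1 h2 s hs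
  have h3 := h1 s hs
  have h4 := h2 s hs
  rw [dist_comm, Real.dist_eq] at *
  have h5 : Real.exp (F n s) - Real.exp (f s) =
      Real.exp (f s) * (Real.exp (F n s - f s) - 1) := by
    rw [mul_sub, ← Real.exp_add]; simp
  rw [h5, abs_mul, Real.abs_exp]
  calc _ ≤ Real.exp B * (2 * |F n s - f s|) :=
        mul_le_mul (Real.exp_le_exp.mpr (hf s hs)) (Real.abs_exp_sub_one_le h3.le) (abs_nonneg _) hB.le
    _ < Real.exp B * (2 * (ε / (2 * Real.exp B))) := by gcongr
    _ = ε := by field_simp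

/-! ### The Doléans exponential -/

/-- The exponential of the sum of logarithms is the running product of the factors 1 + Δ. Over the
`k`th interval it grows by the product of the completed factors times the increment of `x`, which
makes it a simple integral. -/
lemma exp_patch_log {T : ℕ → ℝ≥0∞} (hT : Monotone T) (hT0 : T 0 = 0) {x : ℝ≥0 → ℝ} {ε : ℝ}
    {t : ℝ≥0} (ht : (t : ℝ≥0∞) < ⨆ k, T k) (hosc : OscLE T x ε t) (hε : ε ≤ 1 / 2) :
    Real.exp (patch T (fun k s => Real.log (1 + (x s - x (T k).toNNReal))) t) =
      1 + patch T (fun k s => (∏ i ∈ Finset.range k,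
        (1 + clip (1 / 2) (x (T (i + 1)).toNNReal - x (T i).toNNReal))) * x s) t := by
  have h := eq_add_patch hT hT0
    (P := fun t => Real.exp (patch T (fun k s => Real.log (1 + (x s - x (T k).toNNReal))) t))
    (F := fun k s => (∏ i ∈ Finset.range k,
        (1 + clip (1 / 2) (x (T (i + 1)).toNNReal - x (T i).toNNReal))) * x s) ht
    fun k u v hu huv hv hvt => by
      have hloc := patch_local hT (fun k s => Real.log (1 + (x s - x (T k).toNNReal)))
        hu.symm.le huv hv
      have hx := abs_le.mp ((hosc.start hT hu huv hv hvt).trans hε)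
      have hprod : Real.exp (patch T (fun k s => Real.log (1 + (x s - x (T k).toNNReal))) u) =
          ∏ i ∈ Finset.range k,
            (1 + clip (1 / 2) (x (T (i + 1)).toNNReal - x (T i).toNNReal)) := by
        rw [patch_eq_sum hT _ hu.le, Real.exp_sum]
        refine Finset.prod_congr rfl fun i hi => ?_
        have hi : i + 1 ≤ k := by simpa using hi
        have h1 : T (i + 1) ≤ u := (hT hi).trans hu.symm.le
        have h0 : T i ≤ u := (hT i.le_succ).trans h1
        have hc1 : ((T (i + 1)).toNNReal : ℝ≥0∞) = T (i + 1) :=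
          ENNReal.coe_toNNReal (ne_top_of_le_ne_top ENNReal.coe_ne_top h1)
        have hc0 : ((T i).toNNReal : ℝ≥0∞) = T i :=
          ENNReal.coe_toNNReal (ne_top_of_le_ne_top ENNReal.coe_ne_top h0)
        have hle : (T i).toNNReal ≤ (T (i + 1)).toNNReal := by
          rw [← ENNReal.coe_le_coe, hc0, hc1]; exact hT i.le_succ
        have hle2 : (T (i + 1)).toNNReal ≤ t := by
          rw [← ENNReal.coe_le_coe, hc1]
          exact h1.trans (by exact_mod_cast huv.trans hvt)
        have ho := (hosc.start hT hc0 hle hc1.le hle2).trans hε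
        rw [minTime_toNNReal h1, minTime_toNNReal h0, clip_of_abs_le ho]
        rw [abs_le] at ho
        simp only [sub_self, add_zero, Real.log_one, sub_zero]
        exact Real.exp_log (by linarith)
      rw [eq_add_of_sub_eq hloc, Real.exp_add, hprod, ← hu]
      simp only [ENNReal.toNNReal_coe, sub_self, add_zero, Real.log_one, sub_zero]
      rw [Real.exp_log (by linarith)]
      ring
  simpa [patch_zero] using h

lemma abs_log_one_add_sub_le {y : ℝ} (hy : |y| ≤ 1 / 2) :
    |Real.log (1 + y) - (y + (-1 / 2) * y ^ 2)| ≤ 2 * |y| ^ 3 := by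
  have h := Real.abs_log_sub_add_sum_range_le (x := -y) (by rw [abs_neg]; linarith) 2
  rw [abs_neg] at h
  simp only [Finset.sum_range_succ, Finset.sum_range_zero] at h
  norm_num at h
  calc _ = |-y + y ^ 2 / 2 + Real.log (1 + y)| := by congr 1; ring
    _ ≤ |y| ^ 3 / (1 - |y|) := h
    _ ≤ 2 * |y| ^ 3 := by
      rw [div_le_iff₀ (by linarith)]
      nlinarith [pow_nonneg (abs_nonneg y) 3]

lemma abs_exp_sub_le {y : ℝ} (hy : |y| ≤ 1) :
    |Real.exp y - 1 - (y + 1 / 2 * y ^ 2)| ≤ 1 * |y| ^ 3 := by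
  have h := Real.exp_bound hy (n := 3) (by norm_num)
  simp only [Finset.sum_range_succ, Finset.sum_range_zero] at h
  norm_num [Nat.factorial] at h
  calc _ = |Real.exp y - (1 + y + y ^ 2 / 2)| := by congr 1; ring
    _ ≤ |y| ^ 3 * (2 / 9) := h
    _ ≤ 1 * |y| ^ 3 := by nlinarith [pow_nonneg (abs_nonneg y) 3]

lemma map₂_eq_mkProc (φ : ℝ → ℝ → ℝ) {X Q : ExtProc M} (h : ∀ t ω, InDom Q t ω → InDom X t ω) :
    (fun t ω => Option.map₂ φ (X t ω) (Q t ω)) =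
      mkProc (InDom Q) fun t ω => φ (val X t ω) (val Q t ω) := by
  funext t ω
  have h1 := h t ω
  unfold mkProc
  unfold InDom val at *
  cases hq : Q t ω with
  | none => simp
  | some q =>
    rw [hq] at h1
    obtain ⟨y, hy⟩ := Option.isSome_iff_exists.mp (h1 rfl)
    simp [hy, hq]

lemma inDom_quadVar_eq {X : ExtProc M} (hX : IsContinuousProcess X)
    {T : ℕ → ℕ → M.Omega → ℝ≥0∞} : InDom (quadVar T X) = QuadDom T X :=
  funext fun _ => funext fun _ => propext (inDom_quadVar hX)

lemma doleansExp_eq {X : ExtProc M} (hX : IsContinuousProcess X) {T : ℕ → ℕ → M.Omega → ℝ≥0∞} :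
    doleansExp T X = mkProc (QuadDom T X) fun t ω =>
      Real.exp (val X t ω - val (quadVar T X) t ω / 2) := by
  rw [← inDom_quadVar_eq hX]
  exact map₂_eq_mkProc (fun x q => Real.exp (x - q / 2)) fun t ω h => ((inDom_quadVar hX).mp h).1

lemma doleansLog_eq {X : ExtProc M} (hX : IsContinuousProcess X) {T : ℕ → ℕ → M.Omega → ℝ≥0∞} :
    doleansLog T X = mkProc (QuadDom T X) fun t ω => val X t ω + val (quadVar T X) t ω / 2 := by
  rw [← inDom_quadVar_eq hX]
  exact map₂_eq_mkProc (fun x q => x + q / 2) fun t ω h => ((inDom_quadVar hX).mp h).1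

lemma KnownAt.prod {τ : M.Omega → ℝ≥0∞} {ι : Type*} (s : Finset ι) {f : ι → M.Omega → ℝ}
    (h : ∀ i ∈ s, KnownAt τ (f i)) : KnownAt τ fun ω => ∏ i ∈ s, f i ω :=
  ⟨Finset.measurable_prod s fun i hi => (h i hi).measurable,
    fun ω ω' hω => Finset.prod_congr rfl fun i hi => (h i hi).agree ω ω' hω⟩

/-- The Doléans exponential of a continuous martingale is a continuous martingale. -/
theorem isContinuousMartingale_doleansExp {X : ExtProc M} (hX : IsContinuousMartingale X)
    {T : ℕ → ℕ → M.Omega → ℝ≥0∞} (hT : IsFine T X) : IsContinuousMartingale (doleansExp T X) := by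
  have hXp := hX.isContinuous
  rw [doleansExp_eq hXp]
  obtain ⟨f, hf, hfe⟩ := hX.exists_version
  obtain ⟨c, hc⟩ := hX.exists_initial
  -- Clipping the increments at 1/2 bounds the `k`th bet by e^c 2^k everywhere; the mesh 2^{-n-1} ≤
  -- 1/2 makes it harmless on the domain.
  set h : ℕ → ℕ → M.Omega → ℝ := fun n k ω => Real.exp c * ∏ i ∈ Finset.range k,
    (1 + clip (1 / 2) (f (T n (i + 1) ω).toNNReal ω - f (T n i ω).toNNReal ω)) with hh
  have hclip : ∀ y, |1 + clip (1 / 2) y| ≤ 2 := fun y => by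
    have := abs_le.mp (abs_clip_le (by norm_num : (0 : ℝ) ≤ 1 / 2) y)
    rw [abs_le]; constructor <;> linarith
  have hhk : ∀ n k, KnownAt (T n k) (h n k) := fun n k => by
    refine (KnownAt.const _).mul (KnownAt.prod _ fun i hi => ?_)
    have hi : i + 1 ≤ k := by simpa using hi
    have h1 := (hf.knownAt ((hT.1 n).stopping (i + 1))).mono (σ := T n k)
      fun ω => (hT.1 n).mono ω hi
    have h0 := (hf.knownAt ((hT.1 n).stopping i)).mono (σ := T n k)
      fun ω => (hT.1 n).mono ω (i.le_succ.trans hi)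
    exact (h1.sub h0).comp (g := fun y => 1 + clip (1 / 2) y)
      (measurable_const.add (measurable_clip _))
  have hhb : ∀ n k, ∃ C : ℝ, ∀ ω, |h n k ω| ≤ C := fun n k => ⟨Real.exp c * 2 ^ k, fun ω => by
    rw [hh, abs_mul, Real.abs_exp, Finset.abs_prod]
    refine mul_le_mul_of_nonneg_left ?_ (Real.exp_pos c).le
    refine (Finset.prod_le_prod (fun _ _ => abs_nonneg _) fun i _ => hclip _).trans ?_
    simp⟩
  refine .of_tendsto (isEffDomain_quadDom hXp hT.isGrid (hX.quasiAlways_quadDom hT))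
    (fun n => hX.integral (hT.1 n) (hhk n) (hhb n) (Real.exp c))
    (fun n t ω ht => inDom_mkProc.mpr ⟨ht.1, ht.2.1 n⟩) fun t ω ht => ?_
  have hosc := fun n => hT.oscLE hXp n ht.1
  obtain ⟨B, hB⟩ := quadVar_bounded hXp hT.isGrid (tendsto_half_pow 1) hosc ht
  have hlog := tendstoUniformlyOn_of_cubic (F := fun n s => c + patch (fun k => T n k ω)
      (fun k s => Real.log (1 + (val X s ω - val X (T n k ω).toNNReal ω))) s)
    (g := fun s => val X s ω) (b := -1 / 2) (e := fun n => 2 * (1 / 2) ^ (n + 1))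
    (tendsto_quadVar hXp ht) (fun s hs => (hB s hs).2)
    (by simpa using (tendsto_half_pow 1).const_mul 2) (fun n => by positivity) fun n s hs => by
      have h1 := patch_sub_qvar_le ((hT.1 n).mono ω) ((hT.1 n).zero ω) (C := 2) (b := -1 / 2)
        (F := fun k s => Real.log (1 + (val X s ω - val X (T n k ω).toNNReal ω))) (by norm_num)
        (coe_le_trans_lt hs.2 (ht.2.1 n)) ((hosc n).mono hs.2) fun k u v hu huv hv hvs => by
          have h2 := ((hosc n).start ((hT.1 n).mono ω) hu huv hv (hvs.trans hs.2)).trans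
            (pow_le_of_le_one (by norm_num) (by norm_num) (Nat.succ_ne_zero n))
          rw [← hu]
          simpa using abs_log_one_add_sub_le h2
      rw [hc] at h1
      convert h1 using 2
      ring
  obtain ⟨C, hC⟩ := isCompact_Icc.exists_bound_of_continuousOn (hXp.continuousOn_Icc ht.1)
  have hexp := tendstoUniformlyOn_exp hlog (B := C) fun s hs => by
    have := (le_abs_self _).trans (hC s hs)
    linarith [(hB s hs).1]
  refine (hexp.congr (Eventually.of_forall fun n s hs => ?_)).congr_right fun s hs => ?_
  · have hsd := ht.mono hXp hs.2
    beta_reduce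
    rw [val_mkProc ⟨hsd.1, hsd.2.1 n⟩, Real.exp_add, exp_patch_log ((hT.1 n).mono ω)
      ((hT.1 n).zero ω) (hsd.2.1 n) ((hosc n).mono hs.2)
      (pow_le_of_le_one (by norm_num) (by norm_num) (Nat.succ_ne_zero n)), mul_add, mul_one,
      ← patch_const_mul]
    congr 1
    refine patch_congr ((hT.1 n).mono ω) fun k u v hu huv _ hvs => ?_
    have e : ∀ i ≤ k, f (T n i ω).toNNReal ω = val X (T n i ω).toNNReal ω := fun i hi => by
      refine (hfe _ ω (hXp.down (?_ : _ ≤ u) (hXp.down (huv.trans (hvs.trans hs.2)) ht.1))).symm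
      rw [← ENNReal.coe_le_coe]
      refine ENNReal.coe_toNNReal_le_self.trans (((hT.1 n).mono ω hi).trans hu.symm.le)
    have e2 : h n k ω = Real.exp c * ∏ i ∈ Finset.range k,
        (1 + clip (1 / 2) (val X (T n (i + 1) ω).toNNReal ω - val X (T n i ω).toNNReal ω)) := by
      refine congrArg (Real.exp c * ·) (Finset.prod_congr rfl fun i hi => ?_)
      have hi : i + 1 ≤ k := by simpa using hi
      rw [e _ hi, e i (i.le_succ.trans hi)]
    rw [e2]
    ring
  · beta_reduce
    congr 1
    ring

/-! ### Continuous martingales of finite variation -/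

/-- For each `n` the exponential martingale of nX is exp(nX), as the quadratic variation vanishes.
Stopped at `r`, these start from 1, and their lower limit is infinite where X is positive at `min r
t`. -/
lemma IsContinuousMartingale.quasiAlways_nonpos {X : ExtProc M} (hX : IsContinuousMartingale X)
    (h0 : ∀ ω, val X 0 ω = 0)
    (hbv : ∀ t ω, InDom X t ω → BoundedVariationOn (fun s => val X s ω) (Set.Icc 0 t)) (r : ℝ≥0) :
    QuasiAlways fun t ω => InDom X t ω ∧ val X (min r t) ω ≤ 0 := by
  have hXp := hX.isContinuous
  set Y : ℕ → ExtProc M := fun n => mkProc (InDom X) fun t ω => n * val X t ω with hY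
  have hYm : ∀ n, IsContinuousMartingale (Y n) := fun n => hX.const_mul n
  have hYp := fun n => (hYm n).isContinuous
  choose T hT using fun n => (hYm n).exists_isFine
  have hYv : ∀ n t ω, InDom X t ω → ∀ s ≤ t, val (Y n) s ω = 0 + n * val X s ω :=
    fun n t ω ht s hs => by rw [val_mkProc (hXp.down hs ht), zero_add]
  have hq : ∀ n t ω, InDom X t ω → (∀ m, (t : ℝ≥0∞) < ⨆ k, T n m k ω) →
      TendstoUniformlyOn (fun m s => qvar (fun k => T n m k ω) (fun s => val (Y n) s ω) s)
        (fun _ => 0) atTop (Set.Icc 0 t) := by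
    intro n t ω ht hlt
    have htY : InDom (Y n) t ω := inDom_mkProc.mpr ht
    have hbvn := boundedVariationOn_const_mul (hbv t ω ht) n
    refine tendstoUniformlyOn_of_abs_sub_le (F := fun _ _ => 0)
      (e := fun m => 3 * (1 / 2) ^ (m + 1) *
        (eVariationOn (fun s => n * val X s ω) (Set.Icc 0 t)).toReal) ?_ ?_ fun m s hs => ?_
    · exact Metric.tendstoUniformlyOn_iff.mpr fun ε hε => Eventually.of_forall fun _ _ _ => by simpa
    · simpa using ((tendsto_half_pow 1).const_mul 3).mul_const
        (eVariationOn (fun s => n * val X s ω) (Set.Icc 0 t)).toReal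
    -- The comparison of sums of squares is used with the zero path as martingale part and nX as
    -- finite variation part.
    · have hosc := (hT n).oscLE (hYp n) m htY
      have := abs_qvar_sub_le ((hT n).isGrid m |>.mono ω) (x := fun _ => 0)
        (z := fun s => val (Y n) s ω) (ε := (1 / 2) ^ (m + 1)) hbvn hs.2 (hlt m) (hYv n t ω ht)
        (fun k u v _ _ _ _ _ _ => by simp) (fun k u v h1 h2 h3 h4 h5 h6 => by
          have := hosc k u v h1 h2 h3 h4 h5 h6
          beta_reduce at this
          rwa [hYv n t ω ht u h5, hYv n t ω ht v h6, zero_add, zero_add] at this) (by positivity)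
      simpa [qvar] using this
  have hdom : QuasiAlways fun t ω => ∀ n, QuadDom (T n) (Y n) t ω :=
    QuasiAlways.all fun n => (hYm n).quasiAlways_quadDom (hT n)
  have hval : ∀ n t ω, QuadDom (T n) (Y n) t ω →
      val (doleansExp (T n) (Y n)) t ω = Real.exp (n * val X t ω) := by
    intro n t ω ht
    have htX : InDom X t ω := inDom_mkProc.mp ht.1
    rw [doleansExp_eq (hYp n), val_mkProc ht, hYv n t ω htX t le_rfl, zero_add]
    have := tendsto_nhds_unique ((tendsto_quadVar (hYp n) ht).tendsto_at (x := t) ⟨bot_le, le_rfl⟩)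
      ((hq n t ω htX ht.2.1).tendsto_at ⟨bot_le, le_rfl⟩)
    rw [this]
    simp
  have hin : ∀ n t ω, QuadDom (T n) (Y n) t ω → InDom (doleansExp (T n) (Y n)) t ω :=
    fun n t ω ht => by rw [doleansExp_eq (hYp n)]; exact inDom_mkProc.mpr ht
  choose S hS hSe using fun n => (isContinuousMartingale_doleansExp (hYm n) (hT n)).exists_supermartingale 0
    (fun _ => (r : ℝ≥0∞)) (isStoppingTime_const _) fun t ω ht _ => by
      rw [doleansExp_eq (hYp n), inDom_mkProc] at ht
      rw [hval n t ω ht, neg_zero]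
      exact (Real.exp_pos _).le
  have hSv : ∀ n t ω, QuadDom (T n) (Y n) t ω →
      S n t ω = ENNReal.ofReal (Real.exp (n * val X (min r t) ω)) := fun n t ω ht => by
    rw [hSe n t ω (hin n t ω ht), minTime_eq_min, add_zero,
      hval n _ ω (ht.mono (hYp n) (min_le_right _ _))]
  have h0d := hdom.at_zero
  have main : QuasiAlways fun t ω => (∀ n, QuadDom (T n) (Y n) t ω) → val X (min r t) ω ≤ 0 := by
    refine .of_supermartingale (.liminf S hS) ENNReal.one_ne_top (fun ω => ?_) fun t ω ht => ?_
    · simp only [hSv _ 0 ω (h0d ω _)]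
      simp [h0]
    · push Not at ht
      simp only [hSv _ t ω (ht.1 _)]
      refine Tendsto.liminf_eq (ENNReal.tendsto_ofReal_atTop.comp (Real.tendsto_exp_atTop.comp ?_))
      exact tendsto_natCast_atTop_atTop.atTop_mul_const ht.2
  exact (hXp.quasiAlways_real.and (hdom.and main)).mono fun t ω h => ⟨h.1, h.2.2 h.2.1⟩

/-- A continuous martingale of finite variation that starts from `0` vanishes quasi-always. -/
theorem IsContinuousMartingale.quasiAlways_eq_zero {X : ExtProc M} (hX : IsContinuousMartingale X)
    (h0 : ∀ ω, val X 0 ω = 0)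
    (hbv : ∀ t ω, InDom X t ω → BoundedVariationOn (fun s => val X s ω) (Set.Icc 0 t)) :
    QuasiAlways fun t ω => InDom X t ω ∧ ∀ s ≤ t, val X s ω = 0 := by
  have hXp := hX.isContinuous
  have hN := hX.const_mul (-1)
  have h1 := QuasiAlways.all fun n => hX.quasiAlways_nonpos h0 hbv
    (TopologicalSpace.denseSeq ℝ≥0 n)
  have h2 := QuasiAlways.all fun n => hN.quasiAlways_nonpos
    (fun ω => by rw [val_mkProc (hXp.zero_mem ω), h0, mul_zero])
    (fun t ω ht => by
      rw [inDom_mkProc] at ht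
      exact boundedVariationOn_congr (boundedVariationOn_const_mul (hbv t ω ht) (-1))
        fun s hs => val_mkProc (hXp.down hs.2 ht)) (TopologicalSpace.denseSeq ℝ≥0 n)
  refine (h1.and h2).mono fun t ω h => ⟨(h.1 0).1, fun s hs => ?_⟩
  have ht := (h.1 0).1
  have hmap : Set.MapsTo (fun s => min s t) Set.univ (Set.Icc 0 t) :=
    fun s _ => ⟨bot_le, min_le_right _ _⟩
  have hc : Continuous fun s => val X (min s t) ω := by
    rw [← continuousOn_univ]
    exact (hXp.continuousOn_Icc ht).comp (by fun_prop) hmap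
  have := hc.ext_on (TopologicalSpace.denseRange_denseSeq ℝ≥0) continuous_const (g := fun _ => 0)
    (by
      rintro _ ⟨n, rfl⟩
      have e1 := (h.1 n).2
      have e2 := (h.2 n).2
      rw [val_mkProc (hXp.down (min_le_right _ _) ht)] at e2
      beta_reduce
      linarith)
  have := congrFun this s
  beta_reduce at this
  rwa [min_eq_left hs] at this

/-! ### Quadratic variation of continuous semimartingales -/

section semimartingale

variable {Z Y A : ExtProc M} {T : ℕ → ℕ → M.Omega → ℝ≥0∞} {t : ℝ≥0} {ω : M.Omega}

lemma IsStandardDecomposition.oscLE (hd : IsStandardDecomposition Z Y A) (hY : IsFine T Y)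
    (hA : IsFine T A) (n : ℕ) (ht : InDom Z t ω) :
    OscLE (fun k => T n k ω) (fun s => val Z s ω) ((1 / 2) ^ n) t := by
  obtain ⟨hZ, hYm, hAv, hZY, hZA, hval⟩ := hd
  intro k u v h1 h2 h3 h4 h5 h6
  have e1 := hY.oscLE hYm.isContinuous n ((hZY t ω).mp ht) k u v h1 h2 h3 h4 h5 h6
  have e2 := hA.oscLE hAv.1 n ((hZA t ω).mp ht) k u v h1 h2 h3 h4 h5 h6
  beta_reduce at e1 e2 ⊢
  rw [hval u ω (hZ.down h5 ht), hval v ω (hZ.down h6 ht), add_sub_add_comm]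
  refine (abs_add_le _ _).trans ((add_le_add e1 e2).trans_eq ?_)
  ring

/-- Because of `abs_qvar_sub_le` the finite variation part does not affect the limit of the sums of
squares, so `Z` inherits convergence and limit from `Y`. -/
lemma IsStandardDecomposition.exists_tendsto (hd : IsStandardDecomposition Z Y A) (hY : IsFine T Y)
    (hA : IsFine T A) (ht : InDom Z t ω) (hT : ∀ n, (t : ℝ≥0∞) < ⨆ k, T n k ω) :
    ∃ e : ℕ → ℝ, Tendsto e atTop (𝓝 0) ∧ ∀ n, ∀ s ∈ Set.Icc 0 t,
      |qvar (fun k => T n k ω) (fun s => val Z s ω) s -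
        qvar (fun k => T n k ω) (fun s => val Y s ω) s| ≤ e n := by
  obtain ⟨hZ, hYm, hAv, hZY, hZA, hval⟩ := hd
  have hbv := hAv.2.2 t ω ((hZA t ω).mp ht)
  refine ⟨fun n => 3 * (1 / 2) ^ (n + 1) *
    (eVariationOn (fun s => val A s ω) (Set.Icc 0 t)).toReal, ?_, fun n s hs => ?_⟩
  · simpa using ((tendsto_half_pow 1).const_mul 3).mul_const
      (eVariationOn (fun s => val A s ω) (Set.Icc 0 t)).toReal
  · exact abs_qvar_sub_le ((hY.1 n).mono ω) hbv hs.2 (hT n) (fun u hu => hval u ω (hZ.down hu ht))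
      (hY.oscLE hYm.isContinuous n ((hZY t ω).mp ht))
      (hA.oscLE hAv.1 n ((hZA t ω).mp ht)) (by positivity)

lemma IsStandardDecomposition.tendsto_quadVar (hd : IsStandardDecomposition Z Y A)
    (hY : IsFine T Y) (hA : IsFine T A) (h : QuadDom T Y t ω) :
    TendstoUniformlyOn (fun n s => qvar (fun k => T n k ω) (fun s => val Z s ω) s)
      (fun s => val (quadVar T Y) s ω) atTop (Set.Icc 0 t) := by
  obtain ⟨e, he, h1⟩ := hd.exists_tendsto hY hA ((hd.2.2.2.1 t ω).mpr h.1) h.2.1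
  exact tendstoUniformlyOn_of_abs_sub_le (Market.tendsto_quadVar hd.2.1.isContinuous h) he h1

lemma IsStandardDecomposition.quadDom_iff (hd : IsStandardDecomposition Z Y A) (hY : IsFine T Y)
    (hA : IsFine T A) : QuadDom T Z t ω ↔ QuadDom T Y t ω := by
  refine ⟨fun h => ⟨(hd.2.2.2.1 t ω).mp h.1, h.2.1, h.2.2.imp fun f hf => ?_⟩,
    fun h => ⟨(hd.2.2.2.1 t ω).mpr h.1, h.2.1, _, hd.tendsto_quadVar hY hA h⟩⟩
  obtain ⟨e, he, h1⟩ := hd.exists_tendsto hY hA h.1 h.2.1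
  exact tendstoUniformlyOn_of_abs_sub_le hf he fun n s hs => by rw [abs_sub_comm]; exact h1 n s hs

lemma IsStandardDecomposition.val_quadVar (hd : IsStandardDecomposition Z Y A)
    (hY : IsFine T Y) (hA : IsFine T A) (h : QuadDom T Z t ω) :
    val (quadVar T Z) t ω = val (quadVar T Y) t ω :=
  tendsto_nhds_unique ((Market.tendsto_quadVar hd.1 h).tendsto_at (x := t) ⟨bot_le, le_rfl⟩)
    ((hd.tendsto_quadVar hY hA ((hd.quadDom_iff hY hA).mp h)).tendsto_at ⟨bot_le, le_rfl⟩)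

lemma IsStandardDecomposition.isEffDomain_quadDom (hd : IsStandardDecomposition Z Y A)
    (hY : IsFine T Y) (hA : IsFine T A) : IsEffDomain (QuadDom T Z) :=
  Market.isEffDomain_quadDom hd.1 hY.isGrid
    ((hd.2.1.quasiAlways_quadDom hY).mono fun _ _ => (hd.quadDom_iff hY hA).mpr)

end semimartingale

/-! ### The Doléans logarithm -/

/-- The integrand is 1/y at the left endpoints, so each term is exp(Δz) - 1 = Δz + (Δz)²/2 up to
|Δz|³. -/
lemma abs_patch_exp_sub_le {T : ℕ → ℝ≥0∞} (hT : Monotone T) (hT0 : T 0 = 0) {y z : ℝ≥0 → ℝ}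
    {p : ℕ → ℝ} {t : ℝ≥0} {ε : ℝ} (ht : (t : ℝ≥0∞) < ⨆ k, T k) (hosc : OscLE T z ε t) (hε : ε ≤ 1)
    (hy : ∀ s ≤ t, y s = Real.exp (z s))
    (hp : ∀ k (u : ℝ≥0), (u : ℝ≥0∞) = T k → u ≤ t → p k = Real.exp (-z u)) :
    |patch T (fun k s => p k * y s) t - ((z t - z 0) + 1 / 2 * qvar T z t)| ≤
      ε * qvar T z t := by
  have h := patch_sub_qvar_le hT hT0 (F := fun k s => p k * y s) (b := 1 / 2) zero_le_one ht hosc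
    fun k u v hu huv hv hvt => by
      have h1 := abs_exp_sub_le ((hosc.start hT hu huv hv hvt).trans hε)
      rw [hp k u hu (huv.trans hvt), hy u (huv.trans hvt), hy v hvt, ← Real.exp_add, ← Real.exp_add,
        neg_add_cancel, Real.exp_zero, neg_add_eq_sub]
      exact h1
  rwa [one_mul] at h

lemma clip_exp_neg {T : ℕ → ℝ≥0∞} (hT : Monotone T) (hT0 : T 0 = 0) {z : ℝ≥0 → ℝ}
    {t : ℝ≥0} {ε : ℝ} (hosc : OscLE T z ε t) (hε : ε ≤ 1) {k : ℕ} {u : ℝ≥0}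
    (hu : (u : ℝ≥0∞) = T k) (hut : u ≤ t) :
    clip (Real.exp (|z 0| + k)) (Real.exp (-z u)) = Real.exp (-z u) := by
  refine clip_of_abs_le ?_
  rw [Real.abs_exp, Real.exp_le_exp]
  have h1 := neg_le_of_abs_le (hosc.abs_sub_zero_le hT hT0 k u hu hut)
  have h2 : (k : ℝ) * ε ≤ k := mul_le_of_le_one_right k.cast_nonneg hε
  linarith [neg_le_abs (z 0)]

/-- The simple integrals of `1 / Y` with respect to `Y`, where `f` is a version of `Y`. -/
def logApprox (Y : ExtProc M) (f : ℝ≥0 → M.Omega → ℝ) (c : ℝ) (T : ℕ → M.Omega → ℝ≥0∞) : ExtProc M :=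
  mkProc (fun t ω => InDom Y t ω ∧ (t : ℝ≥0∞) < ⨆ k, T k ω) fun t ω =>
    Real.log c + patch (fun k => T k ω) (fun k s => clip (Real.exp (|Real.log c| + k))
      (Real.exp (-Real.log (f (T k ω).toNNReal ω))) * val Y s ω) t

section logApprox

variable {Y : ExtProc M} {f : ℝ≥0 → M.Omega → ℝ} {c : ℝ} {T : ℕ → M.Omega → ℝ≥0∞}

lemma knownAt_logBet (hf : IsMeasAdapted f) (hT : IsPartition T) (k : ℕ) :
    KnownAt (T k) fun ω => clip (Real.exp (|Real.log c| + k))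
      (Real.exp (-Real.log (f (T k ω).toNNReal ω))) :=
  (hf.knownAt (hT.stopping k)).comp (g := fun y => clip (Real.exp (|Real.log c| + k))
    (Real.exp (-Real.log y))) ((measurable_clip _).comp (by fun_prop))

lemma isContinuousMartingale_logApprox (hY : IsContinuousMartingale Y) (hf : IsMeasAdapted f)
    (hT : IsPartition T) : IsContinuousMartingale (logApprox Y f c T) :=
  hY.integral hT (fun k => knownAt_logBet hf hT k)
    (fun _ => ⟨_, fun _ => abs_clip_le (Real.exp_pos _).le _⟩) (Real.log c)

lemma logBet_eq (hY : IsContinuousProcess Y) (hfe : ∀ t ω, InDom Y t ω → val Y t ω = f t ω)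
    (hc : ∀ ω, val Y 0 ω = c) (hT : IsGrid T) {ε : ℝ} {t u : ℝ≥0} {ω : M.Omega} (ht : InDom Y t ω)
    (hosc : OscLE (fun k => T k ω) (fun s => Real.log (val Y s ω)) ε t) (hε : ε ≤ 1) {k : ℕ}
    (hu : (u : ℝ≥0∞) = T k ω) (hut : u ≤ t) :
    clip (Real.exp (|Real.log c| + k)) (Real.exp (-Real.log (f (T k ω).toNNReal ω))) =
      Real.exp (-Real.log (val Y u ω)) := by
  rw [← hu, ENNReal.toNNReal_coe, ← hfe u ω (hY.down hut ht), ← hc ω]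
  exact clip_exp_neg (hT.mono ω) (hT.zero ω) hosc hε hu hut

lemma abs_logApprox_sub_le (hY : IsContinuousProcess Y) (hpos : IsPositive Y)
    (hfe : ∀ t ω, InDom Y t ω → val Y t ω = f t ω)
    (hc : ∀ ω, val Y 0 ω = c) (hT : IsGrid T) {ε : ℝ} {t : ℝ≥0} {ω : M.Omega} (ht : InDom Y t ω)
    (hlt : (t : ℝ≥0∞) < ⨆ k, T k ω)
    (hosc : OscLE (fun k => T k ω) (fun s => Real.log (val Y s ω)) ε t) (hε : ε ≤ 1) :
    |val (logApprox Y f c T) t ω - (Real.log (val Y t ω) + 1 / 2 *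
      qvar (fun k => T k ω) (fun s => Real.log (val Y s ω)) t)| ≤
      ε * qvar (fun k => T k ω) (fun s => Real.log (val Y s ω)) t := by
  have h := abs_patch_exp_sub_le (hT.mono ω) (hT.zero ω) (y := fun s => val Y s ω) hlt hosc hε
    (fun s hs => (Real.exp_log (hpos s ω (hY.down hs ht))).symm)
    (fun k u hu hut => logBet_eq hY hfe hc hT ht hosc hε hu hut)
  rw [logApprox, val_mkProc ⟨ht, hlt⟩]
  rw [hc] at h
  convert h using 2
  ring

end logApprox

/-- The Doléans logarithm of a positive continuous martingale is a continuous martingale. -/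
theorem isContinuousMartingale_doleansLog {Y Z : ExtProc M} (hY : IsContinuousMartingale Y)
    (hpos : IsPositive Y) {T : ℕ → ℕ → M.Omega → ℝ≥0∞} (hZ : IsLogSemimartingale Y Z)
    (hT : IsFineForSemimartingale T Z) : IsContinuousMartingale (doleansLog T Z) := by
  obtain ⟨N, A, hd, hTN, hTA⟩ := hT
  have hZp := hd.1
  have hYp := hY.isContinuous
  obtain ⟨f, hf, hfe⟩ := hY.exists_version
  obtain ⟨c, hc⟩ := hY.exists_initial
  rw [doleansLog_eq hZp]
  refine .of_tendsto (hd.isEffDomain_quadDom hTN hTA)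
    (fun n => isContinuousMartingale_logApprox (c := c) hY hf (hTN.1 n))
    (fun n t ω ht => inDom_mkProc.mpr ⟨(hZ.2 t ω ht.1).1, ht.2.1 n⟩) fun t ω ht => ?_
  have hosc := fun n => hd.oscLE hTN hTA n ht.1
  obtain ⟨B, hB⟩ := quadVar_bounded hZp hTN.isGrid (tendsto_half_pow 0) hosc ht
  have hlog : ∀ s ≤ t, val Z s ω = Real.log (val Y s ω) := fun s hs =>
    (hZ.2 s ω (hZp.down hs ht.1)).2
  -- As `Z` is a semimartingale, its sums of squares converge, and the convergence of the integrals
  -- is deduced from theirs. In the construction of a version the implication is used in the other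
  -- direction.
  have h := tendstoUniformlyOn_of_cubic (F := fun n s => val (logApprox Y f c (T n)) s ω)
    (g := fun s => val Z s ω) (b := 1 / 2) (e := fun n => (1 / 2) ^ n)
    (tendsto_quadVar hZp ht) (fun s hs => (hB s hs).2) (tendsto_half_pow 0)
    (fun n => by positivity) fun n s hs => by
      have hsd := ht.mono hZp hs.2
      have e : qvar (fun k => T n k ω) (fun s => val Z s ω) s =
          qvar (fun k => T n k ω) (fun s => Real.log (val Y s ω)) s := by
        rw [qvar_eq_patch (hTN.isGrid n |>.mono ω), qvar_eq_patch (hTN.isGrid n |>.mono ω)]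
        refine patch_congr (hTN.isGrid n |>.mono ω) fun k u v hu huv _ hv => ?_
        have hvt := hv.trans hs.2
        rw [← hu, ENNReal.toNNReal_coe, hlog v hvt, hlog u (huv.trans hvt)]
      rw [e, hlog s hs.2]
      exact abs_logApprox_sub_le hYp hpos hfe hc (hTN.isGrid n) (hZ.2 s ω hsd.1).1 (hsd.2.1 n)
        (fun k u v h1 h2 h3 h4 h5 h6 => by
          have := hosc n k u v h1 h2 h3 h4 (h5.trans hs.2) (h6.trans hs.2)
          beta_reduce at this ⊢
          rwa [hlog u (h5.trans hs.2), hlog v (h6.trans hs.2)] at this)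
        (pow_le_one₀ (by norm_num) (by norm_num))
  refine h.congr_right fun s _ => ?_
  beta_reduce
  ring

/-! ### Existence of a version of the logarithm -/

lemma tendsto_ucLimit {X : ℕ → ExtProc M} (hX : ∀ k, IsContinuousProcess (X k)) {t : ℝ≥0}
    {ω : M.Omega} (h : InDom (ucLimit X) t ω) :
    TendstoUniformlyOn (fun k s => val (X k) s ω) (fun s => val (ucLimit X) s ω) atTop
      (Set.Icc 0 t) := by
  obtain ⟨h1, f, hf⟩ := inDom_ucLimit.mp h
  refine hf.congr_right fun s hs => ?_
  have hs' : InDom (ucLimit X) s ω := inDom_ucLimit.mpr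
    ⟨fun k => (hX k).down hs.2 (h1 k), f, hf.mono (Set.Icc_subset_Icc_right hs.2)⟩
  rw [val_ucLimit hs']
  exact (hf.tendsto_at hs).limUnder_eq.symm

lemma isContinuousMartingale_ucLimit {X : ℕ → ExtProc M} (hX : ∀ k, IsContinuousMartingale (X k))
    (h : QuasiAlways (InDom (ucLimit X))) : IsContinuousMartingale (ucLimit X) := by
  have hXp := fun k => (hX k).isContinuous
  have hD : IsEffDomain (InDom (ucLimit X)) := by
    refine ⟨fun t ω ω' hω => ?_, h, fun ω s t hst ht => ?_⟩
    · unfold InDom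
      rw [ucLimit_congr fun k s hs => (hXp k).adapted s ω ω' (hω.mono (by exact_mod_cast hs))]
    · obtain ⟨h1, f, hf⟩ := inDom_ucLimit.mp ht
      exact inDom_ucLimit.mpr ⟨fun k => (hXp k).down hst (h1 k), f,
        hf.mono (Set.Icc_subset_Icc_right hst)⟩
  have := IsContinuousMartingale.of_tendsto (f := val (ucLimit X)) hD hX
    (fun k t ω ht => (inDom_ucLimit.mp ht).1 k) fun t ω ht => tendsto_ucLimit hXp ht
  convert this using 1
  exact extProc_ext (fun _ _ => inDom_mkProc.symm) fun t ω ht => (val_mkProc ht).symm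

lemma tendstoUniformlyOn_of_approx {F Q : ℕ → ℝ≥0 → ℝ} {f g : ℝ≥0 → ℝ} {A : Set ℝ≥0} {e : ℕ → ℝ}
    {B : ℝ} (hF : TendstoUniformlyOn F f atTop A) (hB : ∀ s ∈ A, |f s - g s| ≤ B)
    (he : Tendsto e atTop (𝓝 0)) (he0 : ∀ n, 0 ≤ e n) (hQ : ∀ n s, 0 ≤ Q n s)
    (h : ∀ n, ∀ s ∈ A, |F n s - (g s + 1 / 2 * Q n s)| ≤ e n * Q n s) :
    TendstoUniformlyOn Q (fun s => 2 * (f s - g s)) atTop A := by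
  refine Metric.tendstoUniformlyOn_iff.mpr fun ε hε => ?_
  -- Once e n ≤ 1/4, the error is at most Q/4, so Q/4 ≤ |F - g| ≤ B + 1; this a priori bound Q ≤ 4(B
  -- + 1) makes the error vanish.
  have he' : Tendsto (fun n => e n * (4 * (B + 1))) atTop (𝓝 0) := by
    simpa using he.mul_const (4 * (B + 1))
  filter_upwards [Metric.tendstoUniformlyOn_iff.mp hF (ε / 4) (by positivity),
    Metric.tendstoUniformlyOn_iff.mp hF 1 one_pos,
    he.eventually (gt_mem_nhds (show (0 : ℝ) < 1 / 4 by norm_num)),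
    he'.eventually (gt_mem_nhds (show (0 : ℝ) < ε / 4 by positivity))] with n h1 h2 h3 h4 s hs
  have h5 := h1 s hs
  have h6 := h2 s hs
  have h7 := abs_le.mp (h n s hs)
  have h8 := abs_le.mp (hB s hs)
  rw [Real.dist_eq, abs_lt] at *
  have h9 : e n * Q n s ≤ 1 / 4 * Q n s := mul_le_mul_of_nonneg_right h3.le (hQ n s)
  have h10 : e n * Q n s ≤ e n * (4 * (B + 1)) :=
    mul_le_mul_of_nonneg_left (by linarith) (he0 n)
  constructor <;> linarith

lemma abs_exp_neg_sub_le {x u v d e : ℝ} (hu : |x - u| ≤ d) (hv : |x - v| ≤ e) (hd : d ≤ 1)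
    (he : e ≤ 1) : |Real.exp (-v) - Real.exp (-u)| ≤ Real.exp (-x) * (2 * (d + e)) := by
  have h1 := (Real.abs_exp_sub_one_le (hu.trans hd)).trans (mul_le_mul_of_nonneg_left hu zero_le_two)
  have h2 := (Real.abs_exp_sub_one_le (hv.trans he)).trans (mul_le_mul_of_nonneg_left hv zero_le_two)
  have h3 : Real.exp (-v) - Real.exp (-u) =
      Real.exp (-x) * ((Real.exp (x - v) - 1) - (Real.exp (x - u) - 1)) := by
    rw [sub_sub_sub_cancel_right, mul_sub, ← Real.exp_add, ← Real.exp_add]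
    congr 2 <;> ring
  rw [h3, abs_mul, Real.abs_exp]
  refine mul_le_mul_of_nonneg_left ((abs_sub _ _).trans ?_) (Real.exp_pos _).le
  linarith

/-- The simple integrals of `1 / Y` with respect to `Y` converge quasi-always. -/
lemma IsContinuousMartingale.quasiAlways_logApprox {Y : ExtProc M} (hY : IsContinuousMartingale Y)
    (hpos : IsPositive Y) {f : ℝ≥0 → M.Omega → ℝ} (hf : IsMeasAdapted f)
    (hfe : ∀ t ω, InDom Y t ω → val Y t ω = f t ω) {c : ℝ} (hc : ∀ ω, val Y 0 ω = c)
    {T : ℕ → ℕ → M.Omega → ℝ≥0∞} (hT : ∀ n, IsPartition (T n))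
    (hosc : ∀ n t ω, InDom Y t ω →
      OscLE (fun k => T n k ω) (fun s => Real.log (val Y s ω)) ((1 / 2) ^ (n + 1)) t) :
    QuasiAlways (InDom (ucLimit fun n => logApprox Y f c (T n))) := by
  have hYp := hY.isContinuous
  have hle : ∀ n : ℕ, (1 / 2 : ℝ) ^ n ≤ 1 := fun n => pow_le_one₀ (by norm_num) (by norm_num)
  obtain ⟨σ, hσ, hloc⟩ := exists_localizing
    (hf.comp (φ := fun y => Real.log y - Real.log c) (by fun_prop)) fun ω => by
      rw [← hfe 0 ω (hYp.zero_mem ω), hc, sub_self]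
  have hcont : ∀ t ω, InDom Y t ω →
      ContinuousOn (fun s => Real.log (f s ω) - Real.log c) (Set.Icc 0 t) := fun t ω ht =>
    ((version_continuousOn hYp hfe ht).log fun s hs => by
      rw [← hfe s ω (hYp.down hs.2 ht)]
      exact (hpos s ω (hYp.down hs.2 ht)).ne').sub continuousOn_const
  have hlog : ∀ m t ω, InDom Y t ω → (t : ℝ≥0∞) ≤ σ m ω →
      |Real.log (val Y t ω) - Real.log c| ≤ m + 1 := fun m t ω ht hm => by
    rw [hfe t ω ht]; exact (hloc ω t (hcont t ω ht)).1 m hm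
  have main := hY.quasiAlways_tendsto hT
    (fun n k => knownAt_logBet (c := c) hf (hT n) k)
    (fun _ _ => ⟨_, fun _ => abs_clip_le (Real.exp_pos _).le _⟩) hσ
    -- Before `σ m` the distance of ln Y from ln c is at most m + 1, which bounds Y by exp(m + 1 +
    -- ln c) and 1/Y by exp(m + 1 - ln c). Two values of 1/Y at times where ln Y differs by 2^{-n-1}
    -- and 2^{-n-2} from its current value then differ by at most C 2^{-n}.
    (K := fun m => Real.exp (m + 1 + Real.log c) + |c|)
    (C := fun m => 2 * Real.exp (m + 1 - Real.log c)) (fun m => by positivity)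
    (fun t ω ht => (hloc ω t (hcont t ω ht)).2) (fun m t ω ht hm => by
      have h1 := (abs_le.mp (hlog m t ω ht hm)).2
      rw [hc]
      refine (abs_sub _ _).trans (add_le_add_left ?_ _)
      rw [abs_of_pos (hpos t ω ht), ← Real.exp_log (hpos t ω ht), Real.exp_le_exp]
      linarith)
    fun m n t ω ht hm i j h1 h2 h3 h4 => by
      obtain ⟨u, hu⟩ : ∃ u : ℝ≥0, (u : ℝ≥0∞) = T n i ω :=
        ⟨_, ENNReal.coe_toNNReal (ne_top_of_le_ne_top ENNReal.coe_ne_top h1)⟩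
      obtain ⟨v, hv⟩ : ∃ v : ℝ≥0, (v : ℝ≥0∞) = T (n + 1) j ω :=
        ⟨_, ENNReal.coe_toNNReal (ne_top_of_le_ne_top ENNReal.coe_ne_top h3)⟩
      have hut : u ≤ t := by rw [← hu] at h1; exact_mod_cast h1
      have hvt : v ≤ t := by rw [← hv] at h3; exact_mod_cast h3
      have e1 := (hosc n t ω ht).start ((hT n).mono ω) hu hut h2 le_rfl
      have e2 := (hosc (n + 1) t ω ht).start ((hT (n + 1)).mono ω) hv hvt h4 le_rfl
      rw [logBet_eq hYp hfe hc (hT n).isGrid ht (hosc n t ω ht) (hle _) hu hut,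
        logBet_eq hYp hfe hc (hT (n + 1)).isGrid ht (hosc (n + 1) t ω ht) (hle _) hv hvt]
      refine (abs_exp_neg_sub_le e1 e2 (hle _) (hle _)).trans ?_
      have e3 : Real.exp (-Real.log (val Y t ω)) ≤ Real.exp (m + 1 - Real.log c) :=
        Real.exp_le_exp.mpr (by linarith [(abs_le.mp (hlog m t ω ht hm)).1])
      refine (mul_le_mul_of_nonneg_right e3 (by positivity)).trans ?_
      have : (0 : ℝ) < (1 / 2) ^ n := by positivity
      rw [mul_comm (2 : ℝ) (Real.exp _), mul_assoc]
      refine mul_le_mul_of_nonneg_left ?_ (Real.exp_pos _).le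
      rw [pow_succ, pow_succ, pow_succ]
      linarith
  refine main.mono fun t ω ⟨h1, h2, F, hF⟩ => inDom_ucLimit.mpr
    ⟨fun n => inDom_mkProc.mpr ⟨h1, h2 n⟩, fun s => Real.log c + F s, ?_⟩
  refine Metric.tendstoUniformlyOn_iff.mpr fun ε hε => ?_
  filter_upwards [Metric.tendstoUniformlyOn_iff.mp hF ε hε] with n hn s hs
  rw [logApprox, val_mkProc ⟨hYp.down hs.2 h1, coe_le_trans_lt hs.2 (h2 n)⟩, dist_add_left]
  exact hn s hs

lemma inDom_mkProc_eq {D : ℝ≥0 → M.Omega → Prop} {f : ℝ≥0 → M.Omega → ℝ} :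
    InDom (mkProc D f) = D := funext₂ fun _ _ => propext inDom_mkProc

/-- A positive continuous martingale has a version of the logarithm as a continuous semimartingale,
and there is a sequence of partitions that is fine for it. -/
theorem exists_isLogSemimartingale {Y : ExtProc M} (hY : IsContinuousMartingale Y)
    (hpos : IsPositive Y) :
    ∃ Z T, IsLogSemimartingale Y Z ∧ IsFineForSemimartingale T Z := by
  have hYp := hY.isContinuous
  have hle : ∀ n : ℕ, (1 / 2 : ℝ) ^ n ≤ 1 := fun n => pow_le_one₀ (by norm_num) (by norm_num)
  obtain ⟨f, hf, hfe⟩ := hY.exists_version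
  obtain ⟨c, hc⟩ := hY.exists_initial
  have hg : IsMeasAdapted fun t ω => Real.log (f t ω) := hf.comp (by fun_prop)
  have hcont : ∀ t ω, InDom Y t ω → ContinuousOn (fun s => Real.log (val Y s ω)) (Set.Icc 0 t) :=
    fun t ω ht => (hYp.continuousOn_Icc ht).log fun s hs => (hpos s ω (hYp.down hs.2 ht)).ne'
  have hcontf : ∀ t ω, InDom Y t ω → ContinuousOn (fun s => Real.log (f s ω)) (Set.Icc 0 t) :=
    fun t ω ht => (hcont t ω ht).congr fun s hs => by
      beta_reduce; rw [hfe s ω (hYp.down hs.2 ht)]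
  -- These partitions are fine for ln Y itself, which is not yet known to be a semimartingale.
  choose T hT1 hT2 using fun n : ℕ => exists_fine_grid hg hg (ε := (1 / 2) ^ (n + 1)) (by positivity)
  have hT : ∀ n, IsPartition (T n) := fun n => ⟨(hT1 n).stopping, (hT1 n).zero, (hT1 n).mono,
    hYp.quasiAlways_real.mono fun t ω h => (hT2 n ω t (hcontf t ω h) (hcontf t ω h)).2.2⟩
  have hosc : ∀ n t ω, InDom Y t ω →
      OscLE (fun k => T n k ω) (fun s => Real.log (val Y s ω)) ((1 / 2) ^ (n + 1)) t :=
    fun n t ω ht k u v h1 h2 h3 h4 h5 h6 => by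
      have := (hT2 n ω t (hcontf t ω ht) (hcontf t ω ht)).1 k u v h1 h2 h3 h4 h5 h6
      beta_reduce at this ⊢
      rwa [hfe u ω (hYp.down h5 ht), hfe v ω (hYp.down h6 ht)]
  have hXm := fun n => isContinuousMartingale_logApprox (c := c) hY hf (hT n)
  set L := ucLimit fun n => logApprox Y f c (T n) with hL
  have hLm : IsContinuousMartingale L := isContinuousMartingale_ucLimit hXm
    (hY.quasiAlways_logApprox hpos hf hfe hc hT hosc)
  have hLp := hLm.isContinuous
  have hLY : ∀ t ω, InDom L t ω → InDom Y t ω ∧ ∀ n, (t : ℝ≥0∞) < ⨆ k, T n k ω :=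
    fun t ω ht => ⟨(inDom_mkProc.mp ((inDom_ucLimit.mp ht).1 0)).1,
      fun n => (inDom_mkProc.mp ((inDom_ucLimit.mp ht).1 n)).2⟩
  set Z : ExtProc M := mkProc (InDom L) fun t ω => Real.log (val Y t ω) with hZ
  set A : ExtProc M := mkProc (InDom L) fun t ω => Real.log (val Y t ω) - val L t ω with hA
  have hZv : ∀ t ω, InDom L t ω → ∀ s ≤ t, val Z s ω = Real.log (val Y s ω) :=
    fun t ω ht s hs => val_mkProc (hLp.down hs ht)
  have hAv : ∀ t ω, InDom L t ω → ∀ s ≤ t, val A s ω = Real.log (val Y s ω) - val L s ω :=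
    fun t ω ht s hs => val_mkProc (hLp.down hs ht)
  have hZp : IsContinuousProcess Z := by
    refine .of_isEffDomain (by rw [hZ, inDom_mkProc_eq]; exact hLp.isEffDomain)
      (fun t ω ω' hω ht => ?_) fun t ω ht => ?_
    · have ht := inDom_mkProc.mp ht
      rw [hZv t ω ht t le_rfl, hZv t ω' ((hLp.isEffDomain.adapted t ω ω' hω).mp ht) t le_rfl,
        hYp.val_adapted hω]
    · have ht := inDom_mkProc.mp ht
      exact (hcont t ω (hLY t ω ht).1).congr fun s hs => hZv t ω ht s hs.2
  have hAp : IsContinuousProcess A := by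
    refine .of_isEffDomain (by rw [hA, inDom_mkProc_eq]; exact hLp.isEffDomain)
      (fun t ω ω' hω ht => ?_) fun t ω ht => ?_
    · have ht := inDom_mkProc.mp ht
      rw [hAv t ω ht t le_rfl, hAv t ω' ((hLp.isEffDomain.adapted t ω ω' hω).mp ht) t le_rfl,
        hYp.val_adapted hω, hLp.val_adapted hω]
    · have ht := inDom_mkProc.mp ht
      exact ((hcont t ω (hLY t ω ht).1).sub (hLp.continuousOn_Icc ht)).congr
        fun s hs => hAv t ω ht s hs.2
  have hoscZ : ∀ t ω, InDom L t ω → ∀ n,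
      OscLE (fun k => T n k ω) (fun s => val Z s ω) ((1 / 2) ^ (n + 1)) t :=
    fun t ω ht n k u v h1 h2 h3 h4 h5 h6 => by
      have := hosc n t ω (hLY t ω ht).1 k u v h1 h2 h3 h4 h5 h6
      beta_reduce at this ⊢
      rwa [hZv t ω ht u h5, hZv t ω ht v h6]
  -- Convergence of the integrals forces that of the sums of squares, with limit 2(L - ln Y). So A =
  -- ln Y - L is -1/2 times a monotone process.
  have hQ : ∀ t ω, InDom L t ω → TendstoUniformlyOn
      (fun n s => qvar (fun k => T n k ω) (fun s => val Z s ω) s)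
      (fun s => 2 * (val L s ω - Real.log (val Y s ω))) atTop (Set.Icc 0 t) := fun t ω ht => by
    obtain ⟨B, hB⟩ := isCompact_Icc.exists_bound_of_continuousOn
      ((hLp.continuousOn_Icc ht).sub (hcont t ω (hLY t ω ht).1))
    refine tendstoUniformlyOn_of_approx (e := fun n => (1 / 2) ^ (n + 1))
      (tendsto_ucLimit (fun n => (hXm n).isContinuous) ht) hB (tendsto_half_pow 1)
      (fun n => by positivity) (fun _ _ => qvar_nonneg _ _ _) fun n s hs => ?_
    have e : qvar (fun k => T n k ω) (fun s => val Z s ω) s =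
        qvar (fun k => T n k ω) (fun s => Real.log (val Y s ω)) s := by
      rw [qvar_eq_patch ((hT n).mono ω), qvar_eq_patch ((hT n).mono ω)]
      refine patch_congr ((hT n).mono ω) fun k u v hu huv _ hv => ?_
      have hvt := hv.trans hs.2
      rw [← hu, ENNReal.toNNReal_coe, hZv t ω ht v hvt, hZv t ω ht u (huv.trans hvt)]
    have hsL := hLY s ω (hLp.down hs.2 ht)
    rw [e]
    exact abs_logApprox_sub_le hYp hpos hfe hc (hT1 n) hsL.1 (hsL.2 n) (hosc n s ω hsL.1) (hle _)
  have hqd : ∀ t ω, InDom L t ω → QuadDom T Z t ω := fun t ω ht =>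
    ⟨inDom_mkProc.mpr ht, (hLY t ω ht).2, _, hQ t ω ht⟩
  have hAq : ∀ t ω, InDom L t ω → ∀ s ≤ t, val A s ω = (-1 / 2) * val (quadVar T Z) s ω :=
    fun t ω ht s hs => by
      have := tendsto_nhds_unique ((tendsto_quadVar hZp (hqd t ω ht)).tendsto_at (x := s) ⟨bot_le, hs⟩)
        ((hQ t ω ht).tendsto_at ⟨bot_le, hs⟩)
      rw [this, hAv t ω ht s hs]
      ring
  have hAfv : IsFiniteVariation A := by
    refine ⟨hAp, fun ω => ?_, fun t ω ht => ?_⟩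
    · have h0 := hLp.zero_mem ω
      have h1 := hAq 0 ω h0 0 le_rfl
      rw [quadVar_zero hZp (hqd 0 ω h0), mul_zero] at h1
      have h2 : InDom A 0 ω := inDom_mkProc.mpr h0
      obtain ⟨a, ha⟩ := Option.isSome_iff_exists.mp h2
      rw [val, ha, Option.getD_some] at h1
      rw [ha, h1]
    · have ht := inDom_mkProc.mp ht
      exact boundedVariationOn_congr (boundedVariationOn_const_mul (boundedVariationOn_of_monotoneOn
        (quadVar_monotoneOn hZp hT1 (tendsto_half_pow 1) (hoscZ t ω ht) (hqd t ω ht))) (-1 / 2))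
        fun s hs => hAq t ω ht s hs.2
  have hdec : IsStandardDecomposition Z L A :=
    ⟨hZp, hLm, hAfv, fun _ _ => inDom_mkProc, fun _ _ => inDom_mkProc.trans inDom_mkProc.symm,
      fun t ω ht => by
        have ht := inDom_mkProc.mp ht
        rw [hZv t ω ht t le_rfl, hAv t ω ht t le_rfl]; ring⟩
  obtain ⟨l, hl, hle'⟩ := hLm.exists_version
  -- New partitions are needed, fine for both `L` and `A`.
  obtain ⟨T', h1, h2⟩ := exists_isFine_pair hLp hAp (fun _ _ => inDom_mkProc.symm) hl
    (hg.comp₂ hl (φ := fun a b => a - b) (by fun_prop)) hle' fun t ω ht => by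
      have ht := inDom_mkProc.mp ht
      rw [hAv t ω ht t le_rfl, hle' t ω ht, hfe t ω (hLY t ω ht).1]
  exact ⟨Z, T', ⟨⟨L, A, hdec⟩, fun t ω ht => ⟨(hLY t ω (inDom_mkProc.mp ht)).1,
    hZv t ω (inDom_mkProc.mp ht) t le_rfl⟩⟩, L, A, hdec, h1, h2⟩

/-! ### The exponential and the logarithm are inverse to each other -/

lemma IsContinuousMartingale.sub_restrict {X Y : ExtProc M} (hX : IsContinuousMartingale X)
    (hY : IsContinuousMartingale Y) {D : ℝ≥0 → M.Omega → Prop} (hD : IsEffDomain D)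
    (hDX : ∀ t ω, D t ω → InDom X t ω) (hDY : ∀ t ω, D t ω → InDom Y t ω) :
    IsContinuousMartingale (mkProc D fun t ω => val X t ω - val Y t ω) :=
  (hX.add (hY.const_mul (-1))).restrict hD
    (fun t ω h => inDom_mkProc.mpr ⟨hDX t ω h, inDom_mkProc.mpr (hDY t ω h)⟩) fun t ω h => by
      rw [val_mkProc ⟨hDX t ω h, inDom_mkProc.mpr (hDY t ω h)⟩, val_mkProc (hDY t ω h)]
      ring

/-- If the difference of two continuous martingales is of finite variation and starts from `0`,
the martingales coincide quasi-always. -/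
lemma IsContinuousMartingale.quasiAlways_eq {X Y : ExtProc M} (hX : IsContinuousMartingale X)
    (hY : IsContinuousMartingale Y) {D : ℝ≥0 → M.Omega → Prop} (hD : IsEffDomain D)
    (hDX : ∀ t ω, D t ω → InDom X t ω) (hDY : ∀ t ω, D t ω → InDom Y t ω)
    {a : ℝ≥0 → M.Omega → ℝ} (ha : ∀ t ω, D t ω → val X t ω - val Y t ω = a t ω)
    (ha0 : ∀ ω, D 0 ω → a 0 ω = 0)
    (hbv : ∀ t ω, D t ω → BoundedVariationOn (fun s => a s ω) (Set.Icc 0 t)) :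
    QuasiAlways fun t ω => D t ω ∧ ∀ s ≤ t, val X s ω = val Y s ω := by
  refine ((hX.sub_restrict hY hD hDX hDY).quasiAlways_eq_zero (fun ω => ?_)
    fun t ω ht => ?_).mono fun t ω ht => ?_
  · have h0 := hD.quasiAlways.at_zero ω
    rw [val_mkProc h0, ha 0 ω h0, ha0 ω h0]
  · have ht := inDom_mkProc.mp ht
    refine boundedVariationOn_congr (hbv t ω ht) fun s hs => ?_
    have hs := hD.down ω s t hs.2 ht
    rw [val_mkProc hs, ha s ω hs]
  · have h1 := inDom_mkProc.mp ht.1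
    refine ⟨h1, fun s hs => sub_eq_zero.mp ?_⟩
    rw [← ht.2 s hs, val_mkProc (hD.down ω s t hs h1)]

/-- Since Z = X - [X]/2, the martingale Z + [Z]/2 differs from X by ([Z] - [X])/2, which is of
finite variation and starts from 0. It is immaterial that the two brackets are taken along different
partitions. -/
theorem quasiAlways_doleansLog_doleansExp {X Z : ExtProc M} (hX : IsContinuousMartingale X)
    {T T' : ℕ → ℕ → M.Omega → ℝ≥0∞} (hT : IsFine T X)
    (hZ : IsLogSemimartingale (doleansExp T X) Z) (hT' : IsFineForSemimartingale T' Z) :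
    QuasiAlways fun t ω => doleansLog T' Z t ω = X t ω := by
  have hXp := hX.isContinuous
  have hE := isContinuousMartingale_doleansExp hX hT
  have hEv : ∀ t ω, InDom (doleansExp T X) t ω → QuadDom T X t ω ∧
      val (doleansExp T X) t ω = Real.exp (val X t ω - val (quadVar T X) t ω / 2) := fun t ω h => by
    rw [doleansExp_eq hXp, inDom_mkProc] at h
    rw [doleansExp_eq hXp, val_mkProc h]
    exact ⟨h, rfl⟩
  have hL := isContinuousMartingale_doleansLog hE (fun t ω h => by
    rw [(hEv t ω h).2]; exact Real.exp_pos _) hZ hT'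
  obtain ⟨N, A, hd, hTN, hTA⟩ := hT'
  have hZp := hd.1
  have hZv : ∀ t ω, InDom Z t ω → QuadDom T X t ω ∧
      val Z t ω = val X t ω - val (quadVar T X) t ω / 2 := fun t ω h => by
    have h1 := hZ.2 t ω h
    have h2 := hEv t ω h1.1
    exact ⟨h2.1, by rw [h1.2, h2.2, Real.log_exp]⟩
  have hLd : ∀ t ω, QuadDom T' Z t ω → InDom (doleansLog T' Z) t ω := fun t ω h => by
    rw [doleansLog_eq hZp]; exact inDom_mkProc.mpr h
  have main := hL.quasiAlways_eq hX (hd.isEffDomain_quadDom hTN hTA) hLd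
    (fun t ω h => (hZv t ω h.1).1.1)
    (a := fun t ω => 1 / 2 * val (quadVar T' Z) t ω + (-1 / 2) * val (quadVar T X) t ω)
    (fun t ω h => by rw [doleansLog_eq hZp, val_mkProc h, (hZv t ω h.1).2]; ring)
    (fun ω h => by rw [quadVar_zero hZp h, quadVar_zero hXp (hZv 0 ω h.1).1]; ring)
    fun t ω h => by
      have hq := (hZv t ω h.1).1
      exact boundedVariationOn_add
        (boundedVariationOn_const_mul (boundedVariationOn_of_monotoneOn (quadVar_monotoneOn hZp
          hTN.isGrid (tendsto_half_pow 0) (fun n => hd.oscLE hTN hTA n h.1) h)) _)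
        (boundedVariationOn_const_mul (boundedVariationOn_of_monotoneOn (quadVar_monotoneOn hXp
          hT.isGrid (tendsto_half_pow 1) (fun n => hT.oscLE hXp n hq.1) hq)) _)
  refine main.mono fun t ω h => extProc_eq_iff.mpr ⟨iff_of_true (hLd t ω h.1) (hZv t ω h.1.1).1.1,
    fun _ => h.2 t le_rfl⟩

/-- Requiring coincidence on all of `[0, t]` makes the set closed downwards in time, so that
martingales can be restricted to it. -/
lemma IsEffDomain.eq_upTo {X Y : ExtProc M} (hX : IsContinuousProcess X)
    (hY : IsContinuousProcess Y) {D : ℝ≥0 → M.Omega → Prop} (hD : IsEffDomain D)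
    (h : QuasiAlways fun t ω => D t ω ∧ ∀ s ≤ t, val X s ω = val Y s ω) :
    IsEffDomain fun t ω => D t ω ∧ ∀ s ≤ t, val X s ω = val Y s ω := by
  refine ⟨fun t ω ω' hω => and_congr (hD.adapted t ω ω' hω) (forall₂_congr fun s hs => ?_), h,
    fun ω s t hst h => ⟨hD.down ω s t hst h.1, fun u hu => h.2 u (hu.trans hst)⟩⟩
  have hs : AgreeUpTo ω ω' s := hω.mono (by exact_mod_cast hs)
  rw [hX.val_adapted hs, hY.val_adapted hs]

/-- Continuous martingales that coincide quasi-always have the same quadratic variation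
quasi-always. -/
lemma IsContinuousMartingale.quasiAlways_quadVar_eq {X Y : ExtProc M}
    (hX : IsContinuousMartingale X) (hY : IsContinuousMartingale Y)
    {T S : ℕ → ℕ → M.Omega → ℝ≥0∞} (hT : IsFine T X) (hS : IsFine S Y)
    {D : ℝ≥0 → M.Omega → Prop} (hD : IsEffDomain D)
    (h : QuasiAlways fun t ω => D t ω ∧ ∀ s ≤ t, val X s ω = val Y s ω) :
    QuasiAlways fun t ω => (QuadDom T X t ω ∧ QuadDom S Y t ω) ∧
      val (quadVar T X) t ω = val (quadVar S Y) t ω := by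
  have hXp := hX.isContinuous
  have hYp := hY.isContinuous
  have hE := ((isEffDomain_quadDom hXp hT.isGrid (hX.quasiAlways_quadDom hT)).and
    (isEffDomain_quadDom hYp hS.isGrid (hY.quasiAlways_quadDom hS))).and (hD.eq_upTo hXp hYp h)
  -- X² - [X] and Y² - [Y] are martingales; where X = Y the squares cancel and a difference of two
  -- monotone processes remains, for whichever partitions.
  have hv : ∀ t ω, ((QuadDom T X t ω ∧ QuadDom S Y t ω) ∧ D t ω ∧ ∀ s ≤ t, val X s ω = val Y s ω) →
      val (mkProc (QuadDom T X) fun t ω => val X t ω ^ 2 - val (quadVar T X) t ω) t ω -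
        val (mkProc (QuadDom S Y) fun t ω => val Y t ω ^ 2 - val (quadVar S Y) t ω) t ω =
      (-1) * val (quadVar T X) t ω + val (quadVar S Y) t ω := fun t ω ht => by
    rw [val_mkProc ht.1.1, val_mkProc ht.1.2, ht.2.2 t le_rfl]; ring
  have main := (hX.sq_sub_quadVar hT).quasiAlways_eq (hY.sq_sub_quadVar hS) hE
    (fun t ω ht => inDom_mkProc.mpr ht.1.1) (fun t ω ht => inDom_mkProc.mpr ht.1.2)
    hv (fun ω ht => by rw [quadVar_zero hXp ht.1.1, quadVar_zero hYp ht.1.2]; ring)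
    fun t ω ht => boundedVariationOn_add
      (boundedVariationOn_const_mul (boundedVariationOn_of_monotoneOn (quadVar_monotoneOn hXp
        hT.isGrid (tendsto_half_pow 1) (fun n => hT.oscLE hXp n ht.1.1.1) ht.1.1)) _)
      (boundedVariationOn_of_monotoneOn (quadVar_monotoneOn hYp
        hS.isGrid (tendsto_half_pow 1) (fun n => hS.oscLE hYp n ht.1.2.1) ht.1.2))
  refine main.mono fun t ω ht => ⟨ht.1.1, ?_⟩
  have h1 := hv t ω ht.1
  rw [ht.2 t le_rfl] at h1
  linarith

/-- Let Z = N + A. The martingales L = Z + [Z]/2 and N differ by A + [Z]/2, of finite variation and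
starting from 0, so L = N and [L] = [N] = [Z] quasi-always. Then exp(L - [L]/2) = exp(Z) = Y. -/
theorem quasiAlways_doleansExp_doleansLog {Y Z : ExtProc M} (hY : IsContinuousMartingale Y)
    (hpos : IsPositive Y) {T T' : ℕ → ℕ → M.Omega → ℝ≥0∞} (hZ : IsLogSemimartingale Y Z)
    (hT : IsFineForSemimartingale T Z) (hT' : IsFine T' (doleansLog T Z)) :
    QuasiAlways fun t ω => doleansExp T' (doleansLog T Z) t ω = Y t ω := by
  have hL := isContinuousMartingale_doleansLog hY hpos hZ hT
  have hLp := hL.isContinuous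
  obtain ⟨N, A, hd, hTN, hTA⟩ := hT
  have hZp := hd.1
  have hD := hd.isEffDomain_quadDom hTN hTA
  have hLd : ∀ t ω, InDom (doleansLog T Z) t ω ↔ QuadDom T Z t ω := fun t ω => by
    rw [doleansLog_eq hZp]; exact inDom_mkProc
  have hLv : ∀ t ω, QuadDom T Z t ω →
      val (doleansLog T Z) t ω = val Z t ω + val (quadVar T Z) t ω / 2 := fun t ω h => by
    rw [doleansLog_eq hZp, val_mkProc h]
  have h1 := hL.quasiAlways_eq hd.2.1 hD (fun t ω => (hLd t ω).mpr)
    (fun t ω h => (hd.2.2.2.1 t ω).mp h.1)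
    (a := fun t ω => val A t ω + 1 / 2 * val (quadVar T Z) t ω)
    (fun t ω h => by rw [hLv t ω h, hd.2.2.2.2.2 t ω h.1]; ring)
    (fun ω h => by
      rw [quadVar_zero hZp h, val, hd.2.2.1.2.1 ω, Option.getD_some]; ring)
    fun t ω h => boundedVariationOn_add (hd.2.2.1.2.2 t ω ((hd.2.2.2.2.1 t ω).mp h.1))
      (boundedVariationOn_const_mul (boundedVariationOn_of_monotoneOn (quadVar_monotoneOn hZp
        hTN.isGrid (tendsto_half_pow 0) (fun n => hd.oscLE hTN hTA n h.1) h)) _)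
  refine (hL.quasiAlways_quadVar_eq hd.2.1 hT' hTN hD h1).mono fun t ω h => ?_
  have hq := (hLd t ω).mp h.1.1.1
  have hYv := hZ.2 t ω hq.1
  rw [doleansExp_eq hLp]
  refine extProc_eq_iff.mpr ⟨iff_of_true (inDom_mkProc.mpr h.1.1) hYv.1, fun _ => ?_⟩
  rw [val_mkProc h.1.1, h.2, hLv t ω hq, hd.val_quadVar hTN hTA hq, add_sub_cancel_right, hYv.2,
    Real.exp_log (hpos t ω hYv.1)]

end Market

end

theorem mainTheorem8 (M : Market) :
    -- the Doléans exponential of a continuous martingale is a continuous martingale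
    (∀ X : M.ExtProc, Market.IsContinuousMartingale X →
      (∃ T, Market.IsFine T X) ∧
      ∀ T, Market.IsFine T X → Market.IsContinuousMartingale (Market.doleansExp T X)) ∧
    -- the Doléans logarithm of a positive continuous martingale is a continuous martingale
    (∀ Y : M.ExtProc, Market.IsContinuousMartingale Y → Market.IsPositive Y →
      (∃ Z T, Market.IsLogSemimartingale Y Z ∧ Market.IsFineForSemimartingale T Z) ∧
      ∀ Z T, Market.IsLogSemimartingale Y Z → Market.IsFineForSemimartingale T Z →
        Market.IsContinuousMartingale (Market.doleansLog T Z)) ∧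
    -- the logarithm of the exponential of `X` is `X` quasi-always
    (∀ X : M.ExtProc, Market.IsContinuousMartingale X →
      ∀ T, Market.IsFine T X →
      ∀ Z T', Market.IsLogSemimartingale (Market.doleansExp T X) Z →
        Market.IsFineForSemimartingale T' Z →
        Market.QuasiAlways fun t ω => Market.doleansLog T' Z t ω = X t ω) ∧
    -- the exponential of the logarithm of `Y` is `Y` quasi-always
    (∀ Y : M.ExtProc, Market.IsContinuousMartingale Y → Market.IsPositive Y →
      ∀ Z T, Market.IsLogSemimartingale Y Z → Market.IsFineForSemimartingale T Z →
      ∀ T', Market.IsFine T' (Market.doleansLog T Z) →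
        Market.QuasiAlways fun t ω => Market.doleansExp T' (Market.doleansLog T Z) t ω = Y t ω) := by
  exact ⟨fun X hX => ⟨hX.exists_isFine, fun T hT => Market.isContinuousMartingale_doleansExp hX hT⟩,
    fun Y hY hpos => ⟨Market.exists_isLogSemimartingale hY hpos, fun Z T hZ hT =>
      Market.isContinuousMartingale_doleansLog hY hpos hZ hT⟩,
    fun X hX T hT Z T' hZ hT' => Market.quasiAlways_doleansLog_doleansExp hX hT hZ hT',
    fun Y hY hpos Z T hZ hT T' hT' =>
      Market.quasiAlways_doleansExp_doleansLog hY hpos hZ hT hT'⟩
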